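/- **Setting.** Let $q_1,q_2,q_3\in\mathbb C$ with $q_1q_2q_3=1$, let $u\in\mathbb C^\times$, $n\ge 2$, $r\ge 2$, and let $a_1,\dots,a_n\in\mathbb Z_{\ge 0}$ with $\sum_{i=1}^n a_i=r$. Assume $q_1^{n+r}q_3^{n+1}=1$ in the precise sense that, for $x,y\in\mathbb Z$, $q_1^xq_3^y=1$ if and only if $(x,y)=\kappa\,(n+r,n+1)$ for some $\kappa\in\mathbb Z$ (so no $q_i$ is a root of unity). *The algebra.* Put $g(z,w)=(z-q_1w)(z-q_2w)(z-q_3w)$. $\mathcal E$ is the associative unital $\mathbb C$-algebra with generators $e_i,f_i$ ($i\in\mathbb Z$), $\psi^+_i,\psi^-_{-i}$ ($i\ge0$), $(\psi^\pm_0)^{-1}$ and, with $e(z)=\sum e_iz^{-i}$, $f(z)=\sum f_iz^{-i}$, $\psi^\pm(z)=\sum_{\pm i\ge0}\psi^\pm_iz^{-i}$, $\delta(z)=\sum_{m\in\mathbb Z}z^m$, the relations $$g(z,w)e(z)e(w)=-g(w,z)e(w)e(z),\quad g(w,z)f(z)f(w)=-g(z,w)f(w)f(z),$$ $$g(z,w)\psi^\pm(z)e(w)=-g(w,z)e(w)\psi^\pm(z),\quad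 g(w,z)\psi^\pm(z)f(w)=-g(z,w)f(w)\psi^\pm(z),$$ $$[e(z),f(w)]=\tfrac{\delta(z/w)}{g(1,1)}(\psi^+(z)-\psi^-(z)),\quad [e_0,[e_1,e_{-1}]]=[f_0,[f_1,f_{-1}]]=0,$$ all $\psi^\pm_i$ commute with each other, and $\psi_0^\pm(\psi_0^\pm)^{-1}=(\psi_0^\pm)^{-1}\psi_0^\pm=1$. It is graded by $\deg e_i=1$, $\deg f_i=-1$, $\deg\psi^\pm_i=0$. *Notation.* For parameters $(q_1,q_2,q_3)$, a non-increasing integer sequence $\lambda=(\lambda_s)_{s\ge1}$ and $w\in\mathbb C^\times$ put, with $x=q_1^{\lambda_s}q_3^{s-1}w/z$, $$\Psi_s(\lambda,w;z)=\frac{(1-q_2x)(1-q_3x)}{(1-x)(1-q_1^{-1}x)},$$ and $\phi_q(x)=\frac{1-qx}{1-x}$. A rational function times a delta function means $F(z)\delta(v/z)=F(v)\delta(v/z)$, after cancelling common factors of numerator and denominator. $\mathbf 1_s$ is the sequence with $1$ at place $s$ and $0$ elsewhere. $\psi^+(z)$, resp. $\psi^-(z)$, acts by the expansion at $z=\infty$,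 resp. $z=0$, of the rational function given; all matrix coefficients not listed are $0$. *The module $\mathcal M=\mathcal M^{n+r,n+1}_{\boldsymbol a,\boldsymbol 0}(u)$* (case $\boldsymbol b=0$). Its basis consists of $|\boldsymbol\lambda\rangle$, where $\boldsymbol\lambda=(\lambda^{(1)},\dots,\lambda^{(n)})$ are partitions with finitely many non-zero parts such that, for all $s\ge1$, $\lambda^{(i)}_s\ge\lambda^{(i+1)}_s-a_i$ for $1\le i\le n-1$ and $\lambda^{(n)}_s\ge\lambda^{(1)}_{s+1}-a_n$. The degree of $|\boldsymbol\lambda\rangle$ is $\sum_{i,s}\lambda^{(i)}_s$. The action has the matrix coefficients of the tensor product of the Fock modules $\mathcal F(u_1)\otimes\dots\otimes\mathcal F(u_n)$, where $u_1=u$, $u_i=u_{i+1}q_1^{a_i+1}q_3$: with $\Psi_{\lambda}(w;z)=\phi_{q_2}(w/z)\prod_{s\ge1}\frac{\Psi_s(\lambda,w;z)}{\Psi_s(\emptyset,w;z)}$ and $v=q_1^{\lambda^{(i)}_s}q_3^{s-1}u_i$, $$\langle\boldsymbol\lambda+\mathbf 1^{(i)}_s|e(z)|\boldsymbol\lambda\rangle=\frac{\delta(v/z)}{1-q_1}\prod_{j<i}\Psi_{\lambda^{(j)}}(u_j;z)\prod_{t<s}\Psi_t(\lambda^{(i)},u_i;z),$$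 $$\langle\boldsymbol\lambda|f(z)|\boldsymbol\lambda+\mathbf 1^{(i)}_s\rangle=\frac{q_1\delta(v/z)}{1-q_1}\,\phi_{q_2}(u_iq_3^s/z)\prod_{t>s}\frac{\Psi_t(\lambda^{(i)},u_i;z)}{\Psi_t(\emptyset,u_i;z)}\prod_{j>i}\Psi_{\lambda^{(j)}}(u_j;z),$$ $$\langle\boldsymbol\lambda|\psi^\pm(z)|\boldsymbol\lambda\rangle=\prod_{j}\Psi_{\lambda^{(j)}}(u_j;z).$$ *The module $G=G^{n,r}_{\boldsymbol a}(u)$.* Let $c_i=a_1+\dots+a_i$ and $\Lambda^0_{\nu n+i+1}=-\nu r-c_i$ for $\nu\ge0$, $0\le i\le n-1$. The basis of $G$ consists of $|\Lambda\rangle$ for the $(n,r)$-admissible partitions: non-increasing integer sequences $\Lambda=(\Lambda_j)_{j\ge1}$ with $\Lambda_j-\Lambda_{j+n}\ge r$ for all $j$ and $\Lambda_j=\Lambda^0_j$ for all large $j$. The degree of $|\Lambda\rangle$ is $\sum_j(\Lambda_j-\Lambda^0_j)$. Let $\Psi'_j$ denote $\Psi_j$ with $q_2$ and $q_3$ interchanged.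 With $v=q_1^{\Lambda_j}q_2^{j-1}u$, the action is $$\langle\Lambda+\mathbf 1_j|e(z)|\Lambda\rangle=\frac{\delta(v/z)}{1-q_1}\prod_{t<j}\Psi'_t(\Lambda,u;z),$$ $$\langle\Lambda|f(z)|\Lambda+\mathbf 1_j\rangle=\frac{q_1\delta(v/z)}{1-q_1}\prod_{t>j}\frac{\Psi'_t(\Lambda,u;z)}{\Psi'_t(\Lambda^0,u;z)}\prod_{m=0}^{n-1}\phi_{q_2}\!\left(uq_1^{\Lambda^0_{j+m+1}}q_2^{j+m}/z\right),$$ $$\langle\Lambda|\psi^\pm(z)|\Lambda\rangle=\prod_{m=0}^{n-1}\phi_{q_2}\!\left(uq_1^{-c_m}q_2^m/z\right)\prod_{t\ge1}\frac{\Psi'_t(\Lambda,u;z)}{\Psi'_t(\Lambda^0,u;z)}.$$ **Theorem.** These formulas define graded $\mathcal E$-modules $\mathcal M$ and $G$. The assignment $\boldsymbol\lambda\mapsto\Lambda$, $$\Lambda_{ns+i}=\lambda^{(i)}_{s+1}+\Lambda^0_{ns+i}\qquad(1\le i\le n,\ s\ge0),$$ is a bijection between the two labelling sets, and there exist non-zero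 constants $c_\Lambda$ such that the linear map $\iota:\mathcal M\to G$, $\iota|\boldsymbol\lambda\rangle=c_\Lambda|\Lambda\rangle$, is an isomorphism of graded $\mathcal E$-modules. -/

import Mathlib

noncomputable section

namespace QuantumGl

open Finset

/-! ### The algebra `E` -/

/-- Generators: `e_i`, `f_i` (`i ∈ ℤ`), `ψ⁺_i`, `ψ⁻_{-i}` (`i ≥ 0`), and the inverses of `ψ⁺_0`
and `ψ⁻_0`. -/
inductive Gen : Type
  | e (i : ℤ)
  | f (i : ℤ)
  | psiPlus (i : ℕ)
  | psiMinus (i : ℕ)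
  | psiPlusInv
  | psiMinusInv

/-- Degrees: `deg e_i = 1`, `deg f_i = -1`, `deg ψ = 0`. -/
def Gen.deg : Gen → ℤ
  | .e _ => 1
  | .f _ => -1
  | _ => 0

/-- The free algebra on the generators. -/
abbrev Free : Type := FreeAlgebra ℂ Gen

/-- Coefficient of `z^{-i}` in `e(z)`. -/
def eS (i : ℤ) : Free := FreeAlgebra.ι ℂ (Gen.e i)

/-- Coefficient of `z^{-i}` in `f(z)`. -/
def fS (i : ℤ) : Free := FreeAlgebra.ι ℂ (Gen.f i)

/-- Coefficient of `z^{-i}` in `ψ⁺(z)` (zero for `i < 0`). -/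
def psiPlusS (i : ℤ) : Free := if 0 ≤ i then FreeAlgebra.ι ℂ (Gen.psiPlus i.toNat) else 0

/-- Coefficient of `z^{-i}` in `ψ⁻(z)` (zero for `i > 0`). -/
def psiMinusS (i : ℤ) : Free := if i ≤ 0 then FreeAlgebra.ι ℂ (Gen.psiMinus (-i).toNat) else 0

/-- Coefficient of `z^{-i} w^{-j}` in `g(z,w) ∑ F_{ij} z^{-i} w^{-j}`, where
`g(z,w) = (z - q₁w)(z - q₂w)(z - q₃w)`. -/
def gzw (q1 q2 q3 : ℂ) (F : ℤ → ℤ → Free) (i j : ℤ) : Free :=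
  F (i + 3) j - (q1 + q2 + q3) • F (i + 2) (j + 1)
    + (q1 * q2 + q1 * q3 + q2 * q3) • F (i + 1) (j + 2) - (q1 * q2 * q3) • F i (j + 3)

/-- Coefficient of `z^{-i} w^{-j}` in `g(w,z) ∑ F_{ij} z^{-i} w^{-j}`. -/
def gwz (q1 q2 q3 : ℂ) (F : ℤ → ℤ → Free) (i j : ℤ) : Free :=
  F i (j + 3) - (q1 + q2 + q3) • F (i + 1) (j + 2)
    + (q1 * q2 + q1 * q3 + q2 * q3) • F (i + 2) (j + 1) - (q1 * q2 * q3) • F (i + 3) j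

/-- Commutator in the free algebra. -/
def comm (x y : Free) : Free := x * y - y * x

/-- The defining relations of `E`, coefficient by coefficient. -/
inductive Rel (q1 q2 q3 : ℂ) : Free → Free → Prop
  /-- `g(z,w) e(z) e(w) = -g(w,z) e(w) e(z)` -/
  | ee (i j : ℤ) : Rel q1 q2 q3
      (gzw q1 q2 q3 (fun i j => eS i * eS j) i j) (-gwz q1 q2 q3 (fun i j => eS j * eS i) i j)
  /-- `g(w,z) f(z) f(w) = -g(z,w) f(w) f(z)` -/
  | ff (i j : ℤ) : Rel q1 q2 q3
      (gwz q1 q2 q3 (fun i j => fS i * fS j) i j) (-gzw q1 q2 q3 (fun i j => fS j * fS i) i j)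
  /-- `g(z,w) ψ^±(z) e(w) = -g(w,z) e(w) ψ^±(z)` -/
  | psiPlus_e (i j : ℤ) : Rel q1 q2 q3
      (gzw q1 q2 q3 (fun i j => psiPlusS i * eS j) i j)
      (-gwz q1 q2 q3 (fun i j => eS j * psiPlusS i) i j)
  | psiMinus_e (i j : ℤ) : Rel q1 q2 q3
      (gzw q1 q2 q3 (fun i j => psiMinusS i * eS j) i j)
      (-gwz q1 q2 q3 (fun i j => eS j * psiMinusS i) i j)
  /-- `g(w,z) ψ^±(z) f(w) = -g(z,w) f(w) ψ^±(z)` -/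
  | psiPlus_f (i j : ℤ) : Rel q1 q2 q3
      (gwz q1 q2 q3 (fun i j => psiPlusS i * fS j) i j)
      (-gzw q1 q2 q3 (fun i j => fS j * psiPlusS i) i j)
  | psiMinus_f (i j : ℤ) : Rel q1 q2 q3
      (gwz q1 q2 q3 (fun i j => psiMinusS i * fS j) i j)
      (-gzw q1 q2 q3 (fun i j => fS j * psiMinusS i) i j)
  /-- `[e(z), f(w)] = δ(z/w) (ψ⁺(z) - ψ⁻(z)) / g(1,1)` -/
  | ef (i j : ℤ) : Rel q1 q2 q3
      (comm (eS i) (fS j))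
      (((1 - q1) * (1 - q2) * (1 - q3))⁻¹ • (psiPlusS (i + j) - psiMinusS (i + j)))
  | psiPlus_psiPlus (i j : ℤ) : Rel q1 q2 q3 (comm (psiPlusS i) (psiPlusS j)) 0
  | psiMinus_psiMinus (i j : ℤ) : Rel q1 q2 q3 (comm (psiMinusS i) (psiMinusS j)) 0
  | psiPlus_psiMinus (i j : ℤ) : Rel q1 q2 q3 (comm (psiPlusS i) (psiMinusS j)) 0
  | psiPlus_inv : Rel q1 q2 q3 (psiPlusS 0 * FreeAlgebra.ι ℂ Gen.psiPlusInv) 1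
  | inv_psiPlus : Rel q1 q2 q3 (FreeAlgebra.ι ℂ Gen.psiPlusInv * psiPlusS 0) 1
  | psiMinus_inv : Rel q1 q2 q3 (psiMinusS 0 * FreeAlgebra.ι ℂ Gen.psiMinusInv) 1
  | inv_psiMinus : Rel q1 q2 q3 (FreeAlgebra.ι ℂ Gen.psiMinusInv * psiMinusS 0) 1
  | serre_e : Rel q1 q2 q3 (comm (eS 0) (comm (eS 1) (eS (-1)))) 0
  | serre_f : Rel q1 q2 q3 (comm (fS 0) (comm (fS 1) (fS (-1)))) 0

/-- Quantum continuous `gl_∞`. -/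
abbrev Alg (q1 q2 q3 : ℂ) : Type := RingQuot (Rel q1 q2 q3)

/-- The image of a generator in `E`. -/
def gen (q1 q2 q3 : ℂ) (x : Gen) : Alg q1 q2 q3 :=
  RingQuot.mkAlgHom ℂ (Rel q1 q2 q3) (FreeAlgebra.ι ℂ x)

/-- The homogeneous component of degree `d` of `E`, spanned by the words of degree `d`. -/
def algGrade (q1 q2 q3 : ℂ) (d : ℤ) : Submodule ℂ (Alg q1 q2 q3) :=
  Submodule.span ℂ {x | ∃ w : List Gen,
    (w.map Gen.deg).sum = d ∧ x = (w.map (gen q1 q2 q3)).prod}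

/-! ### Modules with a basis `|l⟩`, `l ∈ P`, given by matrix coefficients

A representation of `E` on the space `P →₀ ℂ` with basis `|l⟩`. The rational functions of `z` are
elements of `RatFunc ℂ`; they are written as functions of `z : RatFunc ℂ`, where `z = X` stands
for the function itself and `z = X⁻¹` for the function in the coordinate `X = 1/z`. -/

/-- The basis vector `|l⟩`. -/
def ket {P : Type} (l : P) : P →₀ ℂ := Finsupp.single l 1

/-- The coefficient of `z^m` in the expansion at `z = 0` of the rational function `F(z)`. -/
def expandZero (F : RatFunc ℂ → RatFunc ℂ) (m : ℕ) : ℂ :=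
  HahnSeries.coeff ((F RatFunc.X : RatFunc ℂ) : LaurentSeries ℂ) (m : ℤ)

/-- The coefficient of `z^{-m}` in the expansion at `z = ∞` of the rational function `F(z)`. -/
def expandInfinity (F : RatFunc ℂ → RatFunc ℂ) (m : ℕ) : ℂ :=
  HahnSeries.coeff ((F RatFunc.X⁻¹ : RatFunc ℂ) : LaurentSeries ℂ) (m : ℤ)

/-- The coefficient of `z^{-m}` in `F(z) δ(v/z) = F(v) δ(v/z)`. -/
def deltaCoeff (F : RatFunc ℂ → RatFunc ℂ) (v : ℂ) (m : ℤ) : ℂ :=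
  RatFunc.eval (RingHom.id ℂ) v (F RatFunc.X) * v ^ m

/-- `ρ` is the representation with the following matrix coefficients, all others being zero.
Here `B` is the set of places for a box and `adds l b l'` says `l' = l + 1_b`:
* `⟨l + 1_b| e(z) |l⟩ = eF l b (z) δ(v l b / z)`,
* `⟨l| f(z) |l + 1_b⟩ = fF l b (z) δ(v l b / z)`,
* `⟨l| ψ^±(z) |l⟩ = psi l (z)`, expanded in powers of `z^{∓1}`. -/
structure HasMatrixCoefficients {q1 q2 q3 : ℂ} {P B : Type}
    (ρ : Alg q1 q2 q3 →ₐ[ℂ] Module.End ℂ (P →₀ ℂ))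
    (adds : P → B → P → Prop) (v : P → B → ℂ)
    (eF fF : P → B → RatFunc ℂ → RatFunc ℂ) (psi : P → RatFunc ℂ → RatFunc ℂ) : Prop where
  e_add : ∀ (m : ℤ) (l : P) (b : B) (l' : P), adds l b l' →
    ρ (gen q1 q2 q3 (.e m)) (ket l) l' = deltaCoeff (eF l b) (v l b) m
  e_other : ∀ (m : ℤ) (l l' : P), (¬ ∃ b, adds l b l') →
    ρ (gen q1 q2 q3 (.e m)) (ket l) l' = 0
  f_add : ∀ (m : ℤ) (l : P) (b : B) (l' : P), adds l b l' →
    ρ (gen q1 q2 q3 (.f m)) (ket l') l = deltaCoeff (fF l b) (v l b) m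
  f_other : ∀ (m : ℤ) (l l' : P), (¬ ∃ b, adds l b l') →
    ρ (gen q1 q2 q3 (.f m)) (ket l') l = 0
  psiPlus : ∀ (m : ℕ) (l : P),
    ρ (gen q1 q2 q3 (.psiPlus m)) (ket l) = expandInfinity (psi l) m • ket l
  psiMinus : ∀ (m : ℕ) (l : P),
    ρ (gen q1 q2 q3 (.psiMinus m)) (ket l) = expandZero (psi l) m • ket l

/-- The component of degree `d` of `P →₀ ℂ` when `|l⟩` has degree `deg l`. -/
def modGrade {P : Type} (deg : P → ℤ) (d : ℤ) : Submodule ℂ (P →₀ ℂ) :=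
  Submodule.span ℂ {x | ∃ l, deg l = d ∧ x = ket l}

/-- `ρ` is a graded module: `E_d V_k ⊆ V_{d+k}`. -/
def IsGradedModule {q1 q2 q3 : ℂ} {P : Type}
    (ρ : Alg q1 q2 q3 →ₐ[ℂ] Module.End ℂ (P →₀ ℂ)) (deg : P → ℤ) : Prop :=
  ∀ (d k : ℤ), ∀ x ∈ algGrade q1 q2 q3 d, ∀ y ∈ modGrade deg k, ρ x y ∈ modGrade deg (d + k)

/-! ### Vector representations and Fock modules

Sequences `(l_1, l_2, …)` are indexed from `0`: `l s` stands for the part `l_{s+1}`. -/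

/-- `⟨j| ψ(z) |j⟩` in the vector representation `V(w)`. -/
def vecPsi (q1 q2 q3 w : ℂ) (j : ℤ) (z : RatFunc ℂ) : RatFunc ℂ :=
  ((1 - RatFunc.C (q1 ^ j * q3 * w) / z) * (1 - RatFunc.C (q1 ^ j * q2 * w) / z)) /
    ((1 - RatFunc.C (q1 ^ j * w) / z) * (1 - RatFunc.C (q1 ^ (j - 1) * w) / z))

/-- `⟨l| ψ(z)_{s+1} |l⟩`: the eigenvalue on `|l_{s+1} - s⟩` in `V(u q₂^{-s})`. -/
def partPsi (q1 q2 q3 u : ℂ) (l : ℕ → ℤ) (s : ℕ) (z : RatFunc ℂ) : RatFunc ℂ :=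
  vecPsi q1 q2 q3 (u * q2 ^ (-(s : ℤ))) (l s - s) z

/-- The support `q₁^{l_{s+1}} q₃^s u` of the delta function in the coefficients changing the
part `l_{s+1}`. -/
def partSupport (q1 q3 u : ℂ) (l : ℕ → ℤ) (s : ℕ) : ℂ := q1 ^ l s * q3 ^ s * u

/-- `(1 - q x) / (1 - x)`. -/
def vacFun (q : ℂ) (x : RatFunc ℂ) : RatFunc ℂ := (1 - RatFunc.C q * x) / (1 - x)

/-- The factor of `δ` in `⟨l + 1_{s+1}| e(z) |l⟩`: a product over the preceding parts. -/
def rowE (q1 q2 q3 u : ℂ) (l : ℕ → ℤ) (s : ℕ) (z : RatFunc ℂ) : RatFunc ℂ :=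
  RatFunc.C (1 / (1 - q1)) * ∏ t ∈ range s, partPsi q1 q2 q3 u l t z

/-- The factor of `δ` in `⟨l| f(z) |l + 1_{s+1}⟩` for the Fock module `F(u)`. -/
def fockF (q1 q2 q3 u : ℂ) (l : ℕ → ℤ) (s : ℕ) (z : RatFunc ℂ) : RatFunc ℂ :=
  RatFunc.C (q1 / (1 - q1)) * vacFun q2 (RatFunc.C (u * q3 ^ (s + 1)) / z) *
    ∏ᶠ t : ℕ, partPsi q1 q2 q3 u l (s + 1 + t) z / partPsi q1 q2 q3 u (fun _ => 0) (s + 1 + t) z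

/-- `⟨l| ψ(z) |l⟩` for the Fock module `F(u)`. -/
def fockPsi (q1 q2 q3 u : ℂ) (l : ℕ → ℤ) (z : RatFunc ℂ) : RatFunc ℂ :=
  vacFun q2 (RatFunc.C u / z) *
    ∏ᶠ t : ℕ, partPsi q1 q2 q3 u l t z / partPsi q1 q2 q3 u (fun _ => 0) t z

/-! ### The module `M_{a,b}^{p',p}(u)`

Here `a = (a_1, …, a_n)` and `b = (b_1, …, b_n)` contain the last entries `a_n`, `b_n`, so that
`p' = ∑ (a_i + 1)` and `p = ∑ (b_i + 1)`. -/

/-- `n`-tuples of finite partitions with `l^{(i)}_s ≥ l^{(i+1)}_{s+b_i} - a_i`, `i` modulo `n`. -/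
def Tuples {n : ℕ} (a b : Fin n → ℕ) : Type :=
  {l : Fin n → ℕ → ℤ // (∀ i, Antitone (l i) ∧ {s | l i s ≠ 0}.Finite) ∧
    ∀ i s, l i s ≥ l (finRotate n i) (s + b i) - a i}

/-- The total size. -/
def tupleDeg {n : ℕ} {a b : Fin n → ℕ} (l : Tuples a b) : ℤ := ∑ i, ∑ᶠ s, l.1 i s

/-- `l' = l + 1^{(i)}_{s+1}`. -/
def tupleAdds {n : ℕ} {a b : Fin n → ℕ} (l : Tuples a b) (x : Fin n × ℕ) (l' : Tuples a b) :
    Prop :=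
  ∀ i s, l'.1 i s = l.1 i s + if (i, s) = x then 1 else 0

/-- `u_1 = u` and `u_i = u_{i+1} q₁^{a_i+1} q₃^{b_i+1}`. -/
def evalParam {n : ℕ} (q1 q3 u : ℂ) (a b : Fin n → ℕ) (i : Fin n) : ℂ :=
  u * ∏ j ∈ Iio i, (q1 ^ (a j + 1) * q3 ^ (b j + 1))⁻¹

/-- The support of the delta function for the part `l^{(i)}_{s+1}`. -/
def tensorSupport {n : ℕ} (q1 q3 : ℂ) (w : Fin n → ℂ) (l : Fin n → ℕ → ℤ) (x : Fin n × ℕ) : ℂ :=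
  partSupport q1 q3 (w x.1) (l x.1) x.2

/-- The factor of `δ` in `⟨l + 1^{(i)}_{s+1}| e(z) |l⟩` on `F(w_1) ⊗ ⋯ ⊗ F(w_n)`, from
`Δ e(z) = e(z) ⊗ 1 + ψ⁻(z) ⊗ e(z)`. -/
def tensorE {n : ℕ} (q1 q2 q3 : ℂ) (w : Fin n → ℂ) (l : Fin n → ℕ → ℤ) (x : Fin n × ℕ)
    (z : RatFunc ℂ) : RatFunc ℂ :=
  (∏ j ∈ Iio x.1, fockPsi q1 q2 q3 (w j) (l j) z) * rowE q1 q2 q3 (w x.1) (l x.1) x.2 z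

/-- The factor of `δ` in `⟨l| f(z) |l + 1^{(i)}_{s+1}⟩` on `F(w_1) ⊗ ⋯ ⊗ F(w_n)`, from
`Δ f(z) = f(z) ⊗ ψ⁺(z) + 1 ⊗ f(z)`. -/
def tensorF {n : ℕ} (q1 q2 q3 : ℂ) (w : Fin n → ℂ) (l : Fin n → ℕ → ℤ) (x : Fin n × ℕ)
    (z : RatFunc ℂ) : RatFunc ℂ :=
  fockF q1 q2 q3 (w x.1) (l x.1) x.2 z * ∏ j ∈ Ioi x.1, fockPsi q1 q2 q3 (w j) (l j) z

/-- `⟨l| ψ(z) |l⟩` on `F(w_1) ⊗ ⋯ ⊗ F(w_n)`. -/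
def tensorPsi {n : ℕ} (q1 q2 q3 : ℂ) (w : Fin n → ℂ) (l : Fin n → ℕ → ℤ) (z : RatFunc ℂ) :
    RatFunc ℂ :=
  ∏ j, fockPsi q1 q2 q3 (w j) (l j) z

/-- `ρ` is the action of `E` on `M_{a,b}^{p',p}(u)`: the matrix coefficients are those of the
tensor product of the Fock modules `F(u_i)`. -/
def IsTupleModule {n : ℕ} {q1 q2 q3 : ℂ} (u : ℂ) (a b : Fin n → ℕ)
    (ρ : Alg q1 q2 q3 →ₐ[ℂ] Module.End ℂ (Tuples a b →₀ ℂ)) : Prop :=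
  HasMatrixCoefficients ρ tupleAdds
    (fun l => tensorSupport q1 q3 (evalParam q1 q3 u a b) l.1)
    (fun l => tensorE q1 q2 q3 (evalParam q1 q3 u a b) l.1)
    (fun l => tensorF q1 q2 q3 (evalParam q1 q3 u a b) l.1)
    (fun l => tensorPsi q1 q2 q3 (evalParam q1 q3 u a b) l.1)

/-- The sequence `b` in the case `b_1 = ⋯ = b_{n-1} = 0`, `p = n + 1`; then `b_n = 1`. -/
def bZero (n : ℕ) : Fin n → ℕ := fun i => if (i : ℕ) + 1 = n then 1 else 0

/-! ### The semi-infinite modules -/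

/-- The vacuum partition: `Λ⁰_{νk+i+1} = -νr - c_i`, `0 ≤ i < k`, `c_i = a_1 + ⋯ + a_i`. -/
def vacuum (k r : ℕ) (a : Fin k → ℕ) (j : ℕ) : ℤ :=
  -((j / k : ℕ) * (r : ℤ)) - ∑ m : Fin k, if (m : ℕ) < j % k then (a m : ℤ) else 0

/-- `(k,r)`-admissible partitions `Λ`, with `Λ_i = Λ⁰_i` for all large `i`. -/
def Admissible (k r : ℕ) (a : Fin k → ℕ) : Type :=
  {L : ℕ → ℤ // Antitone L ∧ (∀ j, L j - L (j + k) ≥ r) ∧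
    ∃ N, ∀ j ≥ N, L j = vacuum k r a j}

/-- The degree `|Λ - Λ⁰|`. -/
def admDeg {k r : ℕ} {a : Fin k → ℕ} (L : Admissible k r a) : ℤ :=
  ∑ᶠ j, (L.1 j - vacuum k r a j)

/-- `Λ' = Λ + 1_{j+1}`. -/
def admAdds {k r : ℕ} {a : Fin k → ℕ} (L : Admissible k r a) (j : ℕ) (L' : Admissible k r a) :
    Prop :=
  ∀ i, L'.1 i = L.1 i + if i = j then 1 else 0

/-- The factor of `δ` in `⟨Λ| f(z) |Λ + 1_{j+1}⟩` for the module `W_a^{k,r}(u)`. -/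
def fatF (q1 q2 q3 u : ℂ) (k r : ℕ) (a : Fin k → ℕ) (L : ℕ → ℤ) (j : ℕ) (z : RatFunc ℂ) :
    RatFunc ℂ :=
  RatFunc.C (q1 / (1 - q1)) *
    (∏ᶠ t : ℕ, partPsi q1 q2 q3 u L (j + 1 + t) z /
      partPsi q1 q2 q3 u (vacuum k r a) (j + 1 + t) z) *
    ∏ m ∈ range k,
      vacFun q3 (RatFunc.C (u * q1 ^ vacuum k r a (j + 1 + m) * q3 ^ (j + 1 + m)) / z)

/-- `⟨Λ| ψ(z) |Λ⟩` for the module `W_a^{k,r}(u)`; note `Λ⁰_{i+1} = -c_i` for `0 ≤ i < k`. -/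
def fatPsi (q1 q2 q3 u : ℂ) (k r : ℕ) (a : Fin k → ℕ) (L : ℕ → ℤ) (z : RatFunc ℂ) : RatFunc ℂ :=
  (∏ m ∈ range k, vacFun q3 (RatFunc.C (u * q1 ^ vacuum k r a m * q3 ^ m) / z)) *
    ∏ᶠ t : ℕ, partPsi q1 q2 q3 u L t z / partPsi q1 q2 q3 u (vacuum k r a) t z

/-- `ρ` is the action of `E` on `G_a^{k,r}(u)`: the formulas of the semi-infinite module
`W_a^{k,r}(u)` with `q₂` and `q₃` interchanged. -/
def IsSemiInfiniteModule {q1 q2 q3 : ℂ} (u : ℂ) (k r : ℕ) (a : Fin k → ℕ)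
    (ρ : Alg q1 q2 q3 →ₐ[ℂ] Module.End ℂ (Admissible k r a →₀ ℂ)) : Prop :=
  HasMatrixCoefficients ρ admAdds
    (fun L => partSupport q1 q2 u L.1)
    (fun L => rowE q1 q3 q2 u L.1)
    (fun L => fatF q1 q3 q2 u k r a L.1)
    (fun L => fatPsi q1 q3 q2 u k r a L.1)

end QuantumGl

end

/-!
A vector `|L⟩` of either module stands for an integer sequence, and `e(z)`, `f(z)` add and remove
one box of it. Flattening a tuple to the sequence `Λ_{ns+i} = λ^{(i)}_{s+1} + Λ⁰_{ns+i}` turns the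
conditions on tuples into admissibility (`isAdm_toSeq_iff`). Since `q₁^{-r} q₂^n = q₃` by resonance,
the flattening also matches the supports of the delta functions (`Resonant.partSupport_untuple`) and
the eigenvalues of `ψ^±(z)` (`Resonant.tensorPsi_eq`).

**The rescaling.** The amplitude of `e(z)` at the part `j` is a product of values, at the support of
`j`, of the factors of those parts which precede `j`; the two modules differ only in the total order
of the parts, place by place for the sequences and member by member for the tuples. Whatever the
order, of two parts exactly one precedes the other, so the two ways around a square
`L → L + 1_j + 1_k` always compare by the same quotient of values of the structure function `g`
(`Resonant.amp_square`). Hence the quotient of the two amplitudes is a function on edges which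
commutes around squares. As the graph of admissible sequences is graded and bounded below, and two
edges into the same vertex always complete to a square, such a function is a coboundary
(`exists_potential`), which provides the rescaling `c` (`Resonant.exists_gauge`). The amplitudes of
`f(z)` need no separate argument: the product of the amplitudes of `e(z)` and `f(z)` along an edge
is `q₁ / (1 - q₁)²` times the value of the eigenvalue of `ψ(z)` without the factor of the part
`j` (`resid`), and is the same in both modules.

**The relations on the sequences.** It remains to construct one of the modules, the semi-infinite
one; the other is its transport along the rescaled bijection (`tupleRep`).

* The quadratic relation at two different parts is the square relation. Where one of the two orders
  leaves the admissible sequences, resonance makes the factor `g` of the other order vanish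
  (`Resonant.support_eq_of_not_edge`).
* Along an admissible path, `g` does not vanish at the first and the second support, nor at the
  first and the third (`Resonant.first_second`, `Resonant.first_third`). Therefore the amplitudes of all
  orders of three boxes are determined by one non-zero amplitude, and the cubic Serre relation
  becomes a polynomial identity (`serre_sum_of_first`, `HalfCurrent.serre`).
* The off-diagonal part of `[e(z), f(w)]` vanishes by the square relation (`Resonant.amp_off_diag`).
  Its diagonal part is the partial fraction expansion of the eigenvalue of `ψ(z)`. After
  cancellation, the poles of the eigenvalue are simple and sit exactly at the supports of the
  addable and removable boxes (`Resonant.exists_poles`), and up to sign and a common factor their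
  residues are the products of the amplitudes of `e(z)` and `f(z)` (`Resonant.exists_expansion`).
  The expansions at `∞` and at `0` differ by the sum of the residues times delta functions.
* The relations between `ψ^±(z)` and `e(w)`, `f(w)` say that adding a box changes the eigenvalue by
  a quotient of values of `g` (`Resonant.fatPsi_add_box_cubic`).
-/

noncomputable section

namespace QuantumGl

open Finset

/-! ### Operators which add one box -/

/-- The operator with `|L⟩ ↦ ∑ A(L,j) |L + ε_j⟩`, for finitely supported `A(L, ·)`. -/
def hop {T B : Type} [AddCommGroup T] (ε : B → T) (A : T → B → ℂ) : Module.End ℂ (T →₀ ℂ) :=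
  Finsupp.linearCombination ℂ fun L => ∑ᶠ j, A L j • ket (L + ε j)

section Hop

variable {T B : Type} [AddCommGroup T] {ε : B → T} {A A' A'' : T → B → ℂ}

theorem hop_ket (S : Finset B) (L : T) (hS : ∀ j, A L j ≠ 0 → j ∈ S) :
    hop ε A (ket L) = ∑ j ∈ S, A L j • ket (L + ε j) := by
  rw [hop, ket, Finsupp.linearCombination_single, one_smul]
  refine finsum_eq_sum_of_support_subset _ fun j hj => hS j fun h => ?_
  simp [h] at hj

theorem hop_hop_ket {ε' : B → T} (S : Finset B) (L : T) (hS : ∀ j, A L j ≠ 0 → j ∈ S)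
    (hS' : ∀ j k, A L j ≠ 0 → A' (L + ε j) k ≠ 0 → k ∈ S) :
    (hop ε' A' * hop ε A) (ket L) =
      ∑ j ∈ S, ∑ k ∈ S, (A L j * A' (L + ε j) k) • ket (L + ε j + ε' k) := by
  rw [Module.End.mul_apply, hop_ket S L hS, map_sum]
  refine Finset.sum_congr rfl fun j _ => ?_
  by_cases h : A L j = 0
  · simp [h]
  · rw [map_smul, hop_ket S _ (fun k => hS' j k h), Finset.smul_sum]
    simp [smul_smul]

theorem hop_hop_hop_ket (S : Finset B) (L : T) (hS : ∀ j, A L j ≠ 0 → j ∈ S)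
    (hS' : ∀ j k, A L j ≠ 0 → A' (L + ε j) k ≠ 0 → k ∈ S)
    (hS'' : ∀ j k m, A L j ≠ 0 → A' (L + ε j) k ≠ 0 → A'' (L + ε j + ε k) m ≠ 0 → m ∈ S) :
    (hop ε A'' * (hop ε A' * hop ε A)) (ket L) =
      ∑ j ∈ S, ∑ k ∈ S, ∑ m ∈ S, (A L j * A' (L + ε j) k * A'' (L + ε j + ε k) m) •
        ket (L + ε j + ε k + ε m) := by
  rw [Module.End.mul_apply, hop_hop_ket S L hS hS', map_sum]
  refine Finset.sum_congr rfl fun j _ => ?_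
  rw [map_sum]
  refine Finset.sum_congr rfl fun k _ => ?_
  by_cases h : A L j * A' (L + ε j) k = 0
  · simp [h]
  · rw [map_smul, hop_ket S _ (fun m => hS'' j k m (left_ne_zero_of_mul h)
      (right_ne_zero_of_mul h)), Finset.smul_sum]
    simp [smul_smul]

/-- A finite set of indices that contains both steps of every path of length two from `L`. -/
theorem exists_finset_two (hA : ∀ L, {j | A L j ≠ 0}.Finite)
    (hA' : ∀ L, {j | A' L j ≠ 0}.Finite) (L : T) :
    ∃ S : Finset B, (∀ j, A L j ≠ 0 → j ∈ S) ∧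
      (∀ j k, A L j ≠ 0 → A' (L + ε j) k ≠ 0 → k ∈ S) := by
  have h : ({j | A L j ≠ 0} ∪ ⋃ j ∈ {j | A L j ≠ 0}, {k | A' (L + ε j) k ≠ 0}).Finite :=
    (hA L).union ((hA L).biUnion fun j _ => hA' _)
  refine ⟨h.toFinset, fun j hj => ?_, fun j k hj hk => ?_⟩
  · simp only [Set.Finite.mem_toFinset]; exact Or.inl hj
  · simp only [Set.Finite.mem_toFinset]; exact Or.inr (Set.mem_biUnion (x := j) hj hk)

/-- A finite set of indices that contains the three steps of every path of length three from `L`. -/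
theorem exists_finset_three (hA : ∀ L, {j | A L j ≠ 0}.Finite) (L : T) :
    ∃ S : Finset B, (∀ j, A L j ≠ 0 → j ∈ S) ∧
      (∀ j k, A L j ≠ 0 → A (L + ε j) k ≠ 0 → k ∈ S) ∧
      (∀ j k m, A L j ≠ 0 → A (L + ε j) k ≠ 0 → A (L + ε j + ε k) m ≠ 0 → m ∈ S) := by
  classical
  obtain ⟨S, h1, h2⟩ := exists_finset_two (ε := ε) hA hA L
  have h : (⋃ j ∈ (S : Set B), ⋃ k ∈ (S : Set B), {m | A (L + ε j + ε k) m ≠ 0}).Finite :=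
    S.finite_toSet.biUnion fun j _ => S.finite_toSet.biUnion fun k _ => hA _
  refine ⟨S ∪ h.toFinset, fun j hj => ?_, fun j k hj hk => ?_, fun j k m hj hk hm => ?_⟩
  · exact mem_union_left _ (h1 j hj)
  · exact mem_union_left _ (h2 j k hj hk)
  · refine mem_union_right _ ?_
    simp only [Set.Finite.mem_toFinset]
    exact Set.mem_biUnion (x := j) (h1 j hj) (Set.mem_biUnion (x := k) (h2 j k hj hk) hm)

end Hop

/-- `z³ - s₁ z² w + s₂ z w² - w³`, that is `∏ (z - q_i w)` when `s₁`, `s₂` are the elementary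
symmetric functions of `q₁, q₂, q₃` and `q₁ q₂ q₃ = 1`. -/
def cubic (s1 s2 z w : ℂ) : ℂ := z ^ 3 - s1 * z ^ 2 * w + s2 * z * w ^ 2 - w ^ 3

theorem cubic_swap (s1 s2 z w : ℂ) : cubic s1 s2 z w = -cubic s2 s1 w z := by
  unfold cubic; ring

/-- A half current `∑_m a_m z^{-m}`, where `a_m |L⟩ = ∑_j A(L,j) w(L,j)^m |L + ε_j⟩`. The
conditions are what makes the quadratic and the Serre relations hold: `pair` is the quadratic
relation at two different boxes, `cubic_same` the one at equal boxes, and `first_second` and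
`first_third` forbid zeros of the structure function along the paths that occur. -/
structure HalfCurrent {T B : Type} [AddCommGroup T] (s1 s2 : ℂ) (ε : B → T)
    (A w : T → B → ℂ) : Prop where
  finite : ∀ L, {j | A L j ≠ 0}.Finite
  ne_zero : ∀ L j, w L j ≠ 0
  shift : ∀ L j k, j ≠ k → w (L + ε j) k = w L k
  cubic_same : ∀ L j, cubic s1 s2 (w (L + ε j) j) (w L j) = 0
  pair : ∀ L j k, j ≠ k → cubic s1 s2 (w L k) (w L j) * (A L j * A (L + ε j) k) +
    cubic s1 s2 (w L j) (w L k) * (A L k * A (L + ε k) j) = 0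
  first_second : ∀ L j k, A L j * A (L + ε j) k ≠ 0 →
    cubic s1 s2 (w L j) (w (L + ε j) k) ≠ 0
  first_third : ∀ L j k m, A L j * A (L + ε j) k * A (L + ε j + ε k) m ≠ 0 →
    cubic s1 s2 (w L j) (w (L + ε j + ε k) m) ≠ 0

/-- The mode `a_m`. -/
def mode {T B : Type} [AddCommGroup T] (ε : B → T) (A w : T → B → ℂ) (m : ℤ) :
    Module.End ℂ (T →₀ ℂ) := hop ε fun L j => A L j * w L j ^ m

/-- The polynomial `z₂/z₁ - z₁/z₂ - z₃/z₂ + z₂/z₃` by which `[a_0,[a_1,a_{-1}]]` acts along a path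
with supports `z₁, z₂, z₃`. -/
def serrePoly (y1 y2 y3 : ℂ) : ℂ := y2 / y1 - y1 / y2 - y3 / y2 + y2 / y3

/-- The Serre relation along the six orderings of three boxes: the amplitudes are all proportional
to those of one non-zero ordering, and the sum becomes a polynomial identity. -/
theorem serre_sum_of_first {s1 s2 y1 y2 y3 p123 p132 p213 p231 p312 p321 : ℂ}
    (h1 : y1 ≠ 0) (h2 : y2 ≠ 0) (h3 : y3 ≠ 0)
    (g12 : cubic s1 s2 y1 y2 ≠ 0) (g13 : cubic s1 s2 y1 y3 ≠ 0) (g23 : cubic s1 s2 y2 y3 ≠ 0)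
    (e1 : cubic s1 s2 y2 y1 * p123 + cubic s1 s2 y1 y2 * p213 = 0)
    (e2 : cubic s1 s2 y3 y2 * p123 + cubic s1 s2 y2 y3 * p132 = 0)
    (e3 : cubic s1 s2 y3 y1 * p213 + cubic s1 s2 y1 y3 * p231 = 0)
    (e4 : cubic s1 s2 y3 y1 * p132 + cubic s1 s2 y1 y3 * p312 = 0)
    (e5 : cubic s1 s2 y3 y2 * p231 + cubic s1 s2 y2 y3 * p321 = 0) :
    p123 * serrePoly y1 y2 y3 + p132 * serrePoly y1 y3 y2 + p213 * serrePoly y2 y1 y3 +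
      p231 * serrePoly y2 y3 y1 + p312 * serrePoly y3 y1 y2 + p321 * serrePoly y3 y2 y1 = 0 := by
  obtain ⟨c, rfl⟩ : ∃ c, p123 = c * (cubic s1 s2 y1 y2 * cubic s1 s2 y1 y3 * cubic s1 s2 y2 y3) :=
    ⟨p123 / (cubic s1 s2 y1 y2 * cubic s1 s2 y1 y3 * cubic s1 s2 y2 y3), by field_simp⟩
  have d1 : p213 = -c * (cubic s1 s2 y2 y1 * cubic s1 s2 y1 y3 * cubic s1 s2 y2 y3) := by
    apply mul_left_cancel₀ g12; linear_combination e1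
  have d2 : p132 = -c * (cubic s1 s2 y1 y2 * cubic s1 s2 y1 y3 * cubic s1 s2 y3 y2) := by
    apply mul_left_cancel₀ g23; linear_combination e2
  have d3 : p231 = c * (cubic s1 s2 y2 y1 * cubic s1 s2 y3 y1 * cubic s1 s2 y2 y3) := by
    apply mul_left_cancel₀ g13; subst d1; linear_combination e3
  have d4 : p312 = c * (cubic s1 s2 y1 y2 * cubic s1 s2 y3 y1 * cubic s1 s2 y3 y2) := by
    apply mul_left_cancel₀ g13; subst d2; linear_combination e4
  have d5 : p321 = -c * (cubic s1 s2 y2 y1 * cubic s1 s2 y3 y1 * cubic s1 s2 y3 y2) := by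
    apply mul_left_cancel₀ g23; subst d3; linear_combination e5
  subst d1 d2 d3 d4 d5
  unfold serrePoly cubic
  field_simp
  ring

/-! ### The quadratic and the Serre relation of a half current -/

namespace HalfCurrent

variable {T B : Type} [AddCommGroup T] {s1 s2 : ℂ} {ε : B → T} {A w : T → B → ℂ}

/-- The quadratic relation. The two brackets exchange `i` and `j`; renaming the two boxes in the second
one collects the two orders in which they are added. -/
theorem quadratic (H : HalfCurrent s1 s2 ε A w) (i j : ℤ) :
    (mode ε A w (i + 3) * mode ε A w j - s1 • (mode ε A w (i + 2) * mode ε A w (j + 1)) +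
        s2 • (mode ε A w (i + 1) * mode ε A w (j + 2)) - mode ε A w i * mode ε A w (j + 3)) +
      (mode ε A w (j + 3) * mode ε A w i - s1 • (mode ε A w (j + 2) * mode ε A w (i + 1)) +
        s2 • (mode ε A w (j + 1) * mode ε A w (i + 2)) - mode ε A w j * mode ε A w (i + 3)) = 0 := by
  classical
  refine Finsupp.lhom_ext' fun L => LinearMap.ext_ring ?_
  obtain ⟨S, hS, hS'⟩ := exists_finset_two (ε := ε) H.finite H.finite L
  have key : ∀ m m' : ℤ, (mode ε A w m' * mode ε A w m) (Finsupp.single L 1) =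
      ∑ a ∈ S, ∑ b ∈ S, ((A L a * w L a ^ m) * (A (L + ε a) b * w (L + ε a) b ^ m')) •
        ket (L + ε a + ε b) := fun m m' =>
    hop_hop_ket S L (fun a h => hS a (left_ne_zero_of_mul h))
      (fun a b h h' => hS' a b (left_ne_zero_of_mul h) (left_ne_zero_of_mul h'))
  have key2 : ∀ i j : ℤ, (mode ε A w (i + 3) * mode ε A w j -
      s1 • (mode ε A w (i + 2) * mode ε A w (j + 1)) +
        s2 • (mode ε A w (i + 1) * mode ε A w (j + 2)) - mode ε A w i * mode ε A w (j + 3))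
        (Finsupp.single L 1) = ∑ a ∈ S, ∑ b ∈ S,
      (A L a * A (L + ε a) b * w L a ^ j * w (L + ε a) b ^ i *
        cubic s1 s2 (w (L + ε a) b) (w L a)) • ket (L + ε a + ε b) := by
    intro i j
    simp only [LinearMap.add_apply, LinearMap.sub_apply, LinearMap.smul_apply, key,
      Finset.smul_sum, smul_smul, ← Finset.sum_add_distrib, ← Finset.sum_sub_distrib, ← sub_smul,
      ← add_smul]
    refine Finset.sum_congr rfl fun a _ => Finset.sum_congr rfl fun b _ => ?_
    congr 1
    have ha := H.ne_zero L a
    have hb := H.ne_zero (L + ε a) b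
    simp only [zpow_add₀ ha, zpow_add₀ hb, cubic]
    simp only [zpow_ofNat]
    ring
  simp only [LinearMap.comp_apply, Finsupp.lsingle_apply]
  rw [LinearMap.add_apply, key2 i j, key2 j i, Finset.sum_comm (s := S) (t := S)
    (f := fun a b => (A L a * A (L + ε a) b * w L a ^ i * w (L + ε a) b ^ j *
        cubic s1 s2 (w (L + ε a) b) (w L a)) • ket (L + ε a + ε b)), ← Finset.sum_add_distrib]
  simp only [LinearMap.zero_apply]
  refine Finset.sum_eq_zero fun a _ => ?_
  rw [← Finset.sum_add_distrib]
  refine Finset.sum_eq_zero fun b _ => ?_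
  by_cases hab : a = b
  · subst hab; simp [H.cubic_same]
  · rw [add_right_comm L (ε b) (ε a), ← add_smul, H.shift L a b hab, H.shift L b a (Ne.symm hab)]
    convert zero_smul ℂ _
    linear_combination (w L a ^ j * w L b ^ i) * H.pair L a b hab

/-- The amplitude of a path that adds three boxes, weighted by the Serre polynomial. -/
def serreTerm (ε : B → T) (A w : T → B → ℂ) (L : T) (a b c : B) : ℂ :=
  A L a * A (L + ε a) b * A (L + ε a + ε b) c *
    serrePoly (w L a) (w (L + ε a) b) (w (L + ε a + ε b) c)

theorem serreTerm_sum_distinct (H : HalfCurrent s1 s2 ε A w) (L : T) (a b c : B) (hab : a ≠ b)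
    (hac : a ≠ c) (hbc : b ≠ c) (h0 : A L a * A (L + ε a) b * A (L + ε a + ε b) c ≠ 0) :
    serreTerm ε A w L a b c + serreTerm ε A w L a c b + serreTerm ε A w L b a c +
      serreTerm ε A w L b c a + serreTerm ε A w L c a b + serreTerm ε A w L c b a = 0 := by
  have sh : ∀ L x y z, x ≠ z → y ≠ z → w (L + ε x + ε y) z = w L z := fun L x y z h h' => by
    rw [H.shift _ _ _ h', H.shift _ _ _ h]
  have g12 := H.first_second L a b (left_ne_zero_of_mul h0)
  have g13 := H.first_third L a b c h0
  have g23 := H.first_second (L + ε a) b c (by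
    rw [mul_assoc] at h0; exact right_ne_zero_of_mul h0)
  rw [H.shift L a b hab] at g12
  rw [sh L a b c hac hbc] at g13
  rw [sh L a b c hac hbc, H.shift L a b hab] at g23
  unfold serreTerm
  simp only [sh L a b c hac hbc, H.shift L a b hab, H.shift L a c hac, H.shift L b c hbc,
    H.shift L b a hab.symm, H.shift L c a hac.symm, H.shift L c b hbc.symm,
    sh L a c b hab hbc.symm, sh L b a c hbc hac, sh L b c a hab.symm hac.symm,
    sh L c a b hbc.symm hab, sh L c b a hac.symm hab.symm]
  refine serre_sum_of_first (H.ne_zero L a) (H.ne_zero L b) (H.ne_zero L c) g12 g13 g23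
    ?_ ?_ ?_ ?_ ?_
  · have := H.pair L a b hab
    rw [add_right_comm L (ε b) (ε a)]
    linear_combination (A (L + ε a + ε b) c) * this
  · have := H.pair (L + ε a) b c hbc
    rw [H.shift L a b hab, H.shift L a c hac] at this
    linear_combination (A L a) * this
  · have := H.pair (L + ε b) a c hac
    rw [H.shift L b a hab.symm, H.shift L b c hbc] at this
    linear_combination (A L b) * this
  · have := H.pair L a c hac
    rw [add_right_comm L (ε c) (ε a)]
    linear_combination (A (L + ε a + ε c) b) * this
  · have := H.pair L b c hbc
    rw [add_right_comm L (ε c) (ε b)]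
    linear_combination (A (L + ε b + ε c) a) * this

/-- With two boxes at the same place only three of the six orders exist. The other three count as
amplitudes `0`, consistently with the quadratic relation, because `cubic_same` makes the coefficients
of their partners vanish. -/
theorem serreTerm_sum_two (H : HalfCurrent s1 s2 ε A w) (L : T) (a c : B) (hac : a ≠ c) :
    serreTerm ε A w L a a c + serreTerm ε A w L a c a + serreTerm ε A w L c a a = 0 := by
  have sh : ∀ L x y z, x ≠ z → y ≠ z → w (L + ε x + ε y) z = w L z := fun L x y z h h' => by
    rw [H.shift _ _ _ h', H.shift _ _ _ h]
  have hs := H.cubic_same L a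
  have e1 : w (L + ε c) a = w L a := H.shift L c a hac.symm
  have e2 : w (L + ε a) c = w L c := H.shift L a c hac
  have e3 : w (L + ε a + ε a) c = w L c := sh L a a c hac hac
  have e4 : w (L + ε a + ε c) a = w (L + ε a) a := H.shift _ c a hac.symm
  have e5 : w (L + ε c + ε a) a = w (L + ε a) a := by rw [add_right_comm, e4]
  have p1 := H.pair (L + ε a) a c hac
  have p2 := H.pair L a c hac
  rw [e2] at p1
  rw [add_right_comm L (ε c) (ε a)] at *
  have hA : A (L + ε a + ε c) a = A (L + ε c + ε a) a := by rw [add_right_comm]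
  unfold serreTerm
  rw [e1, e2, e3, e4, add_right_comm L (ε c) (ε a), e4]
  have n1 := H.ne_zero L a
  have n2 := H.ne_zero (L + ε a) a
  have n3 := H.ne_zero L c
  by_cases h1 : A L a * A (L + ε a) a * A (L + ε a + ε a) c = 0
  · by_cases h2 : A L a * A (L + ε a) c * A (L + ε a + ε c) a = 0
    · by_cases h3 : A L c * A (L + ε c) a * A (L + ε a + ε c) a = 0
      · rw [h1, h2, h3]; simp
      · have g12 := H.first_second L c a (left_ne_zero_of_mul h3)
        have g13 := H.first_third L c a a (by rwa [add_right_comm])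
        have g23 := H.first_second (L + ε c) a a (by
          rw [mul_assoc] at h3; rw [add_right_comm]; exact right_ne_zero_of_mul h3)
        rw [add_right_comm, e4] at g13 g23
        rw [e1] at g12 g23
        have := serre_sum_of_first (s1 := s1) (s2 := s2) n3 n1 n2 g12 g13 g23
          (p123 := A L c * A (L + ε c) a * A (L + ε a + ε c) a) (p132 := 0)
          (p213 := A L a * A (L + ε a) c * A (L + ε a + ε c) a)
          (p231 := A L a * A (L + ε a) a * A (L + ε a + ε a) c) (p312 := 0) (p321 := 0)
          (by linear_combination (A (L + ε a + ε c) a) * p2) (by rw [hs]; ring)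
          (by linear_combination (A L a) * p1) (by ring) (by rw [hs]; ring)
        linear_combination this
    · have g12 := H.first_second L a c (left_ne_zero_of_mul h2)
      have g13 := H.first_third L a c a h2
      have g23 := H.first_second (L + ε a) c a (by
        rw [mul_assoc] at h2; exact right_ne_zero_of_mul h2)
      rw [e4] at g13 g23
      rw [e2] at g12 g23
      have := serre_sum_of_first (s1 := s1) (s2 := s2) n1 n3 n2 g12 g13 g23
          (p123 := A L a * A (L + ε a) c * A (L + ε a + ε c) a)
          (p132 := A L a * A (L + ε a) a * A (L + ε a + ε a) c)
          (p213 := A L c * A (L + ε c) a * A (L + ε a + ε c) a)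
          (p231 := 0) (p312 := 0) (p321 := 0)
          (by linear_combination (A (L + ε a + ε c) a) * p2)
          (by linear_combination (A L a) * p1) (by rw [hs]; ring) (by rw [hs]; ring) (by ring)
      linear_combination this
  · have g12 := H.first_second L a a (left_ne_zero_of_mul h1)
    have g13 := H.first_third L a a c h1
    have g23 := H.first_second (L + ε a) a c (by
        rw [mul_assoc] at h1; exact right_ne_zero_of_mul h1)
    rw [e3] at g13 g23
    have := serre_sum_of_first (s1 := s1) (s2 := s2) n1 n2 n3 g12 g13 g23
          (p123 := A L a * A (L + ε a) a * A (L + ε a + ε a) c)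
          (p132 := A L a * A (L + ε a) c * A (L + ε a + ε c) a)
          (p213 := 0) (p231 := 0)
          (p312 := A L c * A (L + ε c) a * A (L + ε a + ε c) a) (p321 := 0)
          (by rw [hs]; ring) (by linear_combination (A L a) * p1)
          (by ring) (by linear_combination (A (L + ε a + ε c) a) * p2) (by ring)
    linear_combination this

theorem serreTerm_same (H : HalfCurrent s1 s2 ε A w) (L : T) (a : B) :
    serreTerm ε A w L a a a = 0 := by
  unfold serreTerm
  by_cases h : A L a * A (L + ε a) a * A (L + ε a + ε a) a = 0
  · rw [h, zero_mul]
  have g12 := H.first_second L a a (left_ne_zero_of_mul h)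
  have g13 := H.first_third L a a a h
  have g23 := H.first_second (L + ε a) a a (by
        rw [mul_assoc] at h; exact right_ne_zero_of_mul h)
  have := serre_sum_of_first (s1 := s1) (s2 := s2) (H.ne_zero L a) (H.ne_zero _ a) (H.ne_zero _ a)
    g12 g13 g23 (p123 := A L a * A (L + ε a) a * A (L + ε a + ε a) a) (p132 := 0) (p213 := 0)
    (p231 := 0) (p312 := 0) (p321 := 0) (by rw [H.cubic_same]; ring) (by rw [H.cubic_same]; ring)
    (by ring) (by ring) (by ring)
  linear_combination this

theorem serreTerm_sum (H : HalfCurrent s1 s2 ε A w) (L : T) (a b c : B) :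
    serreTerm ε A w L a b c + serreTerm ε A w L a c b + serreTerm ε A w L b a c +
      serreTerm ε A w L b c a + serreTerm ε A w L c a b + serreTerm ε A w L c b a = 0 := by
  by_cases hab : a = b
  · subst hab
    by_cases hac : a = c
    · subst hac; simp [H.serreTerm_same]
    · linear_combination 2 * H.serreTerm_sum_two L a c hac
  by_cases hac : a = c
  · subst hac
    linear_combination 2 * H.serreTerm_sum_two L a b hab
  by_cases hbc : b = c
  · subst hbc
    linear_combination 2 * H.serreTerm_sum_two L b a (Ne.symm hab)
  have hne : ∀ x y z, serreTerm ε A w L x y z ≠ 0 →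
      A L x * A (L + ε x) y * A (L + ε x + ε y) z ≠ 0 := fun x y z h => left_ne_zero_of_mul h
  by_contra hsum
  have hall : ∀ t1 t2 t3 t4 t5 t6 : ℂ, t1 + t2 + t3 + t4 + t5 + t6 ≠ 0 →
      t1 ≠ 0 ∨ t2 ≠ 0 ∨ t3 ≠ 0 ∨ t4 ≠ 0 ∨ t5 ≠ 0 ∨ t6 ≠ 0 := by
    intro t1 t2 t3 t4 t5 t6 h
    by_contra! hh
    obtain ⟨rfl, rfl, rfl, rfl, rfl, rfl⟩ := hh
    simp at h
  apply hsum
  rcases hall _ _ _ _ _ _ hsum with h | h | h | h | h | h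
  · linear_combination H.serreTerm_sum_distinct L a b c hab hac hbc (hne _ _ _ h)
  · linear_combination H.serreTerm_sum_distinct L a c b hac hab (Ne.symm hbc) (hne _ _ _ h)
  · linear_combination H.serreTerm_sum_distinct L b a c (Ne.symm hab) hbc hac (hne _ _ _ h)
  · linear_combination H.serreTerm_sum_distinct L b c a hbc (Ne.symm hab) (Ne.symm hac) (hne _ _ _ h)
  · linear_combination H.serreTerm_sum_distinct L c a b (Ne.symm hac) (Ne.symm hbc) hab (hne _ _ _ h)
  · linear_combination H.serreTerm_sum_distinct L c b a (Ne.symm hbc) (Ne.symm hac) (Ne.symm hab)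
      (hne _ _ _ h)

/-- A sum over triples with symmetric vectors vanishes if the symmetrised coefficients do. -/
theorem sum_perm_three {M : Type*} [AddCommGroup M] [Module ℂ M] (S : Finset B)
    (t : B → B → B → ℂ) (v : B → B → B → M) (hv : ∀ a b c, v a b c = v b a c)
    (hv' : ∀ a b c, v a b c = v a c b)
    (ht : ∀ a b c, t a b c + t a c b + t b a c + t b c a + t c a b + t c b a = 0) :
    ∑ a ∈ S, ∑ b ∈ S, ∑ c ∈ S, t a b c • v a b c = 0 := by
  have swap : ∀ f : B → B → B → M, ∑ a ∈ S, ∑ b ∈ S, ∑ c ∈ S, f a b c =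
      ∑ a ∈ S, ∑ b ∈ S, ∑ c ∈ S, f b a c := fun f => Finset.sum_comm
  have swap' : ∀ f : B → B → B → M, ∑ a ∈ S, ∑ b ∈ S, ∑ c ∈ S, f a b c =
      ∑ a ∈ S, ∑ b ∈ S, ∑ c ∈ S, f a c b := fun f =>
    Finset.sum_congr rfl fun a _ => Finset.sum_comm
  set X := ∑ a ∈ S, ∑ b ∈ S, ∑ c ∈ S, t a b c • v a b c with hX
  have e1 : X = ∑ a ∈ S, ∑ b ∈ S, ∑ c ∈ S, t a c b • v a b c := by
    rw [hX, swap']; simp only [← hv']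
  have e2 : X = ∑ a ∈ S, ∑ b ∈ S, ∑ c ∈ S, t b a c • v a b c := by
    rw [hX, swap]; simp only [← hv]
  have e3 : X = ∑ a ∈ S, ∑ b ∈ S, ∑ c ∈ S, t b c a • v a b c := by
    rw [e1, swap]; simp only [← hv]
  have e4 : X = ∑ a ∈ S, ∑ b ∈ S, ∑ c ∈ S, t c a b • v a b c := by
    rw [e2, swap']; simp only [← hv']
  have e5 : X = ∑ a ∈ S, ∑ b ∈ S, ∑ c ∈ S, t c b a • v a b c := by
    rw [e4, swap]; simp only [← hv]
  have h6 : X + X + X + X + X + X = 0 := by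
    calc X + X + X + X + X + X = _ := congr (congrArg _ (congr (congrArg _ (congr (congrArg _
          (congr (congrArg _ (congr (congrArg _ hX) e1)) e2)) e3)) e4)) e5
      _ = 0 := by
        simp only [← Finset.sum_add_distrib, ← add_smul, ht, zero_smul, Finset.sum_const_zero]
  have : (6 : ℂ) • X = 0 := by
    rw [← h6]; module
  exact (smul_eq_zero.mp this).resolve_left (by norm_num)

theorem mode_mode_mode_ket (H : HalfCurrent s1 s2 ε A w) (L : T) : ∃ S : Finset B, ∀ m m' m'' : ℤ,
    mode ε A w m'' (mode ε A w m' (mode ε A w m (ket L))) =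
      ∑ a ∈ S, ∑ b ∈ S, ∑ c ∈ S, ((A L a * w L a ^ m) * (A (L + ε a) b * w (L + ε a) b ^ m') *
        (A (L + ε a + ε b) c * w (L + ε a + ε b) c ^ m'')) • ket (L + ε a + ε b + ε c) := by
  obtain ⟨S, hS, hS', hS''⟩ := exists_finset_three (ε := ε) H.finite L
  refine ⟨S, fun m m' m'' => ?_⟩
  have h1 : ∀ (m : ℤ) L a, A L a * w L a ^ m ≠ 0 → A L a ≠ 0 := fun m L a h => left_ne_zero_of_mul h
  have := hop_hop_hop_ket (ε := ε) (A := fun L a => A L a * w L a ^ m)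
    (A' := fun L a => A L a * w L a ^ m') (A'' := fun L a => A L a * w L a ^ m'') S L
    (fun a h => hS a (h1 m _ _ h)) (fun a b h h' => hS' a b (h1 m _ _ h) (h1 m' _ _ h'))
    (fun a b c h h' h'' => hS'' a b c (h1 m _ _ h) (h1 m' _ _ h') (h1 m'' _ _ h''))
  exact this

/-- On a basis vector, the Serre relation is the sum of all paths of length three, weighted by the Serre
polynomial. -/
theorem serre_ket (H : HalfCurrent s1 s2 ε A w) (L : T) :
    mode ε A w 0 (mode ε A w 1 (mode ε A w (-1) (ket L))) -
      mode ε A w 0 (mode ε A w (-1) (mode ε A w 1 (ket L))) -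
      (mode ε A w 1 (mode ε A w (-1) (mode ε A w 0 (ket L))) -
      mode ε A w (-1) (mode ε A w 1 (mode ε A w 0 (ket L)))) = 0 := by
  obtain ⟨S, key⟩ := H.mode_mode_mode_ket L
  rw [key, key, key, key]
  simp only [← Finset.sum_sub_distrib, ← sub_smul]
  refine Eq.trans ?_ (sum_perm_three S (serreTerm ε A w L)
    (fun a b c => ket (L + ε a + ε b + ε c)) (fun a b c => by rw [add_right_comm L])
    (fun a b c => by rw [add_right_comm (L + ε a)]) (H.serreTerm_sum L))
  refine Finset.sum_congr rfl fun a _ => Finset.sum_congr rfl fun b _ =>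
    Finset.sum_congr rfl fun c _ => ?_
  congr 1
  simp only [serreTerm, serrePoly, zpow_zero, zpow_one, zpow_neg]
  ring

theorem serre (H : HalfCurrent s1 s2 ε A w) :
    mode ε A w 0 * (mode ε A w 1 * mode ε A w (-1) - mode ε A w (-1) * mode ε A w 1) -
      (mode ε A w 1 * mode ε A w (-1) - mode ε A w (-1) * mode ε A w 1) * mode ε A w 0 = 0 := by
  refine Finsupp.lhom_ext' fun L => LinearMap.ext_ring ?_
  simp only [LinearMap.comp_apply, Finsupp.lsingle_apply, LinearMap.sub_apply,
    Module.End.mul_apply, map_sub, LinearMap.zero_apply]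
  exact H.serre_ket L

end HalfCurrent

/-! ### Representations with a basis of integer sequences -/

/-- The diagonal operator with eigenvalues `a`. -/
def diagOp {T : Type} (a : T → ℂ) : Module.End ℂ (T →₀ ℂ) :=
  Finsupp.linearCombination ℂ fun L => a L • ket L

theorem diagOp_ket {T : Type} (a : T → ℂ) (L : T) : diagOp a (ket L) = a L • ket L := by
  rw [diagOp, ket, Finsupp.linearCombination_single, one_smul]; rfl

theorem end_ext {T : Type} {f g : Module.End ℂ (T →₀ ℂ)} (h : ∀ L, f (ket L) = g (ket L)) :
    f = g :=
  Finsupp.lhom_ext' fun L => LinearMap.ext_ring (h L)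

theorem diagOp_mul {T : Type} (a b : T → ℂ) : diagOp a * diagOp b = diagOp (a * b) :=
  end_ext fun L => by
    rw [Module.End.mul_apply, diagOp_ket, diagOp_ket, map_smul, diagOp_ket, smul_smul, Pi.mul_apply,
      mul_comm]

theorem diagOp_one {T : Type} : diagOp (1 : T → ℂ) = 1 :=
  end_ext fun L => by rw [diagOp_ket, Pi.one_apply, one_smul]; rfl

/-- The sequence with `1` at place `j` and `0` elsewhere. -/
def box (j : ℕ) : ℕ → ℤ := Pi.single j 1

/-- Amplitudes `E`, `F`, supports `v` and eigenvalue coefficients `ψ^±` on integer sequences which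
define an action of the algebra on the span of all `|L⟩`, in such a way that the span of the
`|L⟩` with `adm L` is invariant. `E L j` and `F L j` belong both to the edge from `L` to `L + 1_j`;
as an operator on `|L⟩`, `f` therefore has the amplitudes `F (L - 1_j) j`. The indices of `ψ^±` are
those of `z^{-i}`. -/
structure IsLadder (q1 q2 q3 : ℂ) (adm : (ℕ → ℤ) → Prop) (E F v : (ℕ → ℤ) → ℕ → ℂ)
    (psiP psiM : (ℕ → ℤ) → ℤ → ℂ) : Prop where
  mul_eq_one : q1 * q2 * q3 = 1
  halfE : HalfCurrent (q1 + q2 + q3) (q1 * q2 + q1 * q3 + q2 * q3) box E v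
  halfF : HalfCurrent (q1 * q2 + q1 * q3 + q2 * q3) (q1 + q2 + q3) (-box)
    (fun L j => F (L - box j) j) (fun L j => v (L - box j) j)
  edgeE : ∀ L j, E L j ≠ 0 → adm L ∧ adm (L + box j)
  edgeF : ∀ L j, F L j ≠ 0 → adm L ∧ adm (L + box j)
  off_diag : ∀ L j k, j ≠ k →
    F (L - box j) j * E (L - box j) k = E L k * F (L + box k - box j) j
  diag : ∀ L m, ∑ᶠ j, E (L - box j) j * F (L - box j) j * v (L - box j) j ^ m -
    ∑ᶠ j, E L j * F L j * v L j ^ m =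
      ((1 - q1) * (1 - q2) * (1 - q3))⁻¹ * (psiP L m - psiM L m)
  psiP_rec : ∀ L j, adm L → adm (L + box j) → ∀ i,
    psiP (L + box j) (i + 3) - (q1 + q2 + q3) * v L j * psiP (L + box j) (i + 2) +
      (q1 * q2 + q1 * q3 + q2 * q3) * v L j ^ 2 * psiP (L + box j) (i + 1) -
        v L j ^ 3 * psiP (L + box j) i =
    psiP L (i + 3) - (q1 * q2 + q1 * q3 + q2 * q3) * v L j * psiP L (i + 2) +
      (q1 + q2 + q3) * v L j ^ 2 * psiP L (i + 1) - v L j ^ 3 * psiP L i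
  psiM_rec : ∀ L j, adm L → adm (L + box j) → ∀ i,
    psiM (L + box j) (i + 3) - (q1 + q2 + q3) * v L j * psiM (L + box j) (i + 2) +
      (q1 * q2 + q1 * q3 + q2 * q3) * v L j ^ 2 * psiM (L + box j) (i + 1) -
        v L j ^ 3 * psiM (L + box j) i =
    psiM L (i + 3) - (q1 * q2 + q1 * q3 + q2 * q3) * v L j * psiM L (i + 2) +
      (q1 + q2 + q3) * v L j ^ 2 * psiM L (i + 1) - v L j ^ 3 * psiM L i
  psiP_neg : ∀ L i, i < 0 → psiP L i = 0
  psiM_pos : ∀ L i, 0 < i → psiM L i = 0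
  psiP_zero : ∀ L, psiP L 0 ≠ 0
  psiM_zero : ∀ L, psiM L 0 ≠ 0

/-- The operators by which the generators act. -/
def ladderOp (E F v : (ℕ → ℤ) → ℕ → ℂ) (psiP psiM : (ℕ → ℤ) → ℤ → ℂ) :
    Gen → Module.End ℂ ((ℕ → ℤ) →₀ ℂ)
  | .e m => mode box E v m
  | .f m => mode (-box) (fun L j => F (L - box j) j) (fun L j => v (L - box j) j) m
  | .psiPlus i => diagOp fun L => psiP L i
  | .psiMinus i => diagOp fun L => psiM L (-i)
  | .psiPlusInv => diagOp fun L => (psiP L 0)⁻¹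
  | .psiMinusInv => diagOp fun L => (psiM L 0)⁻¹

namespace IsLadder

variable {q1 q2 q3 : ℂ} {adm : (ℕ → ℤ) → Prop} {E F v : (ℕ → ℤ) → ℕ → ℂ}
  {psiP psiM : (ℕ → ℤ) → ℤ → ℂ}

/-- A diagonal current and a half current satisfy the mixed relation, if the eigenvalues do. -/
theorem diag_mode {s1 s2 : ℂ} {ε : ℕ → ℕ → ℤ} {A w : (ℕ → ℤ) → ℕ → ℂ} {ψ : (ℕ → ℤ) → ℤ → ℂ}
    (H : HalfCurrent s1 s2 ε A w) (hψ : ∀ L j, A L j ≠ 0 → ∀ i,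
      ψ (L + ε j) (i + 3) - s1 * w L j * ψ (L + ε j) (i + 2) +
        s2 * w L j ^ 2 * ψ (L + ε j) (i + 1) - w L j ^ 3 * ψ (L + ε j) i =
      ψ L (i + 3) - s2 * w L j * ψ L (i + 2) + s1 * w L j ^ 2 * ψ L (i + 1) - w L j ^ 3 * ψ L i)
    (i j : ℤ) :
    diagOp (fun L => ψ L (i + 3)) * mode ε A w j
      - s1 • (diagOp (fun L => ψ L (i + 2)) * mode ε A w (j + 1))
      + s2 • (diagOp (fun L => ψ L (i + 1)) * mode ε A w (j + 2))
      - diagOp (fun L => ψ L i) * mode ε A w (j + 3) =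
    -(mode ε A w (j + 3) * diagOp (fun L => ψ L i)
      - s1 • (mode ε A w (j + 2) * diagOp (fun L => ψ L (i + 1)))
      + s2 • (mode ε A w (j + 1) * diagOp (fun L => ψ L (i + 2)))
      - mode ε A w j * diagOp (fun L => ψ L (i + 3))) := by
  refine end_ext fun L => ?_
  obtain ⟨S, hS, -⟩ := exists_finset_two (ε := ε) H.finite H.finite L
  have key : ∀ m : ℤ, mode ε A w m (ket L) = ∑ a ∈ S, (A L a * w L a ^ m) • ket (L + ε a) :=
    fun m => hop_ket S L fun a h => hS a (left_ne_zero_of_mul h)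
  simp only [LinearMap.add_apply, LinearMap.sub_apply, LinearMap.smul_apply, LinearMap.neg_apply,
    Module.End.mul_apply, diagOp_ket, map_smul, key, map_sum, Finset.smul_sum, smul_smul,
    ← Finset.sum_add_distrib, ← Finset.sum_sub_distrib, ← sub_smul, ← add_smul,
    ← Finset.sum_neg_distrib, ← neg_smul]
  refine Finset.sum_congr rfl fun a _ => ?_
  congr 1
  by_cases ha : A L a = 0
  · simp [ha]
  · have h := hψ L a ha i
    have hw := H.ne_zero L a
    simp only [zpow_add₀ hw, zpow_ofNat]
    linear_combination (A L a * w L a ^ j) * h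

/-- The commutator `[e_i, f_j]`: the terms with two different boxes cancel by `off_diag`, the others give
the diagonal operator in `diag`. -/
theorem commutator (H : IsLadder q1 q2 q3 adm E F v psiP psiM) (i j : ℤ) :
    mode box E v i * mode (-box) (fun L j => F (L - box j) j) (fun L j => v (L - box j) j) j -
      mode (-box) (fun L j => F (L - box j) j) (fun L j => v (L - box j) j) j * mode box E v i =
    ((1 - q1) * (1 - q2) * (1 - q3))⁻¹ •
      (diagOp (fun L => psiP L (i + j)) - diagOp (fun L => psiM L (i + j))) := by
  classical
  refine end_ext fun L => ?_
  obtain ⟨S1, hS1, hS1'⟩ := exists_finset_two (ε := box) H.halfE.finite H.halfF.finite L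
  obtain ⟨S2, hS2, hS2'⟩ := exists_finset_two (ε := -box) H.halfF.finite H.halfE.finite L
  set S := S1 ∪ S2 with hS
  have h1 : ∀ (m : ℤ) L a, E L a * v L a ^ m ≠ 0 → E L a ≠ 0 :=
    fun m L a h => left_ne_zero_of_mul h
  have h2 : ∀ (m : ℤ) L a, F (L - box a) a * v (L - box a) a ^ m ≠ 0 → F (L - box a) a ≠ 0 :=
    fun m L a h => left_ne_zero_of_mul h
  have k1 := hop_hop_ket (ε := -box) (ε' := box) (A := fun L a => F (L - box a) a * v (L - box a) a ^ j)
    (A' := fun L a => E L a * v L a ^ i) S L (fun a h => mem_union_right _ (hS2 a (h2 _ _ _ h)))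
    (fun a b h h' => mem_union_right _ (hS2' a b (h2 _ _ _ h) (h1 _ _ _ h')))
  have k2 := hop_hop_ket (ε := box) (ε' := -box) (A := fun L a => E L a * v L a ^ i)
    (A' := fun L a => F (L - box a) a * v (L - box a) a ^ j) S L
    (fun a h => mem_union_left _ (hS1 a (h1 _ _ _ h)))
    (fun a b h h' => mem_union_left _ (hS1' a b (h1 _ _ _ h) (h2 _ _ _ h')))
  rw [Finset.sum_comm] at k2
  have e1 : ∑ᶠ a, E (L - box a) a * F (L - box a) a * v (L - box a) a ^ (i + j) =
      ∑ a ∈ S, E (L - box a) a * F (L - box a) a * v (L - box a) a ^ (i + j) :=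
    finsum_eq_sum_of_support_subset _ fun a ha => by
      refine mem_coe.2 (mem_union_right _ (hS2 a ?_))
      exact fun h => ha (by simp [h])
  have e2 : ∑ᶠ a, E L a * F L a * v L a ^ (i + j) =
      ∑ a ∈ S, E L a * F L a * v L a ^ (i + j) :=
    finsum_eq_sum_of_support_subset _ fun a ha => by
      refine mem_coe.2 (mem_union_left _ (hS1 a ?_))
      exact fun h => ha (by simp [h])
  have hd := H.diag L (i + j)
  rw [e1, e2, ← Finset.sum_sub_distrib] at hd
  unfold mode
  rw [LinearMap.sub_apply, k1, k2, LinearMap.smul_apply, LinearMap.sub_apply, diagOp_ket,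
    diagOp_ket, ← sub_smul, smul_smul, ← hd, Finset.sum_smul, ← Finset.sum_sub_distrib]
  refine Finset.sum_congr rfl fun a ha => ?_
  rw [← Finset.sum_sub_distrib, Finset.sum_eq_single a]
  · simp only [Pi.neg_apply, ← sub_eq_add_neg, sub_add_cancel, add_sub_cancel_right]
    rw [← sub_smul]
    congr 1
    rw [zpow_add₀ (H.halfE.ne_zero _ _), zpow_add₀ (H.halfE.ne_zero _ _)]
    ring
  · intro b _ hba
    have hab : a ≠ b := Ne.symm hba
    have s1 : v (L - box a) b = v L b := by
      have := H.halfE.shift (L - box a) a b hab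
      rwa [sub_add_cancel, eq_comm] at this
    have s2 : v (L + box b - box a) a = v (L - box a) a := by
      have := H.halfE.shift (L - box a) b a hba
      rwa [sub_add_eq_add_sub] at this
    simp only [Pi.neg_apply, ← sub_eq_add_neg]
    rw [s1, s2, sub_add_eq_add_sub, ← sub_smul]
    convert zero_smul ℂ _
    linear_combination (v (L - box a) a ^ j * v L b ^ i) * H.off_diag L a b hab
  · exact fun h => (h ha).elim

/-- The recursions for `ψ⁺` and `ψ⁻` are the same. -/
theorem psi_rec (H : IsLadder q1 q2 q3 adm E F v psiP psiM) (L : ℕ → ℤ) (j : ℕ) (h : adm L)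
    (h' : adm (L + box j)) (ψ : (ℕ → ℤ) → ℤ → ℂ) (hψ : ψ = psiP ∨ ψ = psiM) (i : ℤ) :
    ψ (L + box j) (i + 3) - (q1 + q2 + q3) * v L j * ψ (L + box j) (i + 2) +
      (q1 * q2 + q1 * q3 + q2 * q3) * v L j ^ 2 * ψ (L + box j) (i + 1) -
        v L j ^ 3 * ψ (L + box j) i =
    ψ L (i + 3) - (q1 * q2 + q1 * q3 + q2 * q3) * v L j * ψ L (i + 2) +
      (q1 + q2 + q3) * v L j ^ 2 * ψ L (i + 1) - v L j ^ 3 * ψ L i := by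
  rcases hψ with rfl | rfl
  · exact H.psiP_rec L j h h' i
  · exact H.psiM_rec L j h h' i

theorem diag_e (H : IsLadder q1 q2 q3 adm E F v psiP psiM) (ψ : (ℕ → ℤ) → ℤ → ℂ)
    (hψ : ψ = psiP ∨ ψ = psiM) (i j : ℤ) :
    diagOp (fun L => ψ L (i + 3)) * mode box E v j
      - (q1 + q2 + q3) • (diagOp (fun L => ψ L (i + 2)) * mode box E v (j + 1))
      + (q1 * q2 + q1 * q3 + q2 * q3) • (diagOp (fun L => ψ L (i + 1)) * mode box E v (j + 2))
      - diagOp (fun L => ψ L i) * mode box E v (j + 3) =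
    -(mode box E v (j + 3) * diagOp (fun L => ψ L i)
      - (q1 + q2 + q3) • (mode box E v (j + 2) * diagOp (fun L => ψ L (i + 1)))
      + (q1 * q2 + q1 * q3 + q2 * q3) • (mode box E v (j + 1) * diagOp (fun L => ψ L (i + 2)))
      - mode box E v j * diagOp (fun L => ψ L (i + 3))) :=
  diag_mode H.halfE (fun L j h i => H.psi_rec L j (H.edgeE L j h).1 (H.edgeE L j h).2 ψ hψ i) i j

theorem diag_f (H : IsLadder q1 q2 q3 adm E F v psiP psiM) (ψ : (ℕ → ℤ) → ℤ → ℂ)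
    (hψ : ψ = psiP ∨ ψ = psiM) (i j : ℤ) {f : ℤ → Module.End ℂ ((ℕ → ℤ) →₀ ℂ)}
    (hf : f = mode (-box) (fun L j => F (L - box j) j) (fun L j => v (L - box j) j)) :
    diagOp (fun L => ψ L i) * f (j + 3)
      - (q1 + q2 + q3) • (diagOp (fun L => ψ L (i + 1)) * f (j + 2))
      + (q1 * q2 + q1 * q3 + q2 * q3) • (diagOp (fun L => ψ L (i + 2)) * f (j + 1))
      - diagOp (fun L => ψ L (i + 3)) * f j =
    -(f j * diagOp (fun L => ψ L (i + 3))
      - (q1 + q2 + q3) • (f (j + 1) * diagOp (fun L => ψ L (i + 2)))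
      + (q1 * q2 + q1 * q3 + q2 * q3) • (f (j + 2) * diagOp (fun L => ψ L (i + 1)))
      - f (j + 3) * diagOp (fun L => ψ L i)) := by
  subst hf
  have := diag_mode (ψ := ψ) H.halfF (fun L j h i => ?_) i j
  · rw [← sub_eq_zero] at this ⊢
    rw [← neg_eq_zero, ← this]
    abel
  · have := H.psi_rec (L - box j) j (H.edgeF _ j h).1 (H.edgeF _ j h).2 ψ hψ i
    simp only [Pi.neg_apply, ← sub_eq_add_neg, sub_add_cancel] at this ⊢
    linear_combination -this

theorem relations (H : IsLadder q1 q2 q3 adm E F v psiP psiM) ⦃x y : Free⦄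
    (h : Rel q1 q2 q3 x y) :
    FreeAlgebra.lift ℂ (ladderOp E F v psiP psiM) x =
      FreeAlgebra.lift ℂ (ladderOp E F v psiP psiM) y := by
  set φ := FreeAlgebra.lift ℂ (ladderOp E F v psiP psiM) with hφ
  have he : ∀ i, φ (eS i) = mode box E v i := fun i => by rw [eS, hφ, FreeAlgebra.lift_ι_apply]; rfl
  obtain ⟨f, hf⟩ : ∃ f, f = mode (-box) (fun L j => F (L - box j) j) (fun L j => v (L - box j) j) :=
    ⟨_, rfl⟩
  have hf' : ∀ i, φ (fS i) = f i := fun i => by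
    rw [fS, hφ, FreeAlgebra.lift_ι_apply, hf]; rfl
  have hz : diagOp (fun _ : ℕ → ℤ => (0 : ℂ)) = 0 := end_ext fun L => by rw [diagOp_ket]; simp
  have hp : ∀ i, φ (psiPlusS i) = diagOp fun L => psiP L i := fun i => by
    rw [psiPlusS]
    split_ifs with hi
    · rw [hφ, FreeAlgebra.lift_ι_apply, ladderOp, Int.toNat_of_nonneg hi]
    · rw [map_zero, ← hz]
      congr 1; funext L; exact (H.psiP_neg L i (not_le.mp hi)).symm
  have hm : ∀ i, φ (psiMinusS i) = diagOp fun L => psiM L i := fun i => by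
    rw [psiMinusS]
    split_ifs with hi
    · rw [hφ, FreeAlgebra.lift_ι_apply, ladderOp, Int.toNat_of_nonneg (by omega), neg_neg]
    · rw [map_zero, ← hz]
      congr 1; funext L; exact (H.psiM_pos L i (not_le.mp hi)).symm
  have hpi : φ (FreeAlgebra.ι ℂ Gen.psiPlusInv) = diagOp fun L => (psiP L 0)⁻¹ := by
    rw [hφ, FreeAlgebra.lift_ι_apply]; rfl
  have hmi : φ (FreeAlgebra.ι ℂ Gen.psiMinusInv) = diagOp fun L => (psiM L 0)⁻¹ := by
    rw [hφ, FreeAlgebra.lift_ι_apply]; rfl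
  have hone : ∀ a : (ℕ → ℤ) → ℂ, (∀ L, a L = 1) → diagOp a = 1 := fun a ha => by
    rw [← diagOp_one]; congr 1; funext L; exact ha L
  have hcomm : ∀ a b : (ℕ → ℤ) → ℂ, diagOp a * diagOp b - diagOp b * diagOp a = 0 :=
    fun a b => by rw [diagOp_mul, diagOp_mul, mul_comm]; exact sub_self (diagOp (b * a))
  cases h with
  | ee i j =>
    have := H.halfE.quadratic i j
    simp only [gzw, gwz, H.mul_eq_one, one_smul, map_add, map_sub, map_neg, map_smul, map_mul, he]
    rw [← sub_eq_zero, ← this]; abel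
  | ff i j =>
    have := H.halfF.quadratic i j
    rw [← hf] at this
    simp only [gzw, gwz, H.mul_eq_one, one_smul, map_add, map_sub, map_neg, map_smul, map_mul, hf']
    rw [← sub_eq_zero, ← neg_eq_zero, ← this]; abel
  | psiPlus_e i j =>
    simp only [gzw, gwz, H.mul_eq_one, one_smul, map_add, map_sub, map_neg, map_smul, map_mul, he,
      hp]
    exact H.diag_e _ (Or.inl rfl) i j
  | psiMinus_e i j =>
    simp only [gzw, gwz, H.mul_eq_one, one_smul, map_add, map_sub, map_neg, map_smul, map_mul, he,
      hm]
    exact H.diag_e _ (Or.inr rfl) i j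
  | psiPlus_f i j =>
    simp only [gzw, gwz, H.mul_eq_one, one_smul, map_add, map_sub, map_neg, map_smul, map_mul, hf',
      hp]
    exact H.diag_f _ (Or.inl rfl) i j hf
  | psiMinus_f i j =>
    simp only [gzw, gwz, H.mul_eq_one, one_smul, map_add, map_sub, map_neg, map_smul, map_mul, hf',
      hm]
    exact H.diag_f _ (Or.inr rfl) i j hf
  | ef i j =>
    simp only [comm, map_sub, map_smul, map_mul, he, hf', hp, hm]
    rw [hf]
    exact H.commutator i j
  | psiPlus_psiPlus i j => simp only [comm, map_sub, map_mul, hp, map_zero, hcomm]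
  | psiMinus_psiMinus i j => simp only [comm, map_sub, map_mul, hm, map_zero, hcomm]
  | psiPlus_psiMinus i j => simp only [comm, map_sub, map_mul, hp, hm, map_zero, hcomm]
  | psiPlus_inv =>
    rw [map_mul, hp, hpi, diagOp_mul, map_one]
    exact hone _ fun L => mul_inv_cancel₀ (H.psiP_zero L)
  | inv_psiPlus =>
    rw [map_mul, hp, hpi, diagOp_mul, map_one]
    exact hone _ fun L => inv_mul_cancel₀ (H.psiP_zero L)
  | psiMinus_inv =>
    rw [map_mul, hm, hmi, diagOp_mul, map_one]
    exact hone _ fun L => mul_inv_cancel₀ (H.psiM_zero L)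
  | inv_psiMinus =>
    rw [map_mul, hm, hmi, diagOp_mul, map_one]
    exact hone _ fun L => inv_mul_cancel₀ (H.psiM_zero L)
  | serre_e =>
    simp only [comm, map_sub, map_mul, he, map_zero]
    exact H.halfE.serre
  | serre_f =>
    simp only [comm, map_sub, map_mul, hf', map_zero]
    rw [hf]
    exact H.halfF.serre

/-- The action of the algebra on the span of all integer sequences. -/
def rep (H : IsLadder q1 q2 q3 adm E F v psiP psiM) :
    Alg q1 q2 q3 →ₐ[ℂ] Module.End ℂ ((ℕ → ℤ) →₀ ℂ) :=
  RingQuot.liftAlgHom ℂ ⟨FreeAlgebra.lift ℂ (ladderOp E F v psiP psiM), H.relations⟩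

theorem rep_gen (H : IsLadder q1 q2 q3 adm E F v psiP psiM) (x : Gen) :
    H.rep (gen q1 q2 q3 x) = ladderOp E F v psiP psiM x := by
  rw [rep, gen, RingQuot.liftAlgHom_mkAlgHom_apply, FreeAlgebra.lift_ι_apply]

end IsLadder

/-! ### The subrepresentation on admissible sequences -/

/-- The restriction of a representation to an invariant subspace. -/
def restrictRep {R V : Type} [Ring R] [Algebra ℂ R] [AddCommGroup V] [Module ℂ V]
    (ρ : R →ₐ[ℂ] Module.End ℂ V) (W : Submodule ℂ V) (h : ∀ x, ∀ y ∈ W, ρ x y ∈ W) :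
    R →ₐ[ℂ] Module.End ℂ W :=
  AlgHom.ofLinearMap
    { toFun := fun x => (ρ x).restrict (h x)
      map_add' := fun x y => by ext1 w; apply Subtype.ext; simp [LinearMap.restrict_apply]
      map_smul' := fun c x => by ext1 w; apply Subtype.ext; simp [LinearMap.restrict_apply] }
    (by ext1 w; apply Subtype.ext; simp [LinearMap.restrict_apply])
    (fun x y => by ext1 w; apply Subtype.ext; simp [LinearMap.restrict_apply])

theorem mem_supported_of_ket {T : Type} {s : Set T} {L : T} (h : L ∈ s) :
    ket L ∈ Finsupp.supported ℂ ℂ s := Finsupp.single_mem_supported ℂ 1 h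

namespace IsLadder

variable {q1 q2 q3 : ℂ} {adm : (ℕ → ℤ) → Prop} {E F v : (ℕ → ℤ) → ℕ → ℂ}
  {psiP psiM : (ℕ → ℤ) → ℤ → ℂ}

theorem hop_mem_supported {ε : ℕ → ℕ → ℤ} {A : (ℕ → ℤ) → ℕ → ℂ} {L : ℕ → ℤ}
    (hA : {j | A L j ≠ 0}.Finite) (h : ∀ j, A L j ≠ 0 → adm (L + ε j)) :
    hop ε A (ket L) ∈ Finsupp.supported ℂ ℂ {L | adm L} := by
  rw [hop_ket hA.toFinset L (fun j hj => by simpa using hj)]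
  refine Submodule.sum_mem _ fun j hj => Submodule.smul_mem _ _ (mem_supported_of_ket (h j ?_))
  simpa using hj

theorem ladderOp_mem_supported (H : IsLadder q1 q2 q3 adm E F v psiP psiM) (x : Gen) {L : ℕ → ℤ}
    (hL : adm L) :
    ladderOp E F v psiP psiM x (ket L) ∈ Finsupp.supported ℂ ℂ {L | adm L} := by
  have hd : ∀ a : (ℕ → ℤ) → ℂ, diagOp a (ket L) ∈ Finsupp.supported ℂ ℂ {L | adm L} := fun a => by
    rw [diagOp_ket]
    exact Submodule.smul_mem _ _ (mem_supported_of_ket hL)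
  cases x with
  | e m =>
    refine hop_mem_supported ((H.halfE.finite L).subset fun j hj => left_ne_zero_of_mul hj)
      fun j hj => (H.edgeE L j (left_ne_zero_of_mul hj)).2
  | f m =>
    refine hop_mem_supported ((H.halfF.finite L).subset fun j hj => left_ne_zero_of_mul hj)
      fun j hj => ?_
    have := (H.edgeF (L - box j) j (left_ne_zero_of_mul hj)).1
    rwa [sub_eq_add_neg] at this
  | psiPlus i => exact hd _
  | psiMinus i => exact hd _
  | psiPlusInv => exact hd _
  | psiMinusInv => exact hd _

theorem rep_mem_supported (H : IsLadder q1 q2 q3 adm E F v psiP psiM) (x : Alg q1 q2 q3) :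
    ∀ y ∈ Finsupp.supported ℂ ℂ {L | adm L}, H.rep x y ∈ Finsupp.supported ℂ ℂ {L | adm L} := by
  obtain ⟨x, rfl⟩ := RingQuot.mkAlgHom_surjective ℂ (Rel q1 q2 q3) x
  induction x using FreeAlgebra.induction with
  | grade0 c =>
    intro y hy
    rw [AlgHom.commutes, AlgHom.commutes]
    exact Submodule.smul_mem _ c hy
  | grade1 x =>
    intro y hy
    have hx : H.rep (RingQuot.mkAlgHom ℂ (Rel q1 q2 q3) (FreeAlgebra.ι ℂ x)) =
      ladderOp E F v psiP psiM x := H.rep_gen x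
    rw [hx]
    rw [Finsupp.supported_eq_span_single] at hy
    induction hy using Submodule.span_induction with
    | mem y hy =>
      obtain ⟨L, hL, rfl⟩ := hy
      exact H.ladderOp_mem_supported x hL
    | zero => rw [map_zero]; exact Submodule.zero_mem _
    | add y z _ _ hy hz => rw [map_add]; exact Submodule.add_mem _ hy hz
    | smul c y _ hy => rw [map_smul]; exact Submodule.smul_mem _ c hy
  | mul a b ha hb =>
    intro y hy
    rw [map_mul, map_mul, Module.End.mul_apply]
    exact ha _ (hb _ hy)
  | add a b ha hb =>
    intro y hy
    rw [map_add, map_add, LinearMap.add_apply]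
    exact Submodule.add_mem _ (ha _ hy) (hb _ hy)

/-- The action of the algebra on the span of the `|L⟩` with `adm L`. -/
def admRep (H : IsLadder q1 q2 q3 adm E F v psiP psiM) :
    Alg q1 q2 q3 →ₐ[ℂ] Module.End ℂ ({L // adm L} →₀ ℂ) :=
  ((Finsupp.supportedEquivFinsupp {L | adm L}).conjAlgEquiv ℂ).toAlgHom.comp
    (restrictRep H.rep (Finsupp.supported ℂ ℂ {L | adm L}) H.rep_mem_supported)

theorem admRep_gen_ket (H : IsLadder q1 q2 q3 adm E F v psiP psiM) (x : Gen) (L L' : {L // adm L}) :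
    H.admRep (gen q1 q2 q3 x) (ket L) L' = ladderOp E F v psiP psiM x (ket L.1) L'.1 := by
  rw [← H.rep_gen x, ket, ket, ← Finsupp.supportedEquivFinsupp_symm_single (R := ℂ) {L | adm L} L (1 : ℂ)]
  rfl

theorem box_injective : Function.Injective box := fun i j h => by
  by_contra hij
  have := congrFun h i
  simp [box, hij] at this

theorem hop_ket_apply {ε : ℕ → ℕ → ℤ} (hε : Function.Injective ε) {A : (ℕ → ℤ) → ℕ → ℂ}
    {L : ℕ → ℤ} (hA : {j | A L j ≠ 0}.Finite) (j : ℕ) :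
    hop ε A (ket L) (L + ε j) = A L j := by
  classical
  rw [hop_ket hA.toFinset L (fun j hj => by simpa using hj)]
  simp only [Finsupp.finsetSum_apply, Finsupp.smul_apply, ket, smul_eq_mul,
    Finsupp.single_apply, add_right_inj, hε.eq_iff, mul_ite, mul_one, mul_zero,
    Finset.sum_ite_eq']
  simp +contextual [eq_comm]

theorem hop_ket_apply_of_ne {ε : ℕ → ℕ → ℤ} {A : (ℕ → ℤ) → ℕ → ℂ} {L L' : ℕ → ℤ}
    (hA : {j | A L j ≠ 0}.Finite) (h : ∀ j, L' ≠ L + ε j) : hop ε A (ket L) L' = 0 := by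
  classical
  rw [hop_ket hA.toFinset L (fun j hj => by simpa using hj)]
  rw [Finsupp.finsetSum_apply]
  refine Finset.sum_eq_zero fun j _ => ?_
  rw [Finsupp.smul_apply, ket, Finsupp.single_apply, if_neg (Ne.symm (h j)), smul_zero]

theorem admRep_e (H : IsLadder q1 q2 q3 adm E F v psiP psiM) (m : ℤ) (L L' : {L // adm L}) (j : ℕ)
    (h : L'.1 = L.1 + box j) :
    H.admRep (gen q1 q2 q3 (.e m)) (ket L) L' = E L.1 j * v L.1 j ^ m := by
  rw [admRep_gen_ket, h]
  exact hop_ket_apply (A := fun L j => E L j * v L j ^ m) box_injective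
    ((H.halfE.finite L.1).subset fun j hj => left_ne_zero_of_mul hj) j

theorem admRep_e_of_ne (H : IsLadder q1 q2 q3 adm E F v psiP psiM) (m : ℤ) (L L' : {L // adm L})
    (h : ∀ j, L'.1 ≠ L.1 + box j) : H.admRep (gen q1 q2 q3 (.e m)) (ket L) L' = 0 := by
  rw [admRep_gen_ket]
  exact hop_ket_apply_of_ne ((H.halfE.finite L.1).subset fun j hj => left_ne_zero_of_mul hj) h

theorem admRep_f (H : IsLadder q1 q2 q3 adm E F v psiP psiM) (m : ℤ) (L L' : {L // adm L}) (j : ℕ)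
    (h : L'.1 = L.1 + box j) :
    H.admRep (gen q1 q2 q3 (.f m)) (ket L') L = F L.1 j * v L.1 j ^ m := by
  have h' : L.1 = L'.1 + (-box) j := by rw [h, Pi.neg_apply, add_neg_cancel_right]
  have key := hop_ket_apply (ε := -box)
    (A := fun L j => F (L - box j) j * v (L - box j) j ^ m) (L := L'.1)
    (fun i j hij => box_injective (neg_injective hij))
    ((H.halfF.finite L'.1).subset fun j hj => left_ne_zero_of_mul hj) j
  rw [← h', show L'.1 - box j = L.1 by rw [h, add_sub_cancel_right]] at key
  rw [admRep_gen_ket]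
  exact key

theorem admRep_f_of_ne (H : IsLadder q1 q2 q3 adm E F v psiP psiM) (m : ℤ) (L L' : {L // adm L})
    (h : ∀ j, L'.1 ≠ L.1 + box j) : H.admRep (gen q1 q2 q3 (.f m)) (ket L') L = 0 := by
  rw [admRep_gen_ket]
  refine hop_ket_apply_of_ne ((H.halfF.finite L'.1).subset fun j hj => left_ne_zero_of_mul hj)
    fun j hj => h j ?_
  rw [hj, Pi.neg_apply, neg_add_cancel_right]

theorem admRep_diag (H : IsLadder q1 q2 q3 adm E F v psiP psiM) (x : Gen) (L : {L // adm L}) (c : ℂ)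
    (h : ladderOp E F v psiP psiM x (ket L.1) = c • ket L.1) :
    H.admRep (gen q1 q2 q3 x) (ket L) = c • ket L := by
  classical
  ext L'
  rw [admRep_gen_ket, h]
  simp only [ket, Finsupp.smul_apply, Finsupp.single_apply, Subtype.ext_iff]

theorem admRep_psiPlus (H : IsLadder q1 q2 q3 adm E F v psiP psiM) (m : ℕ) (L : {L // adm L}) :
    H.admRep (gen q1 q2 q3 (.psiPlus m)) (ket L) = psiP L.1 m • ket L :=
  H.admRep_diag _ L _ (diagOp_ket _ _)

theorem admRep_psiMinus (H : IsLadder q1 q2 q3 adm E F v psiP psiM) (m : ℕ) (L : {L // adm L}) :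
    H.admRep (gen q1 q2 q3 (.psiMinus m)) (ket L) = psiM L.1 (-m) • ket L :=
  H.admRep_diag _ L _ (diagOp_ket _ _)

end IsLadder

/-! ### Grading -/

section Graded

variable {q1 q2 q3 : ℂ} {P B : Type} {ρ : Alg q1 q2 q3 →ₐ[ℂ] Module.End ℂ (P →₀ ℂ)}

theorem modGrade_eq_supported (deg : P → ℤ) (d : ℤ) :
    modGrade deg d = Finsupp.supported ℂ ℂ {l | deg l = d} := by
  rw [Finsupp.supported_eq_span_single, modGrade]
  congr 1
  ext x
  simp [ket, eq_comm]

theorem gen_relation {x y : Free} (h : Rel q1 q2 q3 x y) :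
    RingQuot.mkAlgHom ℂ (Rel q1 q2 q3) x = RingQuot.mkAlgHom ℂ (Rel q1 q2 q3) y :=
  RingQuot.mkAlgHom_rel ℂ h

/-- The inverse of an invertible element acting diagonally acts diagonally. -/
theorem map_ket_of_inverse {x y : Alg q1 q2 q3} (hyx : y * x = 1) {l : P} {c : ℂ}
    (h : ρ x (ket l) = c • ket l) : ∃ d : ℂ, ρ y (ket l) = d • ket l := by
  have h1 : ρ y (ρ x (ket l)) = ket l := by
    rw [← Module.End.mul_apply, ← map_mul, hyx, map_one]; rfl
  rw [h, map_smul] at h1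
  have hc : c ≠ 0 := fun hc => by
    rw [hc, zero_smul] at h1
    exact one_ne_zero (Finsupp.single_eq_zero.mp h1.symm)
  exact ⟨c⁻¹, by rw [← inv_smul_smul₀ hc (ρ y (ket l)), h1]⟩

/-- An action with the listed matrix coefficients is graded, as soon as adding a box raises the degree
by one. -/
theorem HasMatrixCoefficients.isGradedModule {adds : P → B → P → Prop} {v : P → B → ℂ}
    {eF fF : P → B → RatFunc ℂ → RatFunc ℂ} {psi : P → RatFunc ℂ → RatFunc ℂ}
    (H : HasMatrixCoefficients ρ adds v eF fF psi) (deg : P → ℤ)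
    (hdeg : ∀ l b l', adds l b l' → deg l' = deg l + 1) : IsGradedModule ρ deg := by
  have hdiag : ∀ (x : Gen) (l : P) (c : ℂ),
      ρ (gen q1 q2 q3 x) (ket l) = c • ket l → x.deg = 0 →
      ρ (gen q1 q2 q3 x) (ket l) ∈ modGrade deg (x.deg + deg l) := by
    intro x l c h hx
    rw [h, hx, zero_add, modGrade_eq_supported]
    exact Submodule.smul_mem _ _ (mem_supported_of_ket rfl)
  have hpsi : gen q1 q2 q3 .psiPlusInv * gen q1 q2 q3 (.psiPlus 0) = 1 := by
    have h := gen_relation (Rel.inv_psiPlus (q1 := q1) (q2 := q2) (q3 := q3))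
    rwa [map_mul, map_one] at h
  have hpsi' : gen q1 q2 q3 .psiMinusInv * gen q1 q2 q3 (.psiMinus 0) = 1 := by
    have h := gen_relation (Rel.inv_psiMinus (q1 := q1) (q2 := q2) (q3 := q3))
    rwa [map_mul, map_one] at h
  have hgen : ∀ (x : Gen) (l : P), ρ (gen q1 q2 q3 x) (ket l) ∈ modGrade deg (x.deg + deg l) := by
    intro x l
    cases x with
    | e m =>
      rw [modGrade_eq_supported, Finsupp.mem_supported']
      intro l' hl'
      refine H.e_other m l l' ?_
      rintro ⟨b, hb⟩
      exact hl' ((hdeg l b l' hb).trans (add_comm _ _))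
    | f m =>
      rw [modGrade_eq_supported, Finsupp.mem_supported']
      intro l' hl'
      refine H.f_other m l' l ?_
      rintro ⟨b, hb⟩
      refine hl' ?_
      have := hdeg l' b l hb
      change deg l' = -1 + deg l
      omega
    | psiPlus i => exact hdiag _ l _ (H.psiPlus i l) rfl
    | psiMinus i => exact hdiag _ l _ (H.psiMinus i l) rfl
    | psiPlusInv =>
      obtain ⟨d, hd⟩ := map_ket_of_inverse hpsi (H.psiPlus 0 l)
      exact hdiag _ l _ hd rfl
    | psiMinusInv =>
      obtain ⟨d, hd⟩ := map_ket_of_inverse hpsi' (H.psiMinus 0 l)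
      exact hdiag _ l _ hd rfl
  have hgen' : ∀ (x : Gen) (k : ℤ), ∀ y ∈ modGrade deg k,
      ρ (gen q1 q2 q3 x) y ∈ modGrade deg (x.deg + k) := by
    intro x k y hy
    induction hy using Submodule.span_induction with
    | mem y hy => obtain ⟨l, rfl, rfl⟩ := hy; exact hgen x l
    | zero => rw [map_zero]; exact Submodule.zero_mem _
    | add y z _ _ hy hz => rw [map_add]; exact Submodule.add_mem _ hy hz
    | smul c y _ hy => rw [map_smul]; exact Submodule.smul_mem _ c hy
  intro d k x hx y hy
  induction hx using Submodule.span_induction with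
  | mem x hx =>
    obtain ⟨w, rfl, rfl⟩ := hx
    induction w with
    | nil => simpa using hy
    | cons a w ih =>
      rw [List.map_cons, List.map_cons, List.prod_cons, List.sum_cons, map_mul,
        Module.End.mul_apply, add_assoc]
      exact hgen' a _ _ ih
  | zero => rw [map_zero]; exact Submodule.zero_mem _
  | add a b _ _ ha hb => rw [map_add]; exact Submodule.add_mem _ ha hb
  | smul c a _ ha => rw [map_smul]; exact Submodule.smul_mem _ c ha

end Graded

/-! ### Partial fractions -/

section PartialFractions

open Polynomial in
/-- Partial fractions for a denominator `∏ (1 - p y)` with simple roots: the constant term `c₀` is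
given by the leading coefficient. -/
theorem exists_partial_fractions (S : Finset ℂ) (h0 : (0 : ℂ) ∉ S) (N : ℂ[X])
    (hN : N.natDegree ≤ #S) : ∃ (c₀ : ℂ) (c : ℂ → ℂ), N.coeff #S = c₀ * ∏ p ∈ S, (-p) ∧
      ∀ (K : Type) [Field K] [Algebra ℂ K] (y : K), (∀ p ∈ S, 1 - algebraMap ℂ K p * y ≠ 0) →
        aeval y N / ∏ p ∈ S, (1 - algebraMap ℂ K p * y) =
          algebraMap ℂ K c₀ + ∑ p ∈ S, algebraMap ℂ K (c p) / (1 - algebraMap ℂ K p * y) := by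
  classical
  induction S using Finset.induction_on generalizing N with
  | empty =>
    refine ⟨N.coeff 0, 0, by simp, fun K _ _ y _ => ?_⟩
    rw [card_empty, Nat.le_zero] at hN
    rw [Polynomial.eq_C_of_natDegree_eq_zero hN]
    simp
  | insert p S hp ih =>
    simp only [mem_insert, not_or] at h0
    have hp0 : p ≠ 0 := Ne.symm h0.1
    set D : ℂ[X] := ∏ s ∈ S, (1 - C s * X) with hD
    have hDp : D.eval p⁻¹ ≠ 0 := by
      rw [hD, eval_prod, prod_ne_zero_iff]
      intro s hs h
      apply hp
      have : s * p⁻¹ = 1 := by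
        have h' : 1 - s * p⁻¹ = 0 := by simpa using h
        linear_combination -h'
      rw [mul_inv_eq_one₀ hp0] at this
      rwa [← this]
    have hDdeg : D.natDegree ≤ #S := by
      refine (natDegree_prod_le _ _).trans ?_
      rw [card_eq_sum_ones]
      refine sum_le_sum fun s _ => ?_
      compute_degree
    set t := N.eval p⁻¹ / D.eval p⁻¹ with ht
    have hroot : (N - C t * D).IsRoot p⁻¹ := by
      simp [ht, hDp]
    obtain ⟨M, hM⟩ := dvd_iff_isRoot.mpr hroot
    -- `N - t D = (1 - p X) N₁`
    set N1 : ℂ[X] := -C p⁻¹ * M with hN1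
    have hN' : N = (1 - C p * X) * N1 + C t * D := by
      have : (X - C p⁻¹) = (1 - C p * X) * (-C p⁻¹) := by
        have : C p * C p⁻¹ = (1 : ℂ[X]) := by rw [← C_mul, mul_inv_cancel₀ hp0, C_1]
        linear_combination (-X : ℂ[X]) * this
      rw [hN1, ← mul_assoc, ← this, ← hM]; ring
    have hMdeg : M.natDegree ≤ #S := by
      by_cases hM0 : M = 0
      · simp [hM0]
      have h1 : ((X - C p⁻¹) * M).natDegree = 1 + M.natDegree := by
        rw [natDegree_mul (X_sub_C_ne_zero _) hM0, natDegree_X_sub_C]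
      rw [← hM] at h1
      have h2 : (N - C t * D).natDegree ≤ #S + 1 := by
        refine (natDegree_sub_le _ _).trans (max_le ?_ ?_)
        · rwa [card_insert_of_notMem hp] at hN
        · exact (natDegree_C_mul_le _ _).trans (hDdeg.trans (Nat.le_succ _))
      omega
    have hN1deg : N1.natDegree ≤ #S := by
      rw [hN1, ← C_neg]
      exact (natDegree_C_mul_le _ _).trans hMdeg
    obtain ⟨c₀, c, hlead, hc⟩ := ih h0.2 N1 hN1deg
    refine ⟨c₀, Function.update c p t, ?_, fun K _ _ y hy => ?_⟩
    · rw [card_insert_of_notMem hp, prod_insert hp, hN']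
      have e1 : ((1 - C p * X) * N1).coeff (#S + 1) = -p * N1.coeff #S := by
        rw [sub_mul, one_mul, mul_assoc, coeff_sub, coeff_C_mul, coeff_X_mul,
          coeff_eq_zero_of_natDegree_lt (Nat.lt_succ_of_le hN1deg)]
        ring
      rw [coeff_add, e1, coeff_C_mul, coeff_eq_zero_of_natDegree_lt (Nat.lt_succ_of_le hDdeg),
        hlead]
      ring
    · simp only [mem_insert, forall_eq_or_imp] at hy
      have hc' := hc K y hy.2
      have hDy : aeval y D = ∏ s ∈ S, (1 - algebraMap ℂ K s * y) := by
        rw [hD, map_prod]; simp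
      have hDy0 : ∏ s ∈ S, (1 - algebraMap ℂ K s * y) ≠ 0 := prod_ne_zero_iff.mpr hy.2
      rw [prod_insert hp, sum_insert hp, Function.update_self]
      have : ∑ x ∈ S, algebraMap ℂ K (Function.update c p t x) / (1 - algebraMap ℂ K x * y) =
          ∑ x ∈ S, algebraMap ℂ K (c x) / (1 - algebraMap ℂ K x * y) := by
        refine sum_congr rfl fun x hx => ?_
        rw [Function.update_of_ne (ne_of_mem_of_not_mem hx hp)]
      rw [this, add_left_comm, ← hc']
      conv_lhs => rw [hN']
      simp only [map_add, map_mul, map_sub, map_one, aeval_C, aeval_X, hDy]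
      have h1 := hy.1
      generalize ∏ s ∈ S, (1 - algebraMap ℂ K s * y) = d at hDy0 ⊢
      field_simp
      ring

/-- Partial fractions for `∏ (1 - a y) / ∏ (1 - b y)` with equally many zeros and poles, when all
poles that remain after cancellation are simple. -/
theorem exists_partial_fractions_multiset (Z P : Multiset ℂ) (hZ : (0 : ℂ) ∉ Z) (hP : (0 : ℂ) ∉ P)
    (hcard : Z.card = P.card) (hcount : ∀ p, P.count p ≤ Z.count p + 1) :
    ∃ (c₀ : ℂ) (c : ℂ → ℂ), c₀ ≠ 0 ∧ c₀ + ∑ p ∈ (P - Z).toFinset, c p = 1 ∧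
      ∀ (K : Type) [Field K] [Algebra ℂ K] (y : K), (∀ p ∈ P, 1 - algebraMap ℂ K p * y ≠ 0) →
        (Z.map fun a => 1 - algebraMap ℂ K a * y).prod /
          (P.map fun a => 1 - algebraMap ℂ K a * y).prod =
          algebraMap ℂ K c₀ + ∑ p ∈ (P - Z).toFinset,
            algebraMap ℂ K (c p) / (1 - algebraMap ℂ K p * y) := by
  classical
  have hnd : (P - Z).Nodup := by
    rw [Multiset.nodup_iff_count_le_one]
    intro p
    rw [Multiset.count_sub]
    have := hcount p
    omega
  set S := (P - Z).toFinset with hS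
  have hSval : S.val = P - Z := by rw [hS, Multiset.toFinset_val, hnd.dedup]
  have hS0 : (0 : ℂ) ∉ S := fun h => hP (Multiset.mem_of_le (Multiset.sub_le_self P Z) (by
    rwa [hS, Multiset.mem_toFinset] at h))
  have hZ' : Z = (Z - P) + (P ∩ Z) := by
    ext a; simp only [Multiset.count_add, Multiset.count_sub, Multiset.count_inter]; omega
  have hP' : P = (P - Z) + (P ∩ Z) := by
    ext a; simp only [Multiset.count_add, Multiset.count_sub, Multiset.count_inter]; omega
  have hcardS : #S = (Z - P).card := by
    have h1 := congrArg Multiset.card hZ'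
    have h2 := congrArg Multiset.card hP'
    rw [Multiset.card_add] at h1 h2
    rw [Finset.card_def, hSval]
    omega
  set N : Polynomial ℂ := ((Z - P).map fun a => 1 - Polynomial.C a * Polynomial.X).prod with hN
  have hdeg : ∀ M : Multiset ℂ, (0 : ℂ) ∉ M →
      (M.map fun a => 1 - Polynomial.C a * Polynomial.X).prod.natDegree ≤ M.card ∧
      (M.map fun a => 1 - Polynomial.C a * Polynomial.X).prod.coeff M.card ≠ 0 := by
    intro M
    induction M using Multiset.induction_on with
    | empty => simp
    | cons a M ih =>
      intro hM
      rw [Multiset.mem_cons, not_or] at hM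
      obtain ⟨h1, h2⟩ := ih hM.2
      rw [Multiset.map_cons, Multiset.prod_cons, Multiset.card_cons]
      refine ⟨(Polynomial.natDegree_mul_le).trans ?_, ?_⟩
      · have : (1 - Polynomial.C a * Polynomial.X).natDegree ≤ 1 := by compute_degree
        omega
      · rw [sub_mul, one_mul, mul_assoc, Polynomial.coeff_sub, Polynomial.coeff_C_mul,
          Polynomial.coeff_X_mul, Polynomial.coeff_eq_zero_of_natDegree_lt (Nat.lt_succ_of_le h1),
          zero_sub]
        exact neg_ne_zero.mpr (mul_ne_zero (Ne.symm hM.1) h2)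
  have hZP0 : (0 : ℂ) ∉ Z - P := fun h => hZ (Multiset.mem_of_le (Multiset.sub_le_self Z P) h)
  obtain ⟨hd1, hd2⟩ := hdeg (Z - P) hZP0
  obtain ⟨c₀, c, hlead, hc⟩ := exists_partial_fractions S hS0 N (by rw [hcardS]; exact hd1)
  have hNy : ∀ (K : Type) [Field K] [Algebra ℂ K] (y : K),
      Polynomial.aeval y N = ((Z - P).map fun a => 1 - algebraMap ℂ K a * y).prod := by
    intro K _ _ y
    rw [hN, map_multiset_prod, Multiset.map_map]
    simp
  refine ⟨c₀, c, ?_, ?_, ?_⟩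
  · rintro rfl
    rw [zero_mul, hcardS] at hlead
    exact hd2 hlead
  · have := hc ℂ 0 (by simp)
    rw [hNy] at this
    simpa using this.symm
  · intro K _ _ y hy
    have hprod : ∏ p ∈ S, (1 - algebraMap ℂ K p * y) =
        ((P - Z).map fun a => 1 - algebraMap ℂ K a * y).prod := by
      rw [Finset.prod, hSval]
    have hI : ((P ∩ Z).map fun a => 1 - algebraMap ℂ K a * y).prod ≠ 0 := by
      refine Multiset.prod_ne_zero ?_
      simp only [Multiset.mem_map, not_exists, not_and]
      exact fun a ha => hy a (Multiset.mem_of_le (Multiset.inter_le_left) ha)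
    rw [← hc K y fun p hp => hy p (Multiset.mem_of_le (Multiset.sub_le_self P Z)
      (by rwa [hS, Multiset.mem_toFinset] at hp)), hNy, hprod]
    have hmap : ∀ A B C : Multiset ℂ, A = B + C → (A.map fun a => 1 - algebraMap ℂ K a * y).prod =
        (B.map fun a => 1 - algebraMap ℂ K a * y).prod *
          (C.map fun a => 1 - algebraMap ℂ K a * y).prod := by
      rintro A B C rfl
      rw [Multiset.map_add, Multiset.prod_add]
    rw [hmap _ _ _ hZ', hmap _ _ _ hP', mul_div_mul_right _ _ hI]

end PartialFractions

/-! ### Expansions at zero and infinity -/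

section Expansion

open HahnSeries
open scoped RatFunc

/-- `1 - c/z`. -/
def lin (c : ℂ) (z : RatFunc ℂ) : RatFunc ℂ := 1 - RatFunc.C c / z

/-- `z` is not a constant; this is what is needed of the points `z = X` and `z = X⁻¹`. -/
def IsGeneric (z : RatFunc ℂ) : Prop := ∀ c, lin c z ≠ 0

theorem isGeneric_X : IsGeneric RatFunc.X := by
  intro c h
  rw [lin, sub_eq_zero, eq_div_iff RatFunc.X_ne_zero, one_mul] at h
  have := congrArg RatFunc.num h
  rw [RatFunc.num_X, RatFunc.num_C] at this
  exact Polynomial.X_ne_C c this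

theorem isGeneric_X_inv : IsGeneric RatFunc.X⁻¹ := by
  intro c h
  rw [lin, sub_eq_zero, div_inv_eq_mul] at h
  have hc : c ≠ 0 := by rintro rfl; simp at h
  refine isGeneric_X c⁻¹ ?_
  rw [lin, sub_eq_zero, eq_div_iff RatFunc.X_ne_zero, one_mul, map_inv₀]
  exact eq_inv_of_mul_eq_one_right h.symm

/-- The geometric series `∑_{m ≥ 0} p^m X^m`. -/
def geom (p : ℂ) : LaurentSeries ℂ := ((PowerSeries.mk fun n => p ^ n : PowerSeries ℂ) :)

theorem coeff_geom (p : ℂ) (m : ℤ) : (geom p).coeff m = if 0 ≤ m then p ^ m else 0 := by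
  rw [geom, PowerSeries.coeff_coe]
  split_ifs with h h' h'
  · omega
  · rfl
  · rw [PowerSeries.coeff_mk, ← zpow_natCast, Int.natCast_natAbs, abs_of_nonneg h']
  · omega

theorem geom_mul (p : ℂ) : (1 - single 1 p) * geom p = 1 := by
  ext m
  rw [sub_mul, one_mul, coeff_sub, coeff_single_mul, coeff_geom, coeff_geom, coeff_one]
  rcases lt_trichotomy m 0 with h | rfl | h
  · rw [if_neg (by omega), if_neg (by omega), if_neg (by omega)]; ring
  · simp
  · rw [if_pos (by omega), if_pos (by omega), if_neg (by omega), sub_eq_zero]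
    rcases eq_or_ne p 0 with rfl | hp
    · rw [zero_zpow _ (by omega), zero_mul]
    · rw [← zpow_one_add₀ hp]; congr 1; ring

theorem algebraMap_ratFunc_C {K : Type} [Field K] (c : K) :
    algebraMap (RatFunc K) (LaurentSeries K) (RatFunc.C c) = single 0 c := by
  rw [← RatFunc.algebraMap_C, ← IsScalarTower.algebraMap_apply]
  simp

/-- The expansion of a rational function at `0`. -/
def toLaurent : RatFunc ℂ →+* LaurentSeries ℂ :=
  algebraMap (RatFunc ℂ) (LaurentSeries ℂ)

theorem toLaurent_C (c : ℂ) : toLaurent (RatFunc.C c) = single 0 c := algebraMap_ratFunc_C c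

theorem toLaurent_X : toLaurent RatFunc.X = single 1 1 := RatFunc.coe_X (F := ℂ)

theorem toLaurent_lin_X_inv (p : ℂ) :
    toLaurent (lin p RatFunc.X⁻¹) = 1 - single 1 p := by
  rw [lin, div_inv_eq_mul, map_sub, map_one, map_mul, toLaurent_C, toLaurent_X, single_mul_single]
  simp

theorem toLaurent_lin_X (p : ℂ) :
    toLaurent (lin p RatFunc.X) = 1 - single (-1) p := by
  rw [lin, map_sub, map_one, map_div₀, toLaurent_C, toLaurent_X, div_eq_mul_inv, inv_single,
    single_mul_single]
  simp

theorem toLaurent_inv_lin_X_inv (p : ℂ) :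
    toLaurent (lin p RatFunc.X⁻¹)⁻¹ = geom p := by
  rw [map_inv₀, toLaurent_lin_X_inv]
  exact inv_eq_of_mul_eq_one_right (geom_mul p)

theorem toLaurent_inv_lin_X (p : ℂ) (hp : p ≠ 0) :
    toLaurent (lin p RatFunc.X)⁻¹ = -(single 1 p⁻¹ * geom p⁻¹) := by
  rw [map_inv₀, toLaurent_lin_X]
  refine inv_eq_of_mul_eq_one_right ?_
  have : (1 - single (-1) p) * single 1 p⁻¹ = -(1 - single 1 p⁻¹ : LaurentSeries ℂ) := by
    rw [sub_mul, single_mul_single, mul_inv_cancel₀ hp, one_mul]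
    simp
  linear_combination (-geom p⁻¹) * this + geom_mul p⁻¹

/-- The coefficient of `z^{-m}` in the expansion of `F(z)` at `z = ∞`. -/
def coeffInf (F : RatFunc ℂ → RatFunc ℂ) (m : ℤ) : ℂ :=
  (toLaurent (F RatFunc.X⁻¹)).coeff m

/-- The coefficient of `z^{-m}` in the expansion of `F(z)` at `z = 0`. -/
def coeffZero (F : RatFunc ℂ → RatFunc ℂ) (m : ℤ) : ℂ :=
  (toLaurent (F RatFunc.X)).coeff (-m)

theorem expandInfinity_eq (F : RatFunc ℂ → RatFunc ℂ) (m : ℕ) : expandInfinity F m = coeffInf F m :=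
  rfl

theorem expandZero_eq (F : RatFunc ℂ → RatFunc ℂ) (m : ℕ) : expandZero F m = coeffZero F (-m) := by
  rw [coeffZero, neg_neg]; rfl

theorem coeffInf_partial_fractions {F : RatFunc ℂ → RatFunc ℂ} {S : Finset ℂ} {c₀ : ℂ} {c : ℂ → ℂ}
    (h : F RatFunc.X⁻¹ = RatFunc.C c₀ + ∑ p ∈ S, RatFunc.C (c p) / lin p RatFunc.X⁻¹) (m : ℤ) :
    coeffInf F m = (if m = 0 then c₀ else 0) + if 0 ≤ m then ∑ p ∈ S, c p * p ^ m else 0 := by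
  rw [coeffInf, h, map_add, map_sum, toLaurent_C, coeff_add, coeff_single, coeff_sum]
  congr 1
  · split_ifs <;> rfl
  have : ∀ p ∈ S, (toLaurent
      (RatFunc.C (c p) / lin p RatFunc.X⁻¹)).coeff m = if 0 ≤ m then c p * p ^ m else 0 := by
    intro p _
    rw [div_eq_mul_inv, map_mul, toLaurent_inv_lin_X_inv, toLaurent_C, coeff_single_zero_mul, coeff_geom]
    split_ifs <;> simp
  rw [Finset.sum_congr rfl this]
  split_ifs <;> simp

theorem coeffZero_partial_fractions {F : RatFunc ℂ → RatFunc ℂ} {S : Finset ℂ} {c₀ : ℂ} {c : ℂ → ℂ}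
    (hS : (0 : ℂ) ∉ S)
    (h : F RatFunc.X = RatFunc.C c₀ + ∑ p ∈ S, RatFunc.C (c p) / lin p RatFunc.X) (m : ℤ) :
    coeffZero F m = (if m = 0 then c₀ else 0) - if m < 0 then ∑ p ∈ S, c p * p ^ m else 0 := by
  rw [coeffZero, h, map_add, map_sum, toLaurent_C, coeff_add, coeff_single, coeff_sum]
  rw [sub_eq_add_neg]
  congr 1
  · simp only [neg_eq_zero]
  have : ∀ p ∈ S, (toLaurent
      (RatFunc.C (c p) / lin p RatFunc.X)).coeff (-m) = -if m < 0 then c p * p ^ m else 0 := by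
    intro p hp
    have hp0 : p ≠ 0 := ne_of_mem_of_not_mem hp hS
    rw [div_eq_mul_inv, map_mul, toLaurent_inv_lin_X p hp0, toLaurent_C, coeff_single_zero_mul,
      coeff_neg, coeff_single_mul, coeff_geom]
    by_cases hm : m < 0
    · rw [if_pos (by omega), if_pos hm, inv_zpow', neg_sub, sub_neg_eq_add, add_comm,
        zpow_add₀ hp0, zpow_one]
      field_simp
    · rw [if_neg (by omega), if_neg hm]; simp
  rw [Finset.sum_congr rfl this]
  split_ifs <;> simp

/-- A relation between two rational functions gives a recursion for the expansion coefficients. -/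
theorem coeffInf_recursion {F G : RatFunc ℂ → RatFunc ℂ} {b1 b2 b3 d1 d2 d3 : ℂ}
    (h : (1 - RatFunc.C b1 * RatFunc.X + RatFunc.C b2 * RatFunc.X ^ 2 -
        RatFunc.C b3 * RatFunc.X ^ 3) * F RatFunc.X⁻¹ =
      (1 - RatFunc.C d1 * RatFunc.X + RatFunc.C d2 * RatFunc.X ^ 2 -
        RatFunc.C d3 * RatFunc.X ^ 3) * G RatFunc.X⁻¹) (i : ℤ) :
    coeffInf F (i + 3) - b1 * coeffInf F (i + 2) + b2 * coeffInf F (i + 1) - b3 * coeffInf F i =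
      coeffInf G (i + 3) - d1 * coeffInf G (i + 2) + d2 * coeffInf G (i + 1) -
        d3 * coeffInf G i := by
  have key : ∀ (H : RatFunc ℂ → RatFunc ℂ) (c1 c2 c3 : ℂ),
      (toLaurent ((1 - RatFunc.C c1 * RatFunc.X +
        RatFunc.C c2 * RatFunc.X ^ 2 - RatFunc.C c3 * RatFunc.X ^ 3) * H RatFunc.X⁻¹)).coeff (i + 3)
      = coeffInf H (i + 3) - c1 * coeffInf H (i + 2) + c2 * coeffInf H (i + 1) -
        c3 * coeffInf H i := by
    intro H c1 c2 c3
    simp only [map_mul, map_sub, map_add, map_pow, toLaurent_C, toLaurent_X,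
      single_pow, single_mul_single, sub_mul, add_mul, one_mul, coeff_sub, coeff_add,
      coeff_single_mul, coeffInf]
    norm_num
    ring_nf
  rw [← key F, ← key G, h]

theorem coeffZero_recursion {F G : RatFunc ℂ → RatFunc ℂ} {b1 b2 b3 d1 d2 d3 : ℂ}
    (h : (1 - RatFunc.C b1 * RatFunc.X⁻¹ + RatFunc.C b2 * RatFunc.X⁻¹ ^ 2 -
        RatFunc.C b3 * RatFunc.X⁻¹ ^ 3) * F RatFunc.X =
      (1 - RatFunc.C d1 * RatFunc.X⁻¹ + RatFunc.C d2 * RatFunc.X⁻¹ ^ 2 -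
        RatFunc.C d3 * RatFunc.X⁻¹ ^ 3) * G RatFunc.X) (i : ℤ) :
    coeffZero F (i + 3) - b1 * coeffZero F (i + 2) + b2 * coeffZero F (i + 1) -
        b3 * coeffZero F i =
      coeffZero G (i + 3) - d1 * coeffZero G (i + 2) + d2 * coeffZero G (i + 1) -
        d3 * coeffZero G i := by
  have key : ∀ (H : RatFunc ℂ → RatFunc ℂ) (c1 c2 c3 : ℂ),
      (toLaurent ((1 - RatFunc.C c1 * RatFunc.X⁻¹ +
        RatFunc.C c2 * RatFunc.X⁻¹ ^ 2 - RatFunc.C c3 * RatFunc.X⁻¹ ^ 3) *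
          H RatFunc.X)).coeff (-(i + 3))
      = coeffZero H (i + 3) - c1 * coeffZero H (i + 2) + c2 * coeffZero H (i + 1) -
        c3 * coeffZero H i := by
    intro H c1 c2 c3
    simp only [map_mul, map_sub, map_add, map_pow, map_inv₀, toLaurent_C, toLaurent_X,
      inv_single, single_pow, single_mul_single, sub_mul, add_mul, one_mul, coeff_sub, coeff_add,
      coeff_single_mul, coeffZero]
    norm_num
    ring_nf
  rw [← key F, ← key G, h]

end Expansion

/-! ### Admissible sequences -/

theorem box_apply (j i : ℕ) : box j i = if i = j then 1 else 0 := by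
  rw [box, Pi.single_apply]

theorem add_box_apply (L : ℕ → ℤ) (j i : ℕ) : (L + box j) i = L i + if i = j then 1 else 0 := by
  rw [Pi.add_apply, box_apply]

section Vacuum

variable {k r : ℕ} {a : Fin k → ℕ}

theorem vacuum_add_period (hk : 0 < k) (j : ℕ) : vacuum k r a (j + k) = vacuum k r a j - r := by
  unfold vacuum
  rw [Nat.add_div_right _ hk, Nat.add_mod_right]
  push_cast
  ring

/-- `(k, r)`-admissible sequences: the defining condition of `Admissible`. -/
def IsAdm (k r : ℕ) (a : Fin k → ℕ) (L : ℕ → ℤ) : Prop :=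
  Antitone L ∧ (∀ j, L j - L (j + k) ≥ r) ∧ ∃ N, ∀ j ≥ N, L j = vacuum k r a j

namespace IsAdm

variable {L L' : ℕ → ℤ}

theorem step (h : IsAdm k r a L) (i : ℕ) : L (i + 1) ≤ L i := h.1 (Nat.le_succ i)

theorem gap (h : IsAdm k r a L) {s t : ℕ} {κ : ℤ} (hκ : 0 ≤ κ) (hst : (k : ℤ) * κ ≤ t - s) :
    (r : ℤ) * κ ≤ L s - L t := by
  lift κ to ℕ using hκ
  induction κ generalizing t with
  | zero =>
    have : L t ≤ L s := h.1 (by push_cast at hst; omega)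
    push_cast
    omega
  | succ κ ih =>
    push_cast at hst ⊢
    have h0 : (0 : ℤ) ≤ k * κ := by positivity
    have hkt : k ≤ t := by rw [mul_add, mul_one] at hst; omega
    have h1 := ih (t := t - k) (by rw [Nat.cast_sub hkt]; linarith)
    have h2 := h.2.1 (t - k)
    rw [Nat.sub_add_cancel hkt] at h2
    linarith

/-- Changing finitely many entries keeps the eventual condition. -/
theorem of_steps (h : IsAdm k r a L) (j : ℕ) (hL : ∀ i, i ≠ j → L' i = L i)
    (h1 : ∀ i, L' (i + 1) ≤ L' i) (h2 : ∀ i, L' (i + k) + r ≤ L' i) : IsAdm k r a L' := by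
  refine ⟨antitone_nat_of_succ_le h1, fun i => by have := h2 i; omega, ?_⟩
  obtain ⟨N, hN⟩ := h.2.2
  refine ⟨max N (j + 1), fun i hi => ?_⟩
  rw [hL i (by have := le_max_right N (j + 1); omega), hN i (le_trans (le_max_left _ _) hi)]

theorem gap_one (h : IsAdm k r a L) (i : ℕ) : L (i + k) + r ≤ L i := by
  have := h.2.1 i; omega

/-- Beyond the first `k` places of the vacuum the gap condition is sharp, so no box can be added. -/
theorem addable_lt (hk : 0 < k) {j N : ℕ} (hN : ∀ i ≥ N, L i = vacuum k r a i)
    (h : IsAdm k r a (L + box j)) : j < N + k := by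
  by_contra! hj
  have h1 := h.gap_one (j - k)
  rw [Nat.sub_add_cancel (by omega), add_box_apply, add_box_apply, if_pos rfl, if_neg (by omega),
    hN j (by omega), hN (j - k) (by omega)] at h1
  have h2 := vacuum_add_period (r := r) (a := a) hk (j - k)
  rw [Nat.sub_add_cancel (by omega)] at h2
  omega

theorem removable_lt (hk : 0 < k) {j N : ℕ} (hN : ∀ i ≥ N, (L + box j) i = vacuum k r a i)
    (h : IsAdm k r a L) : j < N := by
  by_contra! hj
  have h1 := h.gap_one j
  have h2 := hN j hj
  have h3 := hN (j + k) (by omega)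
  have h4 := vacuum_add_period (r := r) (a := a) hk j
  rw [add_box_apply] at h2 h3
  rw [if_pos rfl] at h2
  rw [if_neg (by omega)] at h3
  omega

/-- The sequence `L` is the entrywise minimum of `L + 1_i` and `L + 1_j`. -/
theorem inf (hk : 0 < k) {i j : ℕ} (hij : i ≠ j) (hi : IsAdm k r a (L + box i))
    (hj : IsAdm k r a (L + box j)) : IsAdm k r a L := by
  refine hi.of_steps i (fun s hs => by rw [add_box_apply, if_neg hs, add_zero]) (fun s => ?_)
    fun s => ?_
  · have h1 := hi.step s
    have h2 := hj.step s
    simp only [add_box_apply] at h1 h2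
    split_ifs at h1 h2 <;> omega
  · have h1 := hi.gap_one s
    have h2 := hj.gap_one s
    simp only [add_box_apply] at h1 h2
    split_ifs at h1 h2 <;> omega

/-- The sequence `L + 1_i + 1_j` is the entrywise maximum of `L + 1_i` and `L + 1_j`. -/
theorem sup {i j : ℕ} (hij : i ≠ j) (hi : IsAdm k r a (L + box i))
    (hj : IsAdm k r a (L + box j)) : IsAdm k r a (L + box i + box j) := by
  refine hi.of_steps j (fun s hs => by rw [add_box_apply _ j, if_neg hs, add_zero]) (fun s => ?_)
    fun s => ?_
  · have h1 := hi.step s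
    have h2 := hj.step s
    simp only [add_box_apply] at h1 h2 ⊢
    split_ifs at h1 h2 ⊢ <;> omega
  · have h1 := hi.gap_one s
    have h2 := hj.gap_one s
    simp only [add_box_apply] at h1 h2 ⊢
    split_ifs at h1 h2 ⊢ <;> omega

/-- The ways in which a box can fail to be addable. -/
theorem not_add_box (h : IsAdm k r a L) {j : ℕ} (hj : ¬ IsAdm k r a (L + box j)) :
    (∃ i, i + 1 = j ∧ L i = L j) ∨ ∃ i, i + k = j ∧ L i = L j + r := by
  by_contra! hcon
  refine hj (h.of_steps j (fun s hs => by rw [add_box_apply, if_neg hs, add_zero]) (fun s => ?_)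
    fun s => ?_)
  · have h1 := h.step s
    have h2 := hcon.1 s
    simp only [add_box_apply]
    split_ifs with h3 h4 h4
    · omega
    · have := h2 h3
      subst h3
      omega
    all_goals omega
  · have h1 := h.gap_one s
    have h2 := hcon.2 s
    simp only [add_box_apply]
    split_ifs with h3 h4 h4
    · omega
    · have := h2 h3
      subst h3
      omega
    all_goals omega

/-- The ways in which a box can fail to be removable. -/
theorem not_sub_box (hk : 0 < k) (h : IsAdm k r a L) {j : ℕ} (hj : ¬ IsAdm k r a (L - box j)) :
    L (j + 1) = L j ∨ L j = L (j + k) + r := by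
  by_contra! hcon
  have hsub : ∀ s, (L - box j) s = L s - if s = j then 1 else 0 := fun s => by
    rw [Pi.sub_apply, box_apply]
  refine hj (h.of_steps j (fun s hs => by rw [hsub, if_neg hs, sub_zero]) (fun s => ?_)
    fun s => ?_)
  · have h1 := h.step s
    rw [hsub, hsub]
    split_ifs with h3 h4 h4
    · omega
    · omega
    · subst h4; omega
    · omega
  · have h1 := h.gap_one s
    rw [hsub, hsub]
    split_ifs with h3 h4 h4
    · omega
    · omega
    · subst h4; omega
    · omega

end IsAdm

end Vacuum

/-! ### Resonance and coincidences of supports -/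

/-- The resonance condition, with `q₁ q₂ q₃ = 1`. -/
structure Resonant (q1 q2 q3 : ℂ) (n r : ℕ) : Prop where
  mul_eq_one : q1 * q2 * q3 = 1
  two_le_n : 2 ≤ n
  two_le_r : 2 ≤ r
  zpow_eq_one_iff : ∀ x y : ℤ, q1 ^ x * q3 ^ y = 1 ↔
      ∃ κ : ℤ, x = ((n : ℤ) + r) * κ ∧ y = ((n : ℤ) + 1) * κ

namespace Resonant

variable {q1 q2 q3 u : ℂ} {n r : ℕ} {a : Fin n → ℕ}

theorem q1_ne_zero (h : Resonant q1 q2 q3 n r) : q1 ≠ 0 := by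
  rintro rfl; simpa using h.mul_eq_one

theorem q2_ne_zero (h : Resonant q1 q2 q3 n r) : q2 ≠ 0 := by
  rintro rfl; simpa using h.mul_eq_one

theorem q3_ne_zero (h : Resonant q1 q2 q3 n r) : q3 ≠ 0 := by
  rintro rfl; simpa using h.mul_eq_one

theorem q3_eq (h : Resonant q1 q2 q3 n r) : q3 = q1 ^ (-1 : ℤ) * q2 ^ (-1 : ℤ) := by
  have h1 := h.q1_ne_zero
  have h2 := h.q2_ne_zero
  rw [zpow_neg_one, zpow_neg_one]
  field_simp
  linear_combination h.mul_eq_one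

/-- The resonance condition in terms of `q₁` and `q₂`. -/
theorem zpow_q1_q2 (h : Resonant q1 q2 q3 n r) (x y : ℤ) : q1 ^ x * q2 ^ y = 1 ↔
    ∃ κ : ℤ, x = (1 - r) * κ ∧ y = ((n : ℤ) + 1) * κ := by
  have h1 := h.q1_ne_zero
  have h2 := h.q2_ne_zero
  have : q1 ^ x * q2 ^ y = q1 ^ (x - y) * q3 ^ (-y) := by
    rw [h.q3_eq, mul_zpow, ← zpow_mul, ← zpow_mul, ← mul_assoc, ← zpow_add₀ h1]
    congr 2 <;> ring
  rw [this, h.zpow_eq_one_iff]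
  constructor
  · rintro ⟨κ, hx, hy⟩
    exact ⟨-κ, by linear_combination hx - hy, by linear_combination -hy⟩
  · rintro ⟨κ, hx, hy⟩
    exact ⟨-κ, by linear_combination hx - hy, by linear_combination -hy⟩

theorem support_ne_zero (h : Resonant q1 q2 q3 n r) (hu : u ≠ 0) (L : ℕ → ℤ) (j : ℕ) :
    partSupport q1 q2 u L j ≠ 0 :=
  mul_ne_zero (mul_ne_zero (zpow_ne_zero _ h.q1_ne_zero) (pow_ne_zero _ h.q2_ne_zero)) hu

/-- Coincidences of supports up to a monomial in `q₁`, `q₂` are multiples of the single one given by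
resonance. In its uses, `gap` bounds `r * κ` by the difference of the entries, which leaves only
`κ = 0` and a few borderline cases. -/
theorem support_eq_iff (h : Resonant q1 q2 q3 n r) (hu : u ≠ 0) (L L' : ℕ → ℤ) (s t : ℕ)
    (α β : ℤ) : partSupport q1 q2 u L s = q1 ^ α * q2 ^ β * partSupport q1 q2 u L' t ↔
      ∃ κ : ℤ, L s - L' t - α = (1 - r) * κ ∧ (s : ℤ) - t - β = ((n : ℤ) + 1) * κ := by
  have h1 := h.q1_ne_zero
  have h2 := h.q2_ne_zero
  rw [← h.zpow_q1_q2]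
  unfold partSupport
  rw [← mul_assoc, mul_left_inj' hu, ← zpow_natCast, ← zpow_natCast]
  simp only [sub_eq_add_neg, zpow_add₀ h1, zpow_add₀ h2, zpow_neg]
  field_simp

theorem q1_pow_ne_one (h : Resonant q1 q2 q3 n r) {x : ℤ} (hx : x ≠ 0) : q1 ^ x ≠ 1 := by
  intro h1
  obtain ⟨κ, hκ, h0⟩ := (h.zpow_q1_q2 x 0).mp (by rw [h1, zpow_zero, mul_one])
  have : κ = 0 := by
    rcases mul_eq_zero.mp h0.symm with h | h
    · omega
    · exact h
  rw [this, mul_zero] at hκ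
  exact hx hκ

theorem q1_ne_one (h : Resonant q1 q2 q3 n r) : q1 ≠ 1 := by
  have := h.q1_pow_ne_one one_ne_zero
  rwa [zpow_one] at this

theorem q2_ne_one (h : Resonant q1 q2 q3 n r) : q2 ≠ 1 := by
  intro h1
  obtain ⟨κ, hκ, h0⟩ := (h.zpow_q1_q2 0 1).mp (by rw [h1]; simp)
  have := h.two_le_n
  have := Int.eq_one_or_neg_one_of_mul_eq_one h0.symm
  omega

theorem q3_ne_one (h : Resonant q1 q2 q3 n r) : q3 ≠ 1 := by
  intro h1
  obtain ⟨κ, hκ, h0⟩ := (h.zpow_eq_one_iff 0 1).mp (by rw [h1]; simp)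
  have := h.two_le_n
  have := Int.eq_one_or_neg_one_of_mul_eq_one h0.symm
  omega

/-- The supports of distinct parts of an admissible sequence are distinct. -/
theorem support_injective (h : Resonant q1 q2 q3 n r) (hu : u ≠ 0) {L : ℕ → ℤ}
    (hL : IsAdm n r a L) : Function.Injective (partSupport q1 q2 u L) := by
  intro s t hst
  obtain ⟨κ, h1, h2⟩ := (h.support_eq_iff hu L L s t 0 0).mp (by simpa using hst)
  rw [show (1 - (r : ℤ)) * κ = κ - r * κ by ring] at h1
  rw [show ((n : ℤ) + 1) * κ = n * κ + κ by ring] at h2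
  rcases lt_trichotomy κ 0 with hκ | rfl | hκ
  · have := hL.gap (s := s) (t := t) (κ := -κ) (by omega) (by rw [mul_neg]; omega)
    rw [mul_neg] at this
    omega
  · simp only [mul_zero] at h2; omega
  · have := hL.gap (s := t) (t := s) (κ := κ) (by omega) (by omega)
    omega

/-- For an addable box `j`, none of the factors attached to the other parts has a zero or a pole
at the support of `j`. -/
theorem support_ne_of_edge (h : Resonant q1 q2 q3 n r) (hu : u ≠ 0) {L : ℕ → ℤ} {j t : ℕ}
    (hL : IsAdm n r a L) (hj : IsAdm n r a (L + box j)) (htj : t ≠ j) {α β : ℤ}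
    (hαβ : (α = 0 ∧ β = 0) ∨ (α = -1 ∧ β = 0) ∨ (α = 0 ∧ β = 1) ∨ (α = -1 ∧ β = -1)) :
    partSupport q1 q2 u L j ≠ q1 ^ α * q2 ^ β * partSupport q1 q2 u L t := by
  intro heq
  obtain ⟨κ, h1, h2⟩ := (h.support_eq_iff hu L L j t α β).mp heq
  rw [show (1 - (r : ℤ)) * κ = κ - r * κ by ring] at h1
  rw [show ((n : ℤ) + 1) * κ = n * κ + κ by ring] at h2
  rcases lt_trichotomy κ 0 with hκ | rfl | hκ
  · have := hL.gap (s := j) (t := t) (κ := -κ) (by omega) (by rw [mul_neg]; omega)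
    rw [mul_neg] at this
    omega
  · simp only [mul_zero] at h1 h2
    have h3 : (t : ℤ) = j - β := by omega
    rcases hαβ with ⟨rfl, rfl⟩ | ⟨rfl, rfl⟩ | ⟨rfl, rfl⟩ | ⟨rfl, rfl⟩
    · omega
    · omega
    · have h4 : j = t + 1 := by omega
      have := hj.step t
      rw [← h4, add_box_apply, add_box_apply, if_pos rfl, if_neg htj] at this
      omega
    · have h4 : t = j + 1 := by omega
      have := hL.step j
      rw [← h4] at this
      omega
  · have := hj.gap (s := t) (t := j) (κ := κ) (by omega) (by omega)
    rw [add_box_apply, add_box_apply, if_pos rfl, if_neg htj] at this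
    omega

/-- When two boxes can be added only in the order `j`, `k`, the structure function vanishes at
`(v_k, v_j)`. This is the coefficient of the remaining order in the quadratic relation. -/
theorem support_eq_of_not_edge (h : Resonant q1 q2 q3 n r) (hu : u ≠ 0) {L : ℕ → ℤ} {j k : ℕ}
    (hL : IsAdm n r a L) (hjk : j ≠ k) (hjk' : IsAdm n r a (L + box j + box k))
    (hk : ¬ IsAdm n r a (L + box k)) :
    partSupport q1 q2 u L k = q2 * partSupport q1 q2 u L j ∨
      partSupport q1 q2 u L k = q3 * partSupport q1 q2 u L j := by
  have hn := h.two_le_n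
  rcases hL.not_add_box hk with ⟨i, hi, hLi⟩ | ⟨i, hi, hLi⟩
  · left
    have := hjk'.step i
    simp only [add_box_apply] at this
    rw [hi] at this
    have hij : i = j := by split_ifs at this <;> omega
    subst hij
    have := (h.support_eq_iff hu L L k i 0 1).mpr ⟨0, by rw [hLi]; ring, by rw [← hi]; push_cast; ring⟩
    simpa using this
  · right
    have := hjk'.gap_one i
    simp only [add_box_apply] at this
    rw [hi] at this
    have hij : i = j := by split_ifs at this <;> omega
    subst hij
    rw [h.q3_eq]
    exact (h.support_eq_iff hu L L k i (-1) (-1)).mpr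
      ⟨1, by rw [hLi]; ring, by rw [← hi]; push_cast; ring⟩

/-- Two boxes added one after the other never have the first support equal to `q_i` times the second. -/
theorem first_second (h : Resonant q1 q2 q3 n r) (hu : u ≠ 0) {L : ℕ → ℤ} {j m : ℕ}
    (hL : IsAdm n r a L) (hj : IsAdm n r a (L + box j)) (hm : IsAdm n r a (L + box j + box m))
    {α β : ℤ} (hαβ : (α = 1 ∧ β = 0) ∨ (α = 0 ∧ β = 1) ∨ (α = -1 ∧ β = -1)) :
    partSupport q1 q2 u L j ≠ q1 ^ α * q2 ^ β * partSupport q1 q2 u (L + box j) m := by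
  intro heq
  obtain ⟨κ, h1, h2⟩ := (h.support_eq_iff hu L (L + box j) j m α β).mp heq
  have hn := h.two_le_n
  rw [show (1 - (r : ℤ)) * κ = κ - r * κ by ring, add_box_apply] at h1
  rw [show ((n : ℤ) + 1) * κ = n * κ + κ by ring] at h2
  rcases lt_trichotomy κ 0 with hκ | rfl | hκ
  · have h3 : (n : ℤ) * κ ≤ 2 * κ := mul_le_mul_of_nonpos_right (by exact_mod_cast hn) hκ.le
    have h4 := hL.gap (s := j) (t := m) (κ := -κ) (by omega) (by rw [mul_neg]; omega)
    rw [mul_neg] at h4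
    rw [if_neg (by omega)] at h1
    obtain rfl : κ = -1 := by omega
    have h5 : m = j + 1 + n := by omega
    have h6 := hm.gap_one (j + 1)
    have h7 := hL.step j
    simp only [add_box_apply] at h6
    rw [← h5, if_neg (show m ≠ j by omega), if_pos rfl, if_neg (show j + 1 ≠ j by omega),
      if_neg (show j + 1 ≠ m by omega)] at h6
    omega
  · simp only [mul_zero] at h1 h2
    have h3 : (m : ℤ) = j - β := by omega
    rcases hαβ with ⟨rfl, rfl⟩ | ⟨rfl, rfl⟩ | ⟨rfl, rfl⟩
    · rw [if_pos (by omega)] at h1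
      obtain rfl : m = j := by omega
      omega
    · have h4 : j = m + 1 := by omega
      have := hj.step m
      rw [← h4, add_box_apply, add_box_apply, if_pos rfl, if_neg (by omega)] at this
      rw [if_neg (by omega)] at h1
      omega
    · have h4 : m = j + 1 := by omega
      have := hL.step j
      rw [← h4] at this
      rw [if_neg (by omega)] at h1
      have := hm.step j
      simp only [add_box_apply, if_true] at this
      rw [← h4, if_neg (show m ≠ j by omega), if_pos rfl, if_neg (show j ≠ m by omega)] at this
      omega
  · have h3 : 2 * κ ≤ (n : ℤ) * κ := mul_le_mul_of_nonneg_right (by exact_mod_cast hn) hκ.le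
    have := hj.gap (s := m) (t := j) (κ := κ) (by omega) (by omega)
    rw [add_box_apply, add_box_apply, if_pos rfl, if_neg (by omega)] at this
    rw [if_neg (by omega)] at h1
    omega

/-- The wheel condition: three boxes added one after the other never have the first support
equal to `q_i` times the last. -/
theorem first_third (h : Resonant q1 q2 q3 n r) (hu : u ≠ 0) {L : ℕ → ℤ} {j k m : ℕ}
    (hL : IsAdm n r a L) (hj : IsAdm n r a (L + box j))
    (hm : IsAdm n r a (L + box j + box k + box m))
    {α β : ℤ} (hαβ : (α = 1 ∧ β = 0) ∨ (α = 0 ∧ β = 1) ∨ (α = -1 ∧ β = -1)) :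
    partSupport q1 q2 u L j ≠ q1 ^ α * q2 ^ β * partSupport q1 q2 u (L + box j + box k) m := by
  intro heq
  obtain ⟨κ, h1, h2⟩ := (h.support_eq_iff hu L (L + box j + box k) j m α β).mp heq
  have hn := h.two_le_n
  rw [show (1 - (r : ℤ)) * κ = κ - r * κ by ring, add_box_apply, add_box_apply] at h1
  rw [show ((n : ℤ) + 1) * κ = n * κ + κ by ring] at h2
  rcases lt_trichotomy κ 0 with hκ | rfl | hκ
  · have h3 : (n : ℤ) * κ ≤ 2 * κ := mul_le_mul_of_nonpos_right (by exact_mod_cast hn) hκ.le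
    have h4 := hL.gap (s := j) (t := m) (κ := -κ) (by omega) (by rw [mul_neg]; omega)
    have h5 := hm.gap (s := j) (t := m) (κ := -κ) (by omega) (by rw [mul_neg]; omega)
    rw [mul_neg] at h4 h5
    simp only [add_box_apply, if_true] at h5
    rw [if_neg (show m ≠ j by omega)] at h1 h5
    rw [if_neg (show j ≠ m by omega)] at h5
    have h6 : -κ ≤ α := by split_ifs at h1 h5 <;> omega
    obtain rfl : κ = -1 := by omega
    have h7 : m = j + 1 + n := by omega
    have h8 := hm.gap_one (j + 1)
    have h9 := hL.step j
    simp only [add_box_apply] at h8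
    rw [← h7, if_neg (show j + 1 ≠ j by omega), if_neg (show j + 1 ≠ m by omega),
      if_neg (show m ≠ j by omega), if_pos rfl] at h8
    -- the parts `j + 1` and `m - 1` would have to be raised both
    have h10 : k = j + 1 := by split_ifs at h1 h8 <;> omega
    subst h10
    have h11 := hm.step (j + n)
    have h12 := hL.gap_one j
    simp only [add_box_apply] at h11
    rw [show j + n + 1 = m by omega, if_neg (show m ≠ j by omega),
      if_neg (show m ≠ j + 1 by omega), if_pos rfl, if_neg (show j + n ≠ j by omega),
      if_neg (show j + n ≠ j + 1 by omega), if_neg (show j + n ≠ m by omega)] at h11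
    rw [if_neg (show m ≠ j + 1 by omega)] at h1
    omega
  · simp only [mul_zero] at h1 h2
    have h3 : (m : ℤ) = j - β := by omega
    rcases hαβ with ⟨rfl, rfl⟩ | ⟨rfl, rfl⟩ | ⟨rfl, rfl⟩
    · obtain rfl : m = j := by omega
      rw [if_pos rfl] at h1
      split_ifs at h1 <;> omega
    · have h4 : j = m + 1 := by omega
      have := hj.step m
      rw [← h4, add_box_apply, add_box_apply, if_pos rfl, if_neg (by omega)] at this
      split_ifs at h1 <;> omega
    · have h4 : m = j + 1 := by omega
      have h5 := hL.step j
      rw [← h4] at h5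
      have h6 := hm.step j
      simp only [add_box_apply, if_true] at h6
      rw [← h4, if_neg (show m ≠ j by omega), if_pos rfl,
        if_neg (show j ≠ m by omega)] at h6
      rw [if_neg (show m ≠ j by omega)] at h1
      split_ifs at h1 h6 <;> omega
  · have h3 : 2 * κ ≤ (n : ℤ) * κ := mul_le_mul_of_nonneg_right (by exact_mod_cast hn) hκ.le
    have := hj.gap (s := m) (t := j) (κ := κ) (by omega) (by omega)
    rw [add_box_apply, add_box_apply, if_pos rfl, if_neg (by omega)] at this
    rw [if_neg (show m ≠ j by omega)] at h1
    split_ifs at h1 <;> omega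

end Resonant

/-! ### The factor of one part -/

section Factors

/-- The eigenvalue factor of a part with support `x`. -/
def hfun (q1 q2 q3 x : ℂ) (z : RatFunc ℂ) : RatFunc ℂ :=
  lin (q2 * x) z * lin (q3 * x) z / (lin x z * lin (q1⁻¹ * x) z)

/-- The vacuum factor `φ_{q₂}(x/z)`. -/
def phi (q2 x : ℂ) (z : RatFunc ℂ) : RatFunc ℂ := lin (q2 * x) z / lin x z

theorem vacFun_eq_phi (q2 x : ℂ) (z : RatFunc ℂ) : vacFun q2 (RatFunc.C x / z) = phi q2 x z := by
  rw [vacFun, phi, lin, lin, map_mul, mul_div_assoc]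

theorem partPsi_eq_hfun {q1 q2 q3 : ℂ} (hq : q1 * q2 * q3 = 1) (u : ℂ) (l : ℕ → ℤ) (s : ℕ)
    (z : RatFunc ℂ) : partPsi q1 q2 q3 u l s z = hfun q1 q2 q3 (partSupport q1 q3 u l s) z := by
  have h1 : q1 ≠ 0 := by rintro rfl; simp at hq
  have h2 : q2 ≠ 0 := by rintro rfl; simp at hq
  have h3 : q3 ≠ 0 := by rintro rfl; simp at hq
  have hx : q1 ^ (l s - s) * (u * q2 ^ (-(s : ℤ))) = partSupport q1 q3 u l s := by
    have h4 : (q1 * q2) ^ (s : ℤ) * q3 ^ (s : ℤ) = 1 := by rw [← mul_zpow, hq, one_zpow]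
    rw [partSupport, zpow_sub₀ h1, zpow_neg, ← zpow_natCast q3]
    rw [mul_zpow] at h4
    have h5 := zpow_ne_zero (s : ℤ) h1
    have h6 := zpow_ne_zero (s : ℤ) h2
    field_simp
    linear_combination -u * h4
  have e1 : q1 ^ (l s - s : ℤ) * q3 * (u * q2 ^ (-(s : ℤ))) = q3 * partSupport q1 q3 u l s := by
    rw [← hx]; ring
  have e2 : q1 ^ (l s - s : ℤ) * q2 * (u * q2 ^ (-(s : ℤ))) = q2 * partSupport q1 q3 u l s := by
    rw [← hx]; ring
  have e3 : q1 ^ (l s - s - 1 : ℤ) * (u * q2 ^ (-(s : ℤ))) = q1⁻¹ * partSupport q1 q3 u l s := by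
    rw [← hx, zpow_sub_one₀ h1]; ring
  unfold partPsi vecPsi hfun lin
  rw [e1, e2, e3, hx]
  ring

theorem hfun_swap (q1 q2 q3 x : ℂ) (z : RatFunc ℂ) : hfun q1 q2 q3 x z = hfun q1 q3 q2 x z := by
  unfold hfun; ring

theorem hfun_ne_zero {q1 q2 q3 x : ℂ} {z : RatFunc ℂ} (hz : IsGeneric z) : hfun q1 q2 q3 x z ≠ 0 :=
  div_ne_zero (mul_ne_zero (hz _) (hz _)) (mul_ne_zero (hz _) (hz _))

/-- The factor of a vacuum part shifts the vacuum factor. -/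
theorem phi_shift {q1 q2 q3 x : ℂ} (hq : q1 * q2 * q3 = 1) {z : RatFunc ℂ} (hz : IsGeneric z) :
    phi q2 (q3 * x) z * hfun q1 q2 q3 x z = phi q2 x z := by
  have h1 : q1 ≠ 0 := by rintro rfl; simp at hq
  have h4 : q2 * (q3 * x) = q1⁻¹ * x := by field_simp; linear_combination x * hq
  unfold phi hfun
  rw [h4]
  have e1 := hz (q3 * x)
  have e2 := hz x
  have e3 := hz (q1⁻¹ * x)
  generalize lin (q3 * x) z = A at *
  generalize lin x z = B at *
  generalize lin (q1⁻¹ * x) z = D at *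
  generalize lin (q2 * x) z = F at *
  field_simp

/-- Adding a box changes the factor of a part by the ratio of the structure function. -/
theorem hfun_shift {q1 q2 q3 x : ℂ} (hq : q1 * q2 * q3 = 1) {z : RatFunc ℂ} (hz : IsGeneric z) :
    hfun q1 q2 q3 (q1 * x) z * (lin (q1 * x) z * lin (q2 * x) z * lin (q3 * x) z) =
      hfun q1 q2 q3 x z * (lin (q1⁻¹ * x) z * lin (q2⁻¹ * x) z * lin (q3⁻¹ * x) z) := by
  have h1 : q1 ≠ 0 := by rintro rfl; simp at hq
  have h2 : q2 ≠ 0 := by rintro rfl; simp at hq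
  have h3 : q3 ≠ 0 := by rintro rfl; simp at hq
  have e1 : q2 * (q1 * x) = q3⁻¹ * x := by field_simp; linear_combination x * hq
  have e2 : q3 * (q1 * x) = q2⁻¹ * x := by field_simp; linear_combination x * hq
  have e3 : q1⁻¹ * (q1 * x) = x := by field_simp
  unfold hfun
  rw [e1, e2, e3]
  have f1 := hz (q1 * x)
  have f2 := hz x
  have f3 := hz (q1⁻¹ * x)
  generalize lin (q1 * x) z = A at *
  generalize lin x z = B at *
  generalize lin (q1⁻¹ * x) z = D at *
  field_simp

/-- A regularised infinite product as a finite one. -/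
theorem mul_finprod_eq {K : Type} [Field K] {Φ h h0 : ℕ → K} (hΦ : ∀ s, Φ (s + 1) * h0 s = Φ s)
    (h0' : ∀ s, h0 s ≠ 0) {N : ℕ} (hN : ∀ t ≥ N, h t = h0 t) {s : ℕ} (hs : s ≤ N) :
    Φ s * ∏ᶠ t : ℕ, h (s + t) / h0 (s + t) = (∏ t ∈ Ico s N, h t) * Φ N := by
  have hsupp : (Function.mulSupport fun t => h (s + t) / h0 (s + t)) ⊆ (range (N - s) : Set ℕ) := by
    intro t ht
    by_contra hcon
    apply ht
    simp only [coe_range, Set.mem_Iio, not_lt] at hcon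
    change h (s + t) / h0 (s + t) = 1
    rw [hN _ (by omega), div_self (h0' _)]
  rw [finprod_eq_prod_of_mulSupport_subset _ hsupp, Finset.prod_div_distrib]
  have key : ∀ d, Φ s = Φ (s + d) * ∏ t ∈ range d, h0 (s + t) := by
    intro d
    induction d with
    | zero => simp
    | succ d ih => rw [ih, prod_range_succ, ← hΦ (s + d), ← add_assoc]; ring
  have h1 : ∏ t ∈ range (N - s), h0 (s + t) ≠ 0 := prod_ne_zero_iff.mpr fun t _ => h0' _
  rw [prod_Ico_eq_prod_range]
  conv_lhs => rw [key (N - s), Nat.add_sub_cancel' hs]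
  field_simp

end Factors

/-! ### Values of rational functions -/

section Evaluation

/-- The rational function `R` is regular at `v`, with value `c`. -/
def EvalsTo (R : RatFunc ℂ) (v c : ℂ) : Prop :=
  ∃ p q : Polynomial ℂ, q.eval v ≠ 0 ∧ R * algebraMap (Polynomial ℂ) (RatFunc ℂ) q =
    algebraMap (Polynomial ℂ) (RatFunc ℂ) p ∧ p.eval v = c * q.eval v

namespace EvalsTo

variable {R R' : RatFunc ℂ} {v c c' : ℂ}

theorem eval_eq (h : EvalsTo R v c) : RatFunc.eval (RingHom.id ℂ) v R = c := by
  obtain ⟨p, q, hq, hR, hp⟩ := h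
  have hq0 : q ≠ 0 := by rintro rfl; simp at hq
  have hqa : algebraMap (Polynomial ℂ) (RatFunc ℂ) q ≠ 0 := RatFunc.algebraMap_ne_zero hq0
  have hR' : R = algebraMap _ _ p / algebraMap _ _ q := by rw [eq_div_iff hqa, hR]
  have h1 := (RatFunc.num_mul_eq_mul_denom_iff hq0).mpr hR'
  have h2 : R.denom ∣ q := (RatFunc.denom_dvd hq0).mpr ⟨p, hR'⟩
  have h3 : R.denom.eval v ≠ 0 := by
    obtain ⟨d, hd⟩ := h2
    rw [hd, Polynomial.eval_mul] at hq
    exact left_ne_zero_of_mul hq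
  have h4 := congrArg (Polynomial.eval v) h1
  rw [Polynomial.eval_mul, Polynomial.eval_mul, hp] at h4
  rw [RatFunc.eval, Polynomial.eval₂_id, Polynomial.eval₂_id, div_eq_iff h3]
  apply mul_right_cancel₀ hq
  rw [h4]; ring

theorem unique (h : EvalsTo R v c) (h' : EvalsTo R v c') : c = c' := by
  rw [← h.eval_eq, ← h'.eval_eq]

theorem mul (h : EvalsTo R v c) (h' : EvalsTo R' v c') : EvalsTo (R * R') v (c * c') := by
  obtain ⟨p, q, hq, hR, hp⟩ := h
  obtain ⟨p', q', hq', hR', hp'⟩ := h'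
  refine ⟨p * p', q * q', by rw [Polynomial.eval_mul]; exact mul_ne_zero hq hq', ?_, ?_⟩
  · rw [map_mul, map_mul, ← hR, ← hR']; ring
  · rw [Polynomial.eval_mul, Polynomial.eval_mul, hp, hp']; ring

theorem add (h : EvalsTo R v c) (h' : EvalsTo R' v c') : EvalsTo (R + R') v (c + c') := by
  obtain ⟨p, q, hq, hR, hp⟩ := h
  obtain ⟨p', q', hq', hR', hp'⟩ := h'
  refine ⟨p * q' + p' * q, q * q', by rw [Polynomial.eval_mul]; exact mul_ne_zero hq hq', ?_, ?_⟩
  · rw [map_add, map_mul, map_mul, map_mul, ← hR, ← hR']; ring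
  · rw [Polynomial.eval_mul, Polynomial.eval_add, Polynomial.eval_mul, Polynomial.eval_mul, hp, hp']
    ring

theorem inv (h : EvalsTo R v c) (hc : c ≠ 0) : EvalsTo R⁻¹ v c⁻¹ := by
  obtain ⟨p, q, hq, hR, hp⟩ := h
  have hp0 : p.eval v ≠ 0 := by rw [hp]; exact mul_ne_zero hc hq
  have hpa : algebraMap (Polynomial ℂ) (RatFunc ℂ) p ≠ 0 :=
    RatFunc.algebraMap_ne_zero (by rintro rfl; simp at hp0)
  have hR0 : R ≠ 0 := by rintro rfl; rw [zero_mul] at hR; exact hpa hR.symm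
  refine ⟨q, p, hp0, ?_, ?_⟩
  · rw [← hR, inv_mul_cancel_left₀ hR0]
  · rw [hp, inv_mul_cancel_left₀ hc]

theorem div (h : EvalsTo R v c) (h' : EvalsTo R' v c') (hc : c' ≠ 0) :
    EvalsTo (R / R') v (c / c') := by
  rw [div_eq_mul_inv, div_eq_mul_inv]
  exact h.mul (h'.inv hc)

theorem const (c v : ℂ) : EvalsTo (RatFunc.C c) v c :=
  ⟨Polynomial.C c, 1, by simp, by rw [map_one, mul_one, RatFunc.algebraMap_C], by simp⟩

theorem lin_X (c : ℂ) (hv : v ≠ 0) : EvalsTo (lin c RatFunc.X) v (1 - c / v) := by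
  refine ⟨Polynomial.X - Polynomial.C c, Polynomial.X, by simpa using hv, ?_, ?_⟩
  · rw [lin, map_sub, RatFunc.algebraMap_X, RatFunc.algebraMap_C, sub_mul,
      div_mul_cancel₀ _ RatFunc.X_ne_zero, one_mul]
  · simp; field_simp

theorem sum {ι : Type} {s : Finset ι} {R : ι → RatFunc ℂ} {c : ι → ℂ}
    (h : ∀ i ∈ s, EvalsTo (R i) v (c i)) : EvalsTo (∑ i ∈ s, R i) v (∑ i ∈ s, c i) := by
  classical
  induction s using Finset.induction_on with
  | empty => simpa using const 0 v
  | insert i s hi ih =>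
    rw [sum_insert hi, sum_insert hi]
    exact (h i (mem_insert_self _ _)).add (ih fun j hj => h j (mem_insert_of_mem hj))

theorem prod {ι : Type} {s : Finset ι} {R : ι → RatFunc ℂ} {c : ι → ℂ}
    (h : ∀ i ∈ s, EvalsTo (R i) v (c i)) : EvalsTo (∏ i ∈ s, R i) v (∏ i ∈ s, c i) := by
  classical
  induction s using Finset.induction_on with
  | empty => simpa using const 1 v
  | insert i s hi ih =>
    rw [prod_insert hi, prod_insert hi]
    exact (h i (mem_insert_self _ _)).mul (ih fun j hj => h j (mem_insert_of_mem hj))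

end EvalsTo

/-- The value at `z = v` of the factor `hfun`. -/
def hval (q1 q2 q3 x v : ℂ) : ℂ :=
  (1 - q2 * x / v) * (1 - q3 * x / v) / ((1 - x / v) * (1 - q1⁻¹ * x / v))

/-- The value at `z = v` of the vacuum factor. -/
def phival (q2 x v : ℂ) : ℂ := (1 - q2 * x / v) / (1 - x / v)

/-- `v` is neither a zero nor a pole of the factor of a part with support `x`. -/
structure Good (q1 q2 q3 x v : ℂ) : Prop where
  ne_zero : v ≠ 0
  pole : v ≠ x
  pole' : v ≠ q1⁻¹ * x
  zero : v ≠ q2 * x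
  zero' : v ≠ q3 * x

namespace Good

variable {q1 q2 q3 x v : ℂ}

theorem one_sub_ne_zero {c v : ℂ} (hv : v ≠ 0) (h : v ≠ c) : 1 - c / v ≠ 0 := by
  rw [sub_ne_zero, ne_comm, Ne, div_eq_one_iff_eq hv]
  exact Ne.symm h

theorem hval_ne_zero (h : Good q1 q2 q3 x v) : hval q1 q2 q3 x v ≠ 0 :=
  div_ne_zero (mul_ne_zero (one_sub_ne_zero h.ne_zero h.zero) (one_sub_ne_zero h.ne_zero h.zero'))
    (mul_ne_zero (one_sub_ne_zero h.ne_zero h.pole) (one_sub_ne_zero h.ne_zero h.pole'))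

theorem phival_ne_zero (h : Good q1 q2 q3 x v) : phival q2 x v ≠ 0 :=
  div_ne_zero (one_sub_ne_zero h.ne_zero h.zero) (one_sub_ne_zero h.ne_zero h.pole)

theorem evalsTo_hfun (h : Good q1 q2 q3 x v) :
    EvalsTo (hfun q1 q2 q3 x RatFunc.X) v (hval q1 q2 q3 x v) :=
  ((EvalsTo.lin_X _ h.ne_zero).mul (EvalsTo.lin_X _ h.ne_zero)).div
    ((EvalsTo.lin_X _ h.ne_zero).mul (EvalsTo.lin_X _ h.ne_zero))
    (mul_ne_zero (one_sub_ne_zero h.ne_zero h.pole) (one_sub_ne_zero h.ne_zero h.pole'))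

theorem evalsTo_phi (h : Good q1 q2 q3 x v) : EvalsTo (phi q2 x RatFunc.X) v (phival q2 x v) :=
  (EvalsTo.lin_X _ h.ne_zero).div (EvalsTo.lin_X _ h.ne_zero)
    (one_sub_ne_zero h.ne_zero h.pole)

/-- Adding a box changes the value of a factor by the ratio of the structure function. -/
theorem hval_shift (hq : q1 * q2 * q3 = 1) (h : Good q1 q2 q3 x v) (h' : Good q1 q2 q3 (q1 * x) v) :
    hval q1 q2 q3 (q1 * x) v * cubic (q1 + q2 + q3) (q1 * q2 + q1 * q3 + q2 * q3) v x =
      -cubic (q1 + q2 + q3) (q1 * q2 + q1 * q3 + q2 * q3) x v * hval q1 q2 q3 x v := by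
  have h1 : q1 ≠ 0 := by rintro rfl; simp at hq
  have hv := h.ne_zero
  have d1 := one_sub_ne_zero hv h.pole
  have d2 := one_sub_ne_zero hv h.pole'
  have d3 := one_sub_ne_zero hv h'.pole
  have e3 : q1⁻¹ * (q1 * x) = x := by field_simp
  have c1 : cubic (q1 + q2 + q3) (q1 * q2 + q1 * q3 + q2 * q3) v x =
      v ^ 3 * ((1 - q1 * x / v) * (1 - q2 * x / v) * (1 - q3 * x / v)) := by
    unfold cubic; field_simp; linear_combination (x ^ 3) * hq
  have c2 : -cubic (q1 + q2 + q3) (q1 * q2 + q1 * q3 + q2 * q3) x v =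
      v ^ 3 * ((1 - q1⁻¹ * x / v) * (1 - q2 * (q1 * x) / v) * (1 - q3 * (q1 * x) / v)) := by
    have hq3 : q1⁻¹ = q2 * q3 := by field_simp; linear_combination -hq
    rw [hq3]
    unfold cubic
    field_simp
    linear_combination (-(q1 + q2 + q3) * x ^ 2 * v + x ^ 3 * (1 + q1 * q2 * q3)) * hq
  rw [c1, c2]
  unfold hval
  rw [e3]
  generalize 1 - x / v = A at *
  generalize 1 - q1⁻¹ * x / v = B at *
  generalize 1 - q1 * x / v = D at *
  field_simp

end Good

end Evaluation

/-! ### Products of factors at the support of another part -/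

theorem support_add_box_self {q1 : ℂ} (h1 : q1 ≠ 0) (q2 u : ℂ) (L : ℕ → ℤ) (k : ℕ) :
    partSupport q1 q2 u (L + box k) k = q1 * partSupport q1 q2 u L k := by
  rw [partSupport, partSupport, add_box_apply, if_pos rfl, zpow_add_one₀ h1]
  ring

theorem support_add_box_of_ne (q1 q2 u : ℂ) (L : ℕ → ℤ) {k t : ℕ} (h : t ≠ k) :
    partSupport q1 q2 u (L + box k) t = partSupport q1 q2 u L t := by
  rw [partSupport, partSupport, add_box_apply, if_neg h, add_zero]

theorem cubic_eq_prod {q1 q2 q3 : ℂ} (hq : q1 * q2 * q3 = 1) (z w : ℂ) :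
    cubic (q1 + q2 + q3) (q1 * q2 + q1 * q3 + q2 * q3) z w =
      (z - q1 * w) * (z - q2 * w) * (z - q3 * w) := by
  unfold cubic
  linear_combination w ^ 3 * hq

/-- A box can be added at place `j` of the admissible sequence `L`. -/
def Edge (n r : ℕ) (a : Fin n → ℕ) (L : ℕ → ℤ) (j : ℕ) : Prop :=
  IsAdm n r a L ∧ IsAdm n r a (L + box j)

/-- A product over parts `t ∈ T` of the values of their factors at the support of the part `j`, times
vacuum factors for the parts in `W`. -/
def amp (q1 q2 q3 u : ℂ) (T W : Finset ℕ) (L : ℕ → ℤ) (j : ℕ) : ℂ :=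
  (∏ t ∈ T, hval q1 q2 q3 (partSupport q1 q2 u L t) (partSupport q1 q2 u L j)) *
    ∏ w ∈ W, phival q2 (partSupport q1 q2 u L w) (partSupport q1 q2 u L j)

section Amp

variable {q1 q2 q3 u : ℂ} {n r : ℕ} {a : Fin n → ℕ} {L : ℕ → ℤ} {j k : ℕ}

theorem amp_add_box_of_notMem {T W : Finset ℕ} (hjk : j ≠ k) (hT : k ∉ T) (hW : k ∉ W) :
    amp q1 q2 q3 u T W (L + box k) j = amp q1 q2 q3 u T W L j := by
  unfold amp
  rw [support_add_box_of_ne _ _ _ _ hjk]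
  congr 1
  · exact prod_congr rfl fun t ht => by
      rw [support_add_box_of_ne _ _ _ _ (ne_of_mem_of_not_mem ht hT)]
  · exact prod_congr rfl fun t ht => by
      rw [support_add_box_of_ne _ _ _ _ (ne_of_mem_of_not_mem ht hW)]

namespace Resonant

theorem good (R : Resonant q1 q2 q3 n r) (hu : u ≠ 0) (h : Edge n r a L j) {t : ℕ} (ht : t ≠ j) :
    Good q1 q2 q3 (partSupport q1 q2 u L t) (partSupport q1 q2 u L j) where
  ne_zero := R.support_ne_zero hu L j
  pole := by
    simpa using R.support_ne_of_edge hu h.1 h.2 ht (α := 0) (β := 0) (Or.inl ⟨rfl, rfl⟩)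
  pole' := by
    simpa using R.support_ne_of_edge hu h.1 h.2 ht (α := -1) (β := 0) (Or.inr (Or.inl ⟨rfl, rfl⟩))
  zero := by
    simpa using R.support_ne_of_edge hu h.1 h.2 ht (α := 0) (β := 1)
      (Or.inr (Or.inr (Or.inl ⟨rfl, rfl⟩)))
  zero' := by
    rw [R.q3_eq]
    exact R.support_ne_of_edge hu h.1 h.2 ht (α := -1) (β := -1)
      (Or.inr (Or.inr (Or.inr ⟨rfl, rfl⟩)))

theorem amp_ne_zero (R : Resonant q1 q2 q3 n r) (hu : u ≠ 0) (h : Edge n r a L j) {T W : Finset ℕ}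
    (hT : j ∉ T) (hW : j ∉ W) : amp q1 q2 q3 u T W L j ≠ 0 :=
  mul_ne_zero
    (prod_ne_zero_iff.mpr fun _ ht => (R.good hu h (ne_of_mem_of_not_mem ht hT)).hval_ne_zero)
    (prod_ne_zero_iff.mpr fun _ ht => (R.good hu h (ne_of_mem_of_not_mem ht hW)).phival_ne_zero)

/-- Adding a box at `k` changes an amplitude which contains the factor of the part `k` by the ratio
of the structure function. -/
theorem amp_add_box_of_mem (R : Resonant q1 q2 q3 n r) (hu : u ≠ 0) {T W : Finset ℕ}
    (hj : Edge n r a L j) (hj' : Edge n r a (L + box k) j) (hjk : j ≠ k) (hT : k ∈ T) (hW : k ∉ W) :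
    amp q1 q2 q3 u T W (L + box k) j * cubic (q1 + q2 + q3) (q1 * q2 + q1 * q3 + q2 * q3)
        (partSupport q1 q2 u L j) (partSupport q1 q2 u L k) =
      -cubic (q1 + q2 + q3) (q1 * q2 + q1 * q3 + q2 * q3)
        (partSupport q1 q2 u L k) (partSupport q1 q2 u L j) * amp q1 q2 q3 u T W L j := by
  have g1 := R.good hu hj hjk.symm
  have g2 := R.good hu hj' hjk.symm
  rw [support_add_box_self R.q1_ne_zero, support_add_box_of_ne _ _ _ _ hjk] at g2
  have h1 := g1.hval_shift R.mul_eq_one g2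
  have h2 : amp q1 q2 q3 u T W (L + box k) j =
      hval q1 q2 q3 (q1 * partSupport q1 q2 u L k) (partSupport q1 q2 u L j) *
        amp q1 q2 q3 u (T.erase k) W (L + box k) j := by
    unfold amp
    rw [← mul_prod_erase _ _ hT, support_add_box_self R.q1_ne_zero,
      support_add_box_of_ne _ _ _ _ hjk, mul_assoc]
  have h3 : amp q1 q2 q3 u T W L j =
      hval q1 q2 q3 (partSupport q1 q2 u L k) (partSupport q1 q2 u L j) *
        amp q1 q2 q3 u (T.erase k) W L j := by
    unfold amp
    rw [← mul_prod_erase _ _ hT, mul_assoc]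
  rw [h2, h3, amp_add_box_of_notMem hjk (by simp) hW]
  linear_combination amp q1 q2 q3 u (T.erase k) W L j * h1

/-- Around a square, amplitudes of which exactly one contains the factor of the other part are
related by the structure function. -/
theorem amp_square (R : Resonant q1 q2 q3 n r) (hu : u ≠ 0) {T W T' W' : Finset ℕ} (hjk : j ≠ k)
    (hj : Edge n r a L j) (hkj : Edge n r a (L + box k) j) (hT : k ∈ T) (hT' : j ∉ T')
    (hW : k ∉ W) (hW' : j ∉ W') :
    cubic (q1 + q2 + q3) (q1 * q2 + q1 * q3 + q2 * q3)
        (partSupport q1 q2 u L k) (partSupport q1 q2 u L j) *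
        (amp q1 q2 q3 u T W L j * amp q1 q2 q3 u T' W' (L + box j) k) +
      cubic (q1 + q2 + q3) (q1 * q2 + q1 * q3 + q2 * q3)
        (partSupport q1 q2 u L j) (partSupport q1 q2 u L k) *
        (amp q1 q2 q3 u T' W' L k * amp q1 q2 q3 u T W (L + box k) j) = 0 := by
  rw [amp_add_box_of_notMem hjk.symm hT' hW']
  linear_combination amp q1 q2 q3 u T' W' L k * R.amp_add_box_of_mem hu hj hkj hjk hT hW

theorem cubic_ne_zero (R : Resonant q1 q2 q3 n r) (hu : u ≠ 0) (hj : Edge n r a L j)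
    (hj' : Edge n r a (L + box k) j) (hjk : j ≠ k) :
    cubic (q1 + q2 + q3) (q1 * q2 + q1 * q3 + q2 * q3)
      (partSupport q1 q2 u L j) (partSupport q1 q2 u L k) ≠ 0 := by
  have g1 := R.good hu hj hjk.symm
  have g2 := R.good hu hj' hjk.symm
  rw [support_add_box_self R.q1_ne_zero, support_add_box_of_ne _ _ _ _ hjk] at g2
  rw [cubic_eq_prod R.mul_eq_one]
  exact mul_ne_zero (mul_ne_zero (sub_ne_zero.mpr g2.pole) (sub_ne_zero.mpr g1.zero))
    (sub_ne_zero.mpr g1.zero')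

/-- The quadratic relation where only one of the two orders exists. -/
theorem cubic_eq_zero_of_not_edge (R : Resonant q1 q2 q3 n r) (hu : u ≠ 0) (hj : Edge n r a L j)
    (hk : Edge n r a (L + box j) k) (hjk : j ≠ k) (hk' : ¬ IsAdm n r a (L + box k)) :
    cubic (q1 + q2 + q3) (q1 * q2 + q1 * q3 + q2 * q3)
      (partSupport q1 q2 u L k) (partSupport q1 q2 u L j) = 0 := by
  rw [cubic_eq_prod R.mul_eq_one]
  rcases R.support_eq_of_not_edge hu hj.1 hjk hk.2 hk' with h | h
  · rw [h]; ring
  · rw [h]; ring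

theorem cubic_ne_zero_of (R : Resonant q1 q2 q3 n r) {z w : ℂ}
    (h : ∀ α β : ℤ, ((α = 1 ∧ β = 0) ∨ (α = 0 ∧ β = 1) ∨ (α = -1 ∧ β = -1)) →
      z ≠ q1 ^ α * q2 ^ β * w) :
    cubic (q1 + q2 + q3) (q1 * q2 + q1 * q3 + q2 * q3) z w ≠ 0 := by
  rw [cubic_eq_prod R.mul_eq_one]
  refine mul_ne_zero (mul_ne_zero (sub_ne_zero.mpr ?_) (sub_ne_zero.mpr ?_)) (sub_ne_zero.mpr ?_)
  · simpa using h 1 0 (Or.inl ⟨rfl, rfl⟩)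
  · simpa using h 0 1 (Or.inr (Or.inl ⟨rfl, rfl⟩))
  · rw [R.q3_eq]; exact h (-1) (-1) (Or.inr (Or.inr ⟨rfl, rfl⟩))

end Resonant

/-- Two edges with a common source or a common target complete to a square. -/
theorem Edge.square (hn : 0 < n) (hjk : j ≠ k) (h : (Edge n r a L j ∧ Edge n r a L k) ∨
    (IsAdm n r a (L + box j) ∧ IsAdm n r a (L + box k))) :
    Edge n r a L j ∧ Edge n r a L k ∧ Edge n r a (L + box j) k ∧ Edge n r a (L + box k) j := by
  have hj : IsAdm n r a (L + box j) := by rcases h with h | h; exacts [h.1.2, h.1]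
  have hk : IsAdm n r a (L + box k) := by rcases h with h | h; exacts [h.2.2, h.2]
  have h0 := IsAdm.inf hn hjk hj hk
  have h1 := IsAdm.sup hjk hj hk
  exact ⟨⟨h0, hj⟩, ⟨h0, hk⟩, ⟨hj, h1⟩, ⟨hk, by rwa [add_right_comm]⟩⟩

end Amp

/-! ### The eigenvalue of `ψ(z)` as a finite product -/

section Eigenvalue

variable {q1 q2 q3 u : ℂ} {n r : ℕ} {a : Fin n → ℕ} {L : ℕ → ℤ}

/-- The entry `n` places further has support `q₁^{-r} q₂^n = q₃` times as large. -/
theorem Resonant.support_vacuum_add (R : Resonant q1 q2 q3 n r) (u : ℂ) (s : ℕ) :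
    partSupport q1 q2 u (vacuum n r a) (s + n) = q3 * partSupport q1 q2 u (vacuum n r a) s := by
  have h1 := R.q1_ne_zero
  have h2 := R.q2_ne_zero
  have h3 : q1 ^ (-r - -1 : ℤ) * q2 ^ (n + 1 : ℤ) = 1 := (R.zpow_q1_q2 _ _).mpr ⟨1, by ring, by ring⟩
  rw [zpow_sub₀ h1, zpow_add_one₀ h2, zpow_natCast, zpow_neg_one] at h3
  have h4 : q1 ^ (-r : ℤ) * q2 ^ n = q3 := by
    rw [R.q3_eq, zpow_neg_one, zpow_neg_one]
    field_simp at h3 ⊢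
    linear_combination h3
  have hn := R.two_le_n
  rw [partSupport, partSupport, vacuum_add_period (by omega), ← h4, sub_eq_add_neg, zpow_add₀ h1,
    pow_add]
  ring

/-- The vacuum factor which remains when the parts before the place `s` are removed. By
`support_vacuum_add` its `n` factors telescope against the factors of the vacuum parts. -/
def vacPhi (q1 q2 u : ℂ) (n r : ℕ) (a : Fin n → ℕ) (s : ℕ) (z : RatFunc ℂ) : RatFunc ℂ :=
  ∏ m ∈ range n, phi q2 (partSupport q1 q2 u (vacuum n r a) (s + m)) z

theorem vacPhi_eq_prod_Ico (q1 q2 u : ℂ) (n r : ℕ) (a : Fin n → ℕ) (s : ℕ) (z : RatFunc ℂ) :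
    vacPhi q1 q2 u n r a s z =
      ∏ w ∈ Ico s (s + n), phi q2 (partSupport q1 q2 u (vacuum n r a) w) z := by
  rw [prod_Ico_eq_prod_range, Nat.add_sub_cancel_left, vacPhi]

theorem vacPhi_eq (q1 q2 u : ℂ) (n r : ℕ) (a : Fin n → ℕ) (s : ℕ) (z : RatFunc ℂ) :
    ∏ m ∈ range n, vacFun q2 (RatFunc.C (u * q1 ^ vacuum n r a (s + m) * q2 ^ (s + m)) / z) =
      vacPhi q1 q2 u n r a s z :=
  prod_congr rfl fun m _ => by rw [vacFun_eq_phi, partSupport]; congr 1; ring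

theorem phi_ne_zero {q2 x : ℂ} {z : RatFunc ℂ} (hz : IsGeneric z) : phi q2 x z ≠ 0 :=
  div_ne_zero (hz _) (hz _)

theorem Resonant.vacPhi_succ (R : Resonant q1 q2 q3 n r) {z : RatFunc ℂ} (hz : IsGeneric z) (s : ℕ) :
    vacPhi q1 q2 u n r a (s + 1) z * hfun q1 q2 q3 (partSupport q1 q2 u (vacuum n r a) s) z =
      vacPhi q1 q2 u n r a s z := by
  set p : ℕ → RatFunc ℂ := fun t => phi q2 (partSupport q1 q2 u (vacuum n r a) t) z with hp
  have h1 : vacPhi q1 q2 u n r a (s + 1) z * p s = vacPhi q1 q2 u n r a s z * p (s + n) := by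
    have e1 : vacPhi q1 q2 u n r a (s + 1) z = ∏ m ∈ range n, p (s + (m + 1)) :=
      prod_congr rfl fun m _ => by rw [hp, add_assoc, add_comm 1 m]
    have e2 : vacPhi q1 q2 u n r a s z = ∏ m ∈ range n, p (s + m) := rfl
    rw [e1, e2, ← prod_range_succ (fun m => p (s + m)), prod_range_succ' (fun m => p (s + m)),
      add_zero]
  have h2 : p (s + n) * hfun q1 q2 q3 (partSupport q1 q2 u (vacuum n r a) s) z = p s := by
    rw [hp]
    dsimp only
    rw [R.support_vacuum_add]
    exact phi_shift R.mul_eq_one hz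
  have h3 : p (s + n) ≠ 0 := phi_ne_zero hz
  apply mul_right_cancel₀ h3
  rw [mul_assoc, mul_comm (hfun _ _ _ _ _), h2, h1]

theorem partPsi_eq_hfun_swap {q1 q2 q3 : ℂ} (hq : q1 * q2 * q3 = 1) (u : ℂ) (l : ℕ → ℤ) (s : ℕ)
    (z : RatFunc ℂ) : partPsi q1 q3 q2 u l s z = hfun q1 q2 q3 (partSupport q1 q2 u l s) z := by
  rw [partPsi_eq_hfun (by linear_combination hq), hfun_swap]

theorem Resonant.vacPhi_mul_finprod (R : Resonant q1 q2 q3 n r) {z : RatFunc ℂ} (hz : IsGeneric z)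
    {N s : ℕ} (hN : ∀ t ≥ N, L t = vacuum n r a t) (hs : s ≤ N) :
    vacPhi q1 q2 u n r a s z *
        ∏ᶠ t : ℕ, partPsi q1 q3 q2 u L (s + t) z / partPsi q1 q3 q2 u (vacuum n r a) (s + t) z =
      (∏ t ∈ Ico s N, hfun q1 q2 q3 (partSupport q1 q2 u L t) z) * vacPhi q1 q2 u n r a N z := by
  simp only [partPsi_eq_hfun_swap R.mul_eq_one]
  exact mul_finprod_eq (Φ := fun s => vacPhi q1 q2 u n r a s z)
    (h := fun t => hfun q1 q2 q3 (partSupport q1 q2 u L t) z)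
    (h0 := fun t => hfun q1 q2 q3 (partSupport q1 q2 u (vacuum n r a) t) z)
    (fun s => R.vacPhi_succ hz s) (fun s => hfun_ne_zero hz)
    (fun t ht => by simp only [partSupport, hN t ht]) hs

theorem Resonant.fatPsi_eq (R : Resonant q1 q2 q3 n r) {z : RatFunc ℂ} (hz : IsGeneric z)
    {N : ℕ} (hN : ∀ t ≥ N, L t = vacuum n r a t) :
    fatPsi q1 q3 q2 u n r a L z =
      (∏ t ∈ range N, hfun q1 q2 q3 (partSupport q1 q2 u L t) z) * vacPhi q1 q2 u n r a N z := by
  have h1 := R.vacPhi_mul_finprod (u := u) hz hN (Nat.zero_le N)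
  have h2 := vacPhi_eq q1 q2 u n r a 0 z
  simp only [zero_add] at h1 h2
  rw [fatPsi, h2, h1, range_eq_Ico]

theorem Resonant.fatF_eq (R : Resonant q1 q2 q3 n r) {z : RatFunc ℂ} (hz : IsGeneric z)
    {N : ℕ} (hN : ∀ t ≥ N, L t = vacuum n r a t) {j : ℕ} (hj : j < N) :
    fatF q1 q3 q2 u n r a L j z = RatFunc.C (q1 / (1 - q1)) *
      ((∏ t ∈ Ico (j + 1) N, hfun q1 q2 q3 (partSupport q1 q2 u L t) z) *
        vacPhi q1 q2 u n r a N z) := by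
  have h1 := R.vacPhi_mul_finprod (u := u) hz hN (show j + 1 ≤ N from hj)
  rw [fatF, mul_assoc, vacPhi_eq, ← h1, mul_comm (vacPhi _ _ _ _ _ _ _ _)]

theorem rowE_eq {q1 q2 q3 : ℂ} (hq : q1 * q2 * q3 = 1) (j : ℕ) (z : RatFunc ℂ) :
    rowE q1 q3 q2 u L j z = RatFunc.C (1 / (1 - q1)) *
      ∏ t ∈ range j, hfun q1 q2 q3 (partSupport q1 q2 u L t) z := by
  simp only [rowE, partPsi_eq_hfun_swap hq]

/-- Adding a box changes the eigenvalue like the factor of the part. -/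
theorem Resonant.fatPsi_add_box (R : Resonant q1 q2 q3 n r) {z : RatFunc ℂ} (hz : IsGeneric z)
    (hL : IsAdm n r a L) (k : ℕ) :
    fatPsi q1 q3 q2 u n r a (L + box k) z * hfun q1 q2 q3 (partSupport q1 q2 u L k) z =
      fatPsi q1 q3 q2 u n r a L z * hfun q1 q2 q3 (q1 * partSupport q1 q2 u L k) z := by
  obtain ⟨N, hN⟩ := hL.2.2
  have h1 : ∀ t ≥ max N (k + 1), L t = vacuum n r a t := fun t ht =>
    hN t (le_trans (le_max_left _ _) ht)
  have hk : k < max N (k + 1) := lt_of_lt_of_le (Nat.lt_succ_self k) (le_max_right _ _)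
  have h2 : ∀ t ≥ max N (k + 1), (L + box k) t = vacuum n r a t := fun t ht => by
    rw [add_box_apply, if_neg (by omega), add_zero, h1 t ht]
  rw [R.fatPsi_eq hz h1, R.fatPsi_eq hz h2, ← mul_prod_erase (range _) _ (mem_range.mpr hk),
    ← mul_prod_erase (range _) _ (mem_range.mpr hk), support_add_box_self R.q1_ne_zero,
    prod_congr rfl fun t ht => by rw [support_add_box_of_ne _ _ _ _ (ne_of_mem_erase ht)]]
  ring

end Eigenvalue

/-! ### The half currents of the semi-infinite module -/

section Amplitudes

open scoped Classical in
/-- The amplitude of `e(z)` on the semi-infinite module, extended by zero. -/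
def ampE (q1 q2 q3 u : ℂ) (n r : ℕ) (a : Fin n → ℕ) (L : ℕ → ℤ) (j : ℕ) : ℂ :=
  if Edge n r a L j then 1 / (1 - q1) * amp q1 q2 q3 u (range j) ∅ L j else 0

/-- The value, at the support of the part `j`, of the eigenvalue of `ψ(z)` without the factor of the
part `j`. -/
def resid (q1 q2 q3 u : ℂ) (n r : ℕ) (a : Fin n → ℕ) (L : ℕ → ℤ) (j : ℕ) : ℂ :=
  RatFunc.eval (RingHom.id ℂ) (partSupport q1 q2 u L j) (fatPsi q1 q3 q2 u n r a L RatFunc.X /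
    hfun q1 q2 q3 (partSupport q1 q2 u L j) RatFunc.X)

open scoped Classical in
/-- The amplitude of `f(z)` on the semi-infinite module, extended by zero. It is defined through its
product with the amplitude of `e(z)`; `evalsTo_fatF` identifies it with the explicit product. -/
def ampF (q1 q2 q3 u : ℂ) (n r : ℕ) (a : Fin n → ℕ) (L : ℕ → ℤ) (j : ℕ) : ℂ :=
  if Edge n r a L j then
    q1 / (1 - q1) ^ 2 * resid q1 q2 q3 u n r a L j / ampE q1 q2 q3 u n r a L j else 0

variable {q1 q2 q3 u : ℂ} {n r : ℕ} {a : Fin n → ℕ} {L : ℕ → ℤ} {j k : ℕ}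

theorem edge_of_ampE_ne_zero (h : ampE q1 q2 q3 u n r a L j ≠ 0) : Edge n r a L j := by
  by_contra hc; exact h (if_neg hc)

theorem edge_of_ampF_ne_zero (h : ampF q1 q2 q3 u n r a L j ≠ 0) : Edge n r a L j := by
  by_contra hc; exact h (if_neg hc)

theorem ampE_of_edge (h : Edge n r a L j) :
    ampE q1 q2 q3 u n r a L j = 1 / (1 - q1) * amp q1 q2 q3 u (range j) ∅ L j := if_pos h

theorem ampE_of_not_edge (h : ¬ Edge n r a L j) : ampE q1 q2 q3 u n r a L j = 0 := if_neg h

theorem ampF_of_not_edge (h : ¬ Edge n r a L j) : ampF q1 q2 q3 u n r a L j = 0 := if_neg h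

namespace Resonant

theorem one_sub_q1_ne_zero (R : Resonant q1 q2 q3 n r) : 1 - q1 ≠ 0 :=
  sub_ne_zero.mpr (Ne.symm R.q1_ne_one)

theorem ampE_ne_zero (R : Resonant q1 q2 q3 n r) (hu : u ≠ 0) (h : Edge n r a L j) :
    ampE q1 q2 q3 u n r a L j ≠ 0 := by
  rw [ampE_of_edge h]
  exact mul_ne_zero (one_div_ne_zero R.one_sub_q1_ne_zero) (R.amp_ne_zero hu h (by simp) (by simp))

theorem ampE_mul_ampF (R : Resonant q1 q2 q3 n r) (hu : u ≠ 0) (h : Edge n r a L j) :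
    ampE q1 q2 q3 u n r a L j * ampF q1 q2 q3 u n r a L j =
      q1 / (1 - q1) ^ 2 * resid q1 q2 q3 u n r a L j := by
  rw [ampF, if_pos h, mul_div_cancel₀ _ (R.ampE_ne_zero hu h)]

theorem evalsTo_prod_hfun (R : Resonant q1 q2 q3 n r) (hu : u ≠ 0) (h : Edge n r a L j)
    {T : Finset ℕ} (hT : j ∉ T) :
    EvalsTo (∏ t ∈ T, hfun q1 q2 q3 (partSupport q1 q2 u L t) RatFunc.X) (partSupport q1 q2 u L j)
      (∏ t ∈ T, hval q1 q2 q3 (partSupport q1 q2 u L t) (partSupport q1 q2 u L j)) :=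
  EvalsTo.prod fun _ ht => (R.good hu h (ne_of_mem_of_not_mem ht hT)).evalsTo_hfun

/-- Every product of factors of other parts, with vacuum factors of the last places, has a value
at the support of an addable box. -/
theorem evalsTo_amp (R : Resonant q1 q2 q3 n r) (hu : u ≠ 0) (h : Edge n r a L j)
    {T W : Finset ℕ} (hT : j ∉ T) {N : ℕ} (hN : ∀ t ≥ N, L t = vacuum n r a t) (hj : j < N)
    (hW : ∀ w ∈ W, N ≤ w) :
    EvalsTo ((∏ t ∈ T, hfun q1 q2 q3 (partSupport q1 q2 u L t) RatFunc.X) *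
      ∏ w ∈ W, phi q2 (partSupport q1 q2 u (vacuum n r a) w) RatFunc.X)
      (partSupport q1 q2 u L j) (amp q1 q2 q3 u T W L j) := by
  refine (R.evalsTo_prod_hfun hu h hT).mul (EvalsTo.prod fun w hw => ?_)
  have h0 := hW w hw
  have h1 : partSupport q1 q2 u (vacuum n r a) w = partSupport q1 q2 u L w := by
    rw [partSupport, partSupport, hN w h0]
  rw [h1]
  exact (R.good hu h (by omega)).evalsTo_phi

theorem fatPsi_div_eq (R : Resonant q1 q2 q3 n r) {z : RatFunc ℂ} (hz : IsGeneric z)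
    {N : ℕ} (hN : ∀ t ≥ N, L t = vacuum n r a t) (hj : j < N) :
    fatPsi q1 q3 q2 u n r a L z / hfun q1 q2 q3 (partSupport q1 q2 u L j) z =
      (∏ t ∈ (range N).erase j, hfun q1 q2 q3 (partSupport q1 q2 u L t) z) *
        vacPhi q1 q2 u n r a N z := by
  rw [R.fatPsi_eq hz hN, ← mul_prod_erase (range N) _ (mem_range.mpr hj),
    div_eq_iff (hfun_ne_zero hz)]
  ring

theorem evalsTo_resid (R : Resonant q1 q2 q3 n r) (hu : u ≠ 0) (h : Edge n r a L j)
    {N : ℕ} (hN : ∀ t ≥ N, L t = vacuum n r a t) (hj : j < N) :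
    EvalsTo (fatPsi q1 q3 q2 u n r a L RatFunc.X /
      hfun q1 q2 q3 (partSupport q1 q2 u L j) RatFunc.X) (partSupport q1 q2 u L j)
      (amp q1 q2 q3 u ((range N).erase j) (Ico N (N + n)) L j) := by
  rw [R.fatPsi_div_eq isGeneric_X hN hj, vacPhi_eq_prod_Ico]
  exact R.evalsTo_amp hu h (by simp) hN hj fun w hw => (mem_Ico.mp hw).1

theorem resid_eq (R : Resonant q1 q2 q3 n r) (hu : u ≠ 0) (h : Edge n r a L j)
    {N : ℕ} (hN : ∀ t ≥ N, L t = vacuum n r a t) (hj : j < N) :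
    resid q1 q2 q3 u n r a L j = amp q1 q2 q3 u ((range N).erase j) (Ico N (N + n)) L j :=
  (R.evalsTo_resid hu h hN hj).eval_eq

theorem resid_add_box (R : Resonant q1 q2 q3 n r) (hu : u ≠ 0) (hj : Edge n r a L j)
    (hj' : Edge n r a (L + box k) j) (hjk : j ≠ k) :
    resid q1 q2 q3 u n r a (L + box k) j *
        cubic (q1 + q2 + q3) (q1 * q2 + q1 * q3 + q2 * q3)
          (partSupport q1 q2 u L j) (partSupport q1 q2 u L k) =
      -cubic (q1 + q2 + q3) (q1 * q2 + q1 * q3 + q2 * q3)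
          (partSupport q1 q2 u L k) (partSupport q1 q2 u L j) * resid q1 q2 q3 u n r a L j := by
  obtain ⟨N, hN⟩ := hj.1.2.2
  have h1 : ∀ t ≥ N + j + k + 1, L t = vacuum n r a t := fun t ht => hN t (by omega)
  have h2 : ∀ t ≥ N + j + k + 1, (L + box k) t = vacuum n r a t := fun t ht => by
    rw [add_box_apply, if_neg (by omega), add_zero, h1 t ht]
  rw [R.resid_eq hu hj h1 (by omega), R.resid_eq hu hj' h2 (by omega)]
  refine R.amp_add_box_of_mem hu hj hj' hjk ?_ ?_
  · rw [mem_erase, mem_range]; exact ⟨hjk.symm, by omega⟩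
  · rw [mem_Ico]; omega

/-- Around a square, the amplitudes of `e(z)` are related by the structure function. -/
theorem ampE_square (R : Resonant q1 q2 q3 n r) (hu : u ≠ 0) (hjk : j ≠ k)
    (hj : Edge n r a L j) (hk : Edge n r a L k)
    (hjk' : Edge n r a (L + box j) k) (hkj : Edge n r a (L + box k) j) :
    cubic (q1 + q2 + q3) (q1 * q2 + q1 * q3 + q2 * q3)
        (partSupport q1 q2 u L k) (partSupport q1 q2 u L j) *
        (ampE q1 q2 q3 u n r a L j * ampE q1 q2 q3 u n r a (L + box j) k) +
      cubic (q1 + q2 + q3) (q1 * q2 + q1 * q3 + q2 * q3)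
        (partSupport q1 q2 u L j) (partSupport q1 q2 u L k) *
        (ampE q1 q2 q3 u n r a L k * ampE q1 q2 q3 u n r a (L + box k) j) = 0 := by
  rw [ampE_of_edge hj, ampE_of_edge hk, ampE_of_edge hjk', ampE_of_edge hkj]
  rcases lt_or_gt_of_ne hjk with hlt | hlt
  · have h1 := R.amp_square hu hjk.symm hk hjk' (T := range k) (T' := range j) (W := ∅) (W' := ∅)
      (by simpa) (by simp; omega) (by simp) (by simp)
    linear_combination (1 / (1 - q1)) ^ 2 * h1
  · have h1 := R.amp_square hu hjk hj hkj (T := range j) (T' := range k) (W := ∅) (W' := ∅)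
      (by simpa) (by simp; omega) (by simp) (by simp)
    linear_combination (1 / (1 - q1)) ^ 2 * h1

/-- Around a square, the amplitudes of `f(z)` are related by the structure function: this follows from
`ampE_square`, as the products `E F` are known. -/
theorem ampF_square (R : Resonant q1 q2 q3 n r) (hu : u ≠ 0) (hjk : j ≠ k)
    (hj : Edge n r a L j) (hk : Edge n r a L k)
    (hjk' : Edge n r a (L + box j) k) (hkj : Edge n r a (L + box k) j) :
    cubic (q1 + q2 + q3) (q1 * q2 + q1 * q3 + q2 * q3)
        (partSupport q1 q2 u L j) (partSupport q1 q2 u L k) *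
        (ampF q1 q2 q3 u n r a (L + box k) j * ampF q1 q2 q3 u n r a L k) +
      cubic (q1 + q2 + q3) (q1 * q2 + q1 * q3 + q2 * q3)
        (partSupport q1 q2 u L k) (partSupport q1 q2 u L j) *
        (ampF q1 q2 q3 u n r a (L + box j) k * ampF q1 q2 q3 u n r a L j) = 0 := by
  have h1 := R.ampE_square hu hjk hj hk hjk' hkj
  have h2 := R.resid_add_box hu hj hkj hjk
  have h3 := R.resid_add_box hu hk hjk' hjk.symm
  have e1 := R.ampE_ne_zero hu hj
  have e2 := R.ampE_ne_zero hu hk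
  have e3 := R.ampE_ne_zero hu hjk'
  have e4 := R.ampE_ne_zero hu hkj
  have c := R.one_sub_q1_ne_zero
  have f1 := R.ampE_mul_ampF hu hj
  have f2 := R.ampE_mul_ampF hu hk
  have f3 := R.ampE_mul_ampF hu hjk'
  have f4 := R.ampE_mul_ampF hu hkj
  generalize cubic _ _ (partSupport q1 q2 u L j) (partSupport q1 q2 u L k) = A at *
  generalize cubic _ _ (partSupport q1 q2 u L k) (partSupport q1 q2 u L j) = B at *
  generalize ampE q1 q2 q3 u n r a L j = x1 at *
  generalize ampE q1 q2 q3 u n r a L k = x2 at *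
  generalize ampE q1 q2 q3 u n r a (L + box j) k = x3 at *
  generalize ampE q1 q2 q3 u n r a (L + box k) j = x4 at *
  generalize ampF q1 q2 q3 u n r a L j = y1 at *
  generalize ampF q1 q2 q3 u n r a L k = y2 at *
  generalize ampF q1 q2 q3 u n r a (L + box j) k = y3 at *
  generalize ampF q1 q2 q3 u n r a (L + box k) j = y4 at *
  generalize q1 / (1 - q1) ^ 2 = κ at *
  generalize resid q1 q2 q3 u n r a L j = r1 at *
  generalize resid q1 q2 q3 u n r a L k = r2 at *
  generalize resid q1 q2 q3 u n r a (L + box j) k = r3 at *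
  generalize resid q1 q2 q3 u n r a (L + box k) j = r4 at *
  have key : x1 * x2 * x3 * x4 * (A * (y4 * y2) + B * (y3 * y1)) =
      x1 * x3 * A * (x4 * y4) * (x2 * y2) + x2 * x4 * B * (x3 * y3) * (x1 * y1) := by ring
  refine (mul_eq_zero.mp ?_).resolve_left
    (mul_ne_zero (mul_ne_zero (mul_ne_zero e1 e2) e3) e4)
  rw [key, f1, f2, f3, f4]
  linear_combination κ ^ 2 * (x1 * x3 * r2 * h2 + x2 * x4 * r1 * h3 - r1 * r2 * h1)

/-- Around a square, removing one box commutes with adding another one. -/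
theorem off_diag_square (R : Resonant q1 q2 q3 n r) (hu : u ≠ 0) (hjk : j ≠ k)
    (hj : Edge n r a L j) (hk : Edge n r a L k)
    (hjk' : Edge n r a (L + box j) k) (hkj : Edge n r a (L + box k) j) :
    ampF q1 q2 q3 u n r a L j * ampE q1 q2 q3 u n r a L k =
      ampE q1 q2 q3 u n r a (L + box j) k * ampF q1 q2 q3 u n r a (L + box k) j := by
  have h1 := R.ampE_square hu hjk hj hk hjk' hkj
  have h2 := R.resid_add_box hu hj hkj hjk
  have h0 := R.cubic_ne_zero hu hj hkj hjk
  have e1 := R.ampE_ne_zero hu hj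
  have e4 := R.ampE_ne_zero hu hkj
  have f1 := R.ampE_mul_ampF hu hj
  have f4 := R.ampE_mul_ampF hu hkj
  generalize cubic _ _ (partSupport q1 q2 u L j) (partSupport q1 q2 u L k) = A at *
  generalize cubic _ _ (partSupport q1 q2 u L k) (partSupport q1 q2 u L j) = B at *
  generalize ampE q1 q2 q3 u n r a L j = x1 at *
  generalize ampE q1 q2 q3 u n r a L k = x2 at *
  generalize ampE q1 q2 q3 u n r a (L + box j) k = x3 at *
  generalize ampE q1 q2 q3 u n r a (L + box k) j = x4 at *
  generalize ampF q1 q2 q3 u n r a L j = y1 at *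
  generalize ampF q1 q2 q3 u n r a (L + box k) j = y4 at *
  apply mul_left_cancel₀ (mul_ne_zero (mul_ne_zero h0 e1) e4)
  linear_combination (A * x4 * x2) * f1 - (A * x1 * x3) * f4 +
    (q1 / (1 - q1) ^ 2 * resid q1 q2 q3 u n r a L j) * h1 - (q1 / (1 - q1) ^ 2 * x1 * x3) * h2

theorem cubic_path_two (R : Resonant q1 q2 q3 n r) (hu : u ≠ 0)
    (hj : Edge n r a L j) (hk : Edge n r a (L + box j) k) :
    cubic (q1 + q2 + q3) (q1 * q2 + q1 * q3 + q2 * q3)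
      (partSupport q1 q2 u L j) (partSupport q1 q2 u (L + box j) k) ≠ 0 :=
  R.cubic_ne_zero_of fun _ _ h => R.first_second hu hj.1 hj.2 hk.2 h

theorem cubic_path_three (R : Resonant q1 q2 q3 n r) (hu : u ≠ 0) {m : ℕ}
    (hj : Edge n r a L j) (hm : Edge n r a (L + box j + box k) m) :
    cubic (q1 + q2 + q3) (q1 * q2 + q1 * q3 + q2 * q3)
      (partSupport q1 q2 u L j) (partSupport q1 q2 u (L + box j + box k) m) ≠ 0 :=
  R.cubic_ne_zero_of fun _ _ h => R.first_third hu hj.1 hj.2 hm.2 h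

theorem cubic_self (R : Resonant q1 q2 q3 n r) (L : ℕ → ℤ) (j : ℕ) :
    cubic (q1 + q2 + q3) (q1 * q2 + q1 * q3 + q2 * q3)
      (partSupport q1 q2 u (L + box j) j) (partSupport q1 q2 u L j) = 0 := by
  rw [cubic_eq_prod R.mul_eq_one, support_add_box_self R.q1_ne_zero]
  ring

theorem halfCurrent_ampE (R : Resonant q1 q2 q3 n r) (hu : u ≠ 0) :
    HalfCurrent (q1 + q2 + q3) (q1 * q2 + q1 * q3 + q2 * q3) box (ampE q1 q2 q3 u n r a)
      (partSupport q1 q2 u) where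
  finite L := by
    have hn := R.two_le_n
    by_cases hL : IsAdm n r a L
    · obtain ⟨N, hN⟩ := hL.2.2
      refine (Set.finite_lt_nat (N + n)).subset fun j hj => ?_
      exact IsAdm.addable_lt (by omega) hN (edge_of_ampE_ne_zero hj).2
    · convert Set.finite_empty
      rw [Set.eq_empty_iff_forall_notMem]
      exact fun j hj => hL (edge_of_ampE_ne_zero hj).1
  ne_zero := R.support_ne_zero hu
  shift L j k hjk := support_add_box_of_ne _ _ _ _ hjk.symm
  cubic_same L j := R.cubic_self L j
  pair L j k hjk := by
    have hn := R.two_le_n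
    -- If both orders exist this is the square relation, and if only one exists its coefficient vanishes.
    by_cases hj : Edge n r a L j ∧ Edge n r a (L + box j) k
    · by_cases hk : IsAdm n r a (L + box k)
      · obtain ⟨s1, s2, s3, s4⟩ := Edge.square (by omega) hjk (Or.inr ⟨hj.1.2, hk⟩)
        exact R.ampE_square hu hjk s1 s2 s3 s4
      · rw [R.cubic_eq_zero_of_not_edge hu hj.1 hj.2 hjk hk,
          ampE_of_not_edge (L := L) (j := k) fun h => hk h.2]
        ring
    · have h0 : ampE q1 q2 q3 u n r a L j * ampE q1 q2 q3 u n r a (L + box j) k = 0 := by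
        rw [not_and_or] at hj
        rcases hj with hj | hj
        · rw [ampE_of_not_edge hj, zero_mul]
        · rw [ampE_of_not_edge hj, mul_zero]
      rw [h0, mul_zero, zero_add]
      by_cases hk : Edge n r a L k ∧ Edge n r a (L + box k) j
      · have hj' : ¬ IsAdm n r a (L + box j) := fun h => by
          obtain ⟨s1, s2, s3, s4⟩ := Edge.square (by omega) hjk (Or.inr ⟨h, hk.1.2⟩)
          exact hj ⟨s1, s3⟩
        rw [R.cubic_eq_zero_of_not_edge hu hk.1 hk.2 hjk.symm hj', zero_mul]
      · rw [not_and_or] at hk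
        rcases hk with hk | hk
        · rw [ampE_of_not_edge hk, zero_mul, mul_zero]
        · rw [ampE_of_not_edge hk, mul_zero, mul_zero]
  first_second L j k h :=
    R.cubic_path_two hu (edge_of_ampE_ne_zero (left_ne_zero_of_mul h))
      (edge_of_ampE_ne_zero (right_ne_zero_of_mul h))
  first_third L j k m h :=
    R.cubic_path_three hu (edge_of_ampE_ne_zero (left_ne_zero_of_mul (left_ne_zero_of_mul h)))
      (edge_of_ampE_ne_zero (right_ne_zero_of_mul h))

end Resonant
end Amplitudes

namespace Resonant

variable {q1 q2 q3 u : ℂ} {n r : ℕ} {a : Fin n → ℕ} {L : ℕ → ℤ} {j k : ℕ}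

theorem halfCurrent_ampF (R : Resonant q1 q2 q3 n r) (hu : u ≠ 0) :
    HalfCurrent (q1 * q2 + q1 * q3 + q2 * q3) (q1 + q2 + q3) (-box)
      (fun L j => ampF q1 q2 q3 u n r a (L - box j) j)
      (fun L j => partSupport q1 q2 u (L - box j) j) where
  finite L := by
    have hn := R.two_le_n
    by_cases hL : IsAdm n r a L
    · obtain ⟨N, hN⟩ := hL.2.2
      refine (Set.finite_lt_nat N).subset fun j hj => ?_
      exact IsAdm.removable_lt (L := L - box j) (by omega)
        (fun i hi => by rw [sub_add_cancel]; exact hN i hi) (edge_of_ampF_ne_zero hj).1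
    · convert Set.finite_empty
      rw [Set.eq_empty_iff_forall_notMem]
      intro j hj
      have := (edge_of_ampF_ne_zero hj).2
      rw [sub_add_cancel] at this
      exact hL this
  ne_zero L j := R.support_ne_zero hu _ j
  shift L j k hjk := by
    obtain ⟨M, rfl⟩ : ∃ M, L = M + box j + box k := ⟨L - box j - box k, by abel⟩
    have e1 : M + box j + box k + (-box) j - box k = M := by rw [Pi.neg_apply]; abel
    rw [e1, add_sub_cancel_right, support_add_box_of_ne _ _ _ _ hjk.symm]
  cubic_same L j := by
    obtain ⟨M, rfl⟩ : ∃ M, L = M + box j + box j := ⟨L - box j - box j, by abel⟩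
    have e1 : M + box j + box j + (-box) j - box j = M := by rw [Pi.neg_apply]; abel
    rw [e1, add_sub_cancel_right, cubic_swap, R.cubic_self, neg_zero]
  pair L j k hjk := by
    have hn := R.two_le_n
    obtain ⟨M, rfl⟩ : ∃ M, L = M + box j + box k := ⟨L - box j - box k, by abel⟩
    have e1 : M + box j + box k + (-box) j - box k = M := by rw [Pi.neg_apply]; abel
    have e2 : M + box j + box k + (-box) k - box j = M := by rw [Pi.neg_apply]; abel
    have e3 : M + box j + box k - box j = M + box k := by abel
    rw [e1, e2, e3, add_sub_cancel_right, support_add_box_of_ne _ _ _ _ hjk,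
      support_add_box_of_ne _ _ _ _ hjk.symm, cubic_swap _ _ (partSupport q1 q2 u M k),
      cubic_swap (q1 * q2 + q1 * q3 + q2 * q3)]
    -- If both orders exist this is the square relation, and if only one exists its coefficient vanishes.
    by_cases hj : Edge n r a M j ∧ Edge n r a (M + box j) k
    · by_cases hk : IsAdm n r a (M + box k)
      · obtain ⟨s1, s2, s3, s4⟩ := Edge.square (by omega) hjk (Or.inr ⟨hj.1.2, hk⟩)
        linear_combination -R.ampF_square hu hjk s1 s2 s3 s4
      · rw [R.cubic_eq_zero_of_not_edge hu hj.1 hj.2 hjk hk,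
          ampF_of_not_edge (L := M) (j := k) fun h => hk h.2]
        ring
    · have h0 : ampF q1 q2 q3 u n r a (M + box j) k * ampF q1 q2 q3 u n r a M j = 0 := by
        rw [not_and_or] at hj
        rcases hj with hj | hj
        · rw [ampF_of_not_edge hj, mul_zero]
        · rw [ampF_of_not_edge hj, zero_mul]
      rw [h0, mul_zero, add_zero]
      by_cases hk : Edge n r a M k ∧ Edge n r a (M + box k) j
      · have hj' : ¬ IsAdm n r a (M + box j) := fun h => by
          obtain ⟨s1, s2, s3, s4⟩ := Edge.square (by omega) hjk (Or.inr ⟨h, hk.1.2⟩)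
          exact hj ⟨s1, s3⟩
        rw [R.cubic_eq_zero_of_not_edge hu hk.1 hk.2 hjk.symm hj', neg_zero, zero_mul]
      · rw [not_and_or] at hk
        rcases hk with hk | hk
        · rw [ampF_of_not_edge hk, mul_zero, mul_zero]
        · rw [ampF_of_not_edge hk, zero_mul, mul_zero]
  first_second L j k h := by
    obtain ⟨M, rfl⟩ : ∃ M, L = M + box k + box j := ⟨L - box j - box k, by abel⟩
    have e1 : M + box k + box j + (-box) j - box k = M := by rw [Pi.neg_apply]; abel
    rw [e1, add_sub_cancel_right] at h ⊢
    rw [cubic_swap, neg_ne_zero]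
    exact R.cubic_path_two hu (edge_of_ampF_ne_zero (right_ne_zero_of_mul h))
      (edge_of_ampF_ne_zero (left_ne_zero_of_mul h))
  first_third L j k m h := by
    obtain ⟨M, rfl⟩ : ∃ M, L = M + box m + box k + box j := ⟨L - box j - box k - box m, by abel⟩
    have e1 : M + box m + box k + box j + (-box) j + (-box) k - box m = M := by
      rw [Pi.neg_apply, Pi.neg_apply]; abel
    rw [e1, add_sub_cancel_right] at h ⊢
    rw [cubic_swap, neg_ne_zero]
    exact R.cubic_path_three hu (edge_of_ampF_ne_zero (right_ne_zero_of_mul h))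
      (edge_of_ampF_ne_zero (left_ne_zero_of_mul (left_ne_zero_of_mul h)))

/-- Adding a box commutes with removing a different one. If one of the two products is non-zero, the
four edges form a square. -/
theorem amp_off_diag (R : Resonant q1 q2 q3 n r) (hu : u ≠ 0) (L : ℕ → ℤ) (hjk : j ≠ k) :
    ampF q1 q2 q3 u n r a (L - box j) j * ampE q1 q2 q3 u n r a (L - box j) k =
      ampE q1 q2 q3 u n r a L k * ampF q1 q2 q3 u n r a (L + box k - box j) j := by
  have hn := R.two_le_n
  obtain ⟨M, rfl⟩ : ∃ M, L = M + box j := ⟨L - box j, by abel⟩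
  have e1 : M + box j + box k - box j = M + box k := by abel
  rw [e1, add_sub_cancel_right]
  by_cases h : Edge n r a M j ∧ Edge n r a M k
  · obtain ⟨s1, s2, s3, s4⟩ := Edge.square (by omega) hjk (Or.inl h)
    exact R.off_diag_square hu hjk s1 s2 s3 s4
  · have h' : ¬ (Edge n r a (M + box j) k ∧ Edge n r a (M + box k) j) := fun h' => by
      obtain ⟨s1, s2, s3, s4⟩ := Edge.square (by omega) hjk (Or.inr ⟨h'.1.1, h'.2.1⟩)
      exact h ⟨s1, s2⟩
    trans (0 : ℂ)
    · rw [not_and_or] at h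
      rcases h with h | h
      · rw [ampF_of_not_edge h, zero_mul]
      · rw [ampE_of_not_edge h, mul_zero]
    · rw [not_and_or] at h'
      rcases h' with h' | h'
      · rw [ampE_of_not_edge h', zero_mul]
      · rw [ampF_of_not_edge h', mul_zero]

end Resonant

/-! ### The poles of the eigenvalue -/

namespace Resonant

variable {q1 q2 q3 u : ℂ} {n r : ℕ} {a : Fin n → ℕ} {L : ℕ → ℤ} {j k N : ℕ}

/-- Two equal neighbours have supports with quotient `q₂`. -/
theorem support_succ (R : Resonant q1 q2 q3 n r) (hu : u ≠ 0) (h : L (k + 1) = L k) :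
    partSupport q1 q2 u L (k + 1) = q2 * partSupport q1 q2 u L k := by
  simpa using (R.support_eq_iff hu L L (k + 1) k 0 1).mpr ⟨0, by rw [h]; ring, by push_cast; ring⟩

/-- Where the gap condition is sharp, the supports have quotient `q₃`. -/
theorem support_add_n (R : Resonant q1 q2 q3 n r) (hu : u ≠ 0) (h : L k = L (k + n) + r) :
    partSupport q1 q2 u L (k + n) = q3 * partSupport q1 q2 u L k := by
  rw [R.q3_eq]
  exact (R.support_eq_iff hu L L (k + n) k (-1) (-1)).mpr
    ⟨1, by rw [h]; ring, by push_cast; ring⟩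

/-- Two poles of the eigenvalue coincide only if there are also two zeros at the same place. -/
theorem double_pole (R : Resonant q1 q2 q3 n r) (hu : u ≠ 0) (hL : IsAdm n r a L)
    (h : partSupport q1 q2 u L j = q1⁻¹ * partSupport q1 q2 u L k) :
    j = k + 1 + n ∧ partSupport q1 q2 u L j = q2 * partSupport q1 q2 u L (k + n) ∧
      partSupport q1 q2 u L j = q3 * partSupport q1 q2 u L (k + 1) := by
  obtain ⟨κ, h1, h2⟩ := (R.support_eq_iff hu L L j k (-1) 0).mp (by simpa using h)
  rw [show (1 - (r : ℤ)) * κ = κ - r * κ by ring] at h1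
  rw [show ((n : ℤ) + 1) * κ = n * κ + κ by ring] at h2
  rcases lt_trichotomy κ 0 with hκ | rfl | hκ
  · have := hL.gap (s := j) (t := k) (κ := -κ) (by omega) (by rw [mul_neg]; omega)
    rw [mul_neg] at this
    omega
  · simp only [mul_zero] at h1 h2
    obtain rfl : j = k := by omega
    omega
  · have := hL.gap (s := k) (t := j) (κ := κ) (by omega) (by omega)
    obtain rfl : κ = 1 := by omega
    obtain rfl : j = k + 1 + n := by omega
    have h3 := hL.gap_one k
    have h4 := hL.gap_one (k + 1)
    have h5 := hL.step k
    have h6 := hL.step (k + n)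
    rw [show k + n + 1 = k + 1 + n by ring] at h6
    refine ⟨rfl, ?_, R.support_add_n hu (by omega)⟩
    have := R.support_succ (k := k + n) hu (L := L) (by rw [show k + n + 1 = k + 1 + n by ring]; omega)
    rwa [show k + n + 1 = k + 1 + n by ring] at this

/-- At a place which is not addable the eigenvalue has a zero. -/
theorem zero_of_not_addable (R : Resonant q1 q2 q3 n r) (hu : u ≠ 0) (hL : IsAdm n r a L)
    (hj : j < N + n) (h : ¬ Edge n r a L j) :
    (∃ i < N + n, q2 * partSupport q1 q2 u L i = partSupport q1 q2 u L j) ∨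
      ∃ i < N, q3 * partSupport q1 q2 u L i = partSupport q1 q2 u L j := by
  rcases hL.not_add_box (fun h' => h ⟨hL, h'⟩) with ⟨i, rfl, hi⟩ | ⟨i, rfl, hi⟩
  · exact Or.inl ⟨i, by omega, (R.support_succ hu hi.symm).symm⟩
  · exact Or.inr ⟨i, by omega, (R.support_add_n hu hi).symm⟩

theorem q2_mul_q3 (R : Resonant q1 q2 q3 n r) : q2 * q3 = q1⁻¹ := by
  have := R.q1_ne_zero
  field_simp
  linear_combination R.mul_eq_one

/-- At a place which is not removable the eigenvalue has a zero. -/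
theorem zero_of_not_removable (R : Resonant q1 q2 q3 n r) (hu : u ≠ 0) (hL : IsAdm n r a L)
    (hN : ∀ t, N ≤ t + 1 → L t = vacuum n r a t) (hk : k < N) (h : ¬ IsAdm n r a (L - box k)) :
    (∃ i < N + n, q2 * partSupport q1 q2 u L i = q1⁻¹ * partSupport q1 q2 u L k) ∨
      ∃ i < N, q3 * partSupport q1 q2 u L i = q1⁻¹ * partSupport q1 q2 u L k := by
  have hn := R.two_le_n
  have h2 : L k = L (k + n) + r → ∃ i < N + n,
      q2 * partSupport q1 q2 u L i = q1⁻¹ * partSupport q1 q2 u L k := fun h' =>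
    ⟨k + n, by omega, by rw [R.support_add_n hu h', ← R.q2_mul_q3]; ring⟩
  by_cases hk' : k + 1 < N
  · rcases hL.not_sub_box (by omega) h with h' | h'
    · exact Or.inr ⟨k + 1, hk', by rw [R.support_succ hu h', ← R.q2_mul_q3]; ring⟩
    · exact Or.inl (h2 h')
  -- The last part `k = N - 1` has no `q₃`-zero beside it, but it belongs to the vacuum, where the
  -- gap condition is sharp.
  · refine Or.inl (h2 ?_)
    rw [hN k (by omega), hN (k + n) (by omega), vacuum_add_period (by omega)]
    ring

/-- The pole of an addable box is not cancelled. -/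
theorem edge_ne_zeros (R : Resonant q1 q2 q3 n r) (hu : u ≠ 0) (h : Edge n r a L j) (t : ℕ) :
    q2 * partSupport q1 q2 u L t ≠ partSupport q1 q2 u L j ∧
      q3 * partSupport q1 q2 u L t ≠ partSupport q1 q2 u L j := by
  have h0 := R.support_ne_zero hu L j
  by_cases ht : t = j
  · subst ht
    constructor
    · intro h'; exact R.q2_ne_one ((mul_eq_right₀ h0).mp h')
    · intro h'; exact R.q3_ne_one ((mul_eq_right₀ h0).mp h')
  · exact ⟨(R.good hu h ht).zero.symm, (R.good hu h ht).zero'.symm⟩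

theorem support_sub_box (R : Resonant q1 q2 q3 n r) (u : ℂ) (L : ℕ → ℤ) (k : ℕ) :
    q1⁻¹ * partSupport q1 q2 u L k = partSupport q1 q2 u (L - box k) k := by
  have h := support_add_box_self R.q1_ne_zero q2 u (L - box k) k
  rw [sub_add_cancel] at h
  rw [h, inv_mul_cancel_left₀ R.q1_ne_zero]

theorem support_sub_box_of_ne (q1 q2 u : ℂ) (L : ℕ → ℤ) {k t : ℕ} (h : t ≠ k) :
    partSupport q1 q2 u (L - box k) t = partSupport q1 q2 u L t := by
  have h := support_add_box_of_ne q1 q2 u (L - box k) h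
  rwa [sub_add_cancel, eq_comm] at h

/-- The pole of a removable box is not cancelled. -/
theorem removable_ne_zeros (R : Resonant q1 q2 q3 n r) (hu : u ≠ 0) (h : Edge n r a (L - box k) k)
    (t : ℕ) : q2 * partSupport q1 q2 u L t ≠ q1⁻¹ * partSupport q1 q2 u L k ∧
      q3 * partSupport q1 q2 u L t ≠ q1⁻¹ * partSupport q1 q2 u L k := by
  have h0 := R.support_ne_zero hu L k
  by_cases ht : t = k
  · subst ht
    rw [← R.q2_mul_q3]
    have h2 := R.q2_ne_zero
    have h3 := R.q3_ne_zero
    constructor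
    · intro h'
      apply R.q3_ne_one
      apply mul_left_cancel₀ (mul_ne_zero h2 h0)
      linear_combination -h'
    · intro h'
      apply R.q2_ne_one
      apply mul_left_cancel₀ (mul_ne_zero h3 h0)
      linear_combination -h'
  · rw [R.support_sub_box, ← support_sub_box_of_ne _ _ _ _ ht]
    exact ⟨(R.good hu h ht).zero.symm, (R.good hu h ht).zero'.symm⟩

theorem addable_ne_removable (R : Resonant q1 q2 q3 n r) (hu : u ≠ 0)
    (hk : Edge n r a (L - box k) k) :
    partSupport q1 q2 u L j ≠ q1⁻¹ * partSupport q1 q2 u L k := by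
  by_cases hjk : j = k
  · subst hjk
    intro h
    have h0 := R.support_ne_zero hu L j
    have := (mul_eq_right₀ h0).mp h.symm
    exact R.q1_ne_one (inv_eq_one.mp this)
  · rw [R.support_sub_box, ← support_sub_box_of_ne _ _ _ _ hjk]
    exact (R.good hu hk hjk).pole.symm

end Resonant

open scoped Classical in
/-- The poles of the eigenvalue of `ψ(z)`: the supports of the addable boxes among the first `N + n`
places and of the removable boxes among the first `N` places. -/
def poles (q1 q2 u : ℂ) (n r : ℕ) (a : Fin n → ℕ) (L : ℕ → ℤ) (N : ℕ) : Finset ℂ :=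
  ((range (N + n)).filter (Edge n r a L)).image (partSupport q1 q2 u L) ∪
    ((range N).filter fun k => Edge n r a (L - box k) k).image
      fun k => q1⁻¹ * partSupport q1 q2 u L k

namespace Resonant

variable {q1 q2 q3 u : ℂ} {n r : ℕ} {a : Fin n → ℕ} {L : ℕ → ℤ} {j k N : ℕ}

/-- The partial fractions of the eigenvalue. All its poles are simple after cancellation, and they
are the points of `poles`. The constant terms are fixed by the values `1` at `z = ∞` and `c₀` at
`z = 0`. -/
theorem exists_poles (R : Resonant q1 q2 q3 n r) (hu : u ≠ 0) (hL : IsAdm n r a L)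
    (hN : ∀ t, N ≤ t + 1 → L t = vacuum n r a t) :
    ∃ (c₀ : ℂ) (c : ℂ → ℂ), c₀ ≠ 0 ∧ c₀ + ∑ p ∈ poles q1 q2 u n r a L N, c p = 1 ∧
      ∀ z : RatFunc ℂ, IsGeneric z → fatPsi q1 q3 q2 u n r a L z =
        RatFunc.C c₀ + ∑ p ∈ poles q1 q2 u n r a L N, RatFunc.C (c p) / lin p z := by
  classical
  have hn := R.two_le_n
  set x := partSupport q1 q2 u L with hx
  have hx0 : ∀ t, x t ≠ 0 := R.support_ne_zero hu L
  have hinj : Function.Injective x := R.support_injective hu hL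
  have h1 := R.q1_ne_zero
  have h2 := R.q2_ne_zero
  have h3 := R.q3_ne_zero
  have i1 : Function.Injective fun t => q1⁻¹ * x t :=
    (mul_right_injective₀ (inv_ne_zero h1)).comp hinj
  -- Before cancellation, the poles `x_t`, `q₁⁻¹ x_t` and the zeros `q₂ x_t`, `q₃ x_t` come from the
  -- first `N` parts, and `x_t`, `q₂ x_t` with `N ≤ t < N + n` from the vacuum factors.
  set P1 : Multiset ℂ := (range (N + n)).val.map x with hP1
  set P2 : Multiset ℂ := (range N).val.map fun t => q1⁻¹ * x t with hP2
  set Z1 : Multiset ℂ := (range (N + n)).val.map fun t => q2 * x t with hZ1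
  set Z2 : Multiset ℂ := (range N).val.map fun t => q3 * x t with hZ2
  have mP1 : ∀ p, p ∈ P1 ↔ ∃ t < N + n, x t = p := by simp [hP1]
  have mP2 : ∀ p, p ∈ P2 ↔ ∃ t < N, q1⁻¹ * x t = p := by simp [hP2]
  have mZ1 : ∀ p, p ∈ Z1 ↔ ∃ t < N + n, q2 * x t = p := by simp [hZ1]
  have mZ2 : ∀ p, p ∈ Z2 ↔ ∃ t < N, q3 * x t = p := by simp [hZ2]
  have cP1 : ∀ p, P1.count p ≤ 1 :=
    Multiset.nodup_iff_count_le_one.mp ((range (N + n)).nodup.map hinj)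
  have cP2 : ∀ p, P2.count p ≤ 1 :=
    Multiset.nodup_iff_count_le_one.mp ((range N).nodup.map i1)
  have double : ∀ p, p ∈ P1 → p ∈ P2 → 1 ≤ Z1.count p ∧ 1 ≤ Z2.count p := by
    intro p hp1 hp2
    obtain ⟨j, hj, rfl⟩ := (mP1 p).mp hp1
    obtain ⟨k, hk, hjk⟩ := (mP2 _).mp hp2
    obtain ⟨e, e1, e2⟩ := R.double_pole hu hL hjk.symm
    rw [Multiset.one_le_count_iff_mem, Multiset.one_le_count_iff_mem]
    exact ⟨(mZ1 _).mpr ⟨k + n, by omega, e1.symm⟩, (mZ2 _).mpr ⟨k + 1, by omega, e2.symm⟩⟩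
  -- A double pole is cancelled completely by the zeros that `double` provides.
  have hcount : ∀ p, (P1 + P2).count p ≤ (Z1 + Z2).count p + 1 := by
    intro p
    rw [Multiset.count_add, Multiset.count_add]
    have a1 := cP1 p
    have a2 := cP2 p
    by_cases b1 : p ∈ P1
    · by_cases b2 : p ∈ P2
      · have := double p b1 b2; omega
      · have := Multiset.count_eq_zero.mpr b2; omega
    · have := Multiset.count_eq_zero.mpr b1; omega
  have hS : ((P1 + P2) - (Z1 + Z2)).toFinset = poles q1 q2 u n r a L N := by
    ext p
    rw [Multiset.mem_toFinset, ← Multiset.count_pos, Multiset.count_sub, tsub_pos_iff_lt,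
      Multiset.count_add, Multiset.count_add, poles, mem_union, mem_image, mem_image]
    simp only [mem_filter, mem_range]
    have a1 := cP1 p
    have a2 := cP2 p
    constructor
    · intro hlt
      by_cases b1 : p ∈ P1
      · by_cases b2 : p ∈ P2
        · have := double p b1 b2; omega
        · left
          have b3 := Multiset.count_eq_zero.mpr b2
          obtain ⟨j, hj, rfl⟩ := (mP1 p).mp b1
          refine ⟨j, ⟨hj, ?_⟩, rfl⟩
          by_contra hcon
          rcases R.zero_of_not_addable hu hL hj hcon with h | h
          · have : 1 ≤ Z1.count (x j) := Multiset.one_le_count_iff_mem.mpr ((mZ1 _).mpr h)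
            omega
          · have : 1 ≤ Z2.count (x j) := Multiset.one_le_count_iff_mem.mpr ((mZ2 _).mpr h)
            omega
      · right
        have b3 := Multiset.count_eq_zero.mpr b1
        have b2 : p ∈ P2 := Multiset.one_le_count_iff_mem.mp (by omega)
        obtain ⟨k, hk, rfl⟩ := (mP2 p).mp b2
        refine ⟨k, ⟨hk, ?_, by rwa [sub_add_cancel]⟩, rfl⟩
        by_contra hcon
        rcases R.zero_of_not_removable hu hL hN hk hcon with h | h
        · have : 1 ≤ Z1.count (q1⁻¹ * x k) := Multiset.one_le_count_iff_mem.mpr ((mZ1 _).mpr h)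
          omega
        · have : 1 ≤ Z2.count (q1⁻¹ * x k) := Multiset.one_le_count_iff_mem.mpr ((mZ2 _).mpr h)
          omega
    · have nz : (∀ t, q2 * x t ≠ p ∧ q3 * x t ≠ p) → Z1.count p = 0 ∧ Z2.count p = 0 := by
        intro h
        rw [Multiset.count_eq_zero, Multiset.count_eq_zero, mZ1, mZ2]
        exact ⟨fun ⟨t, _, ht⟩ => (h t).1 ht, fun ⟨t, _, ht⟩ => (h t).2 ht⟩
      rintro (⟨j, ⟨hj, hje⟩, hp⟩ | ⟨k, ⟨hk, hke⟩, hp⟩)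
      · have := nz (by rw [← hp]; exact R.edge_ne_zeros hu hje)
        have : 1 ≤ P1.count p := Multiset.one_le_count_iff_mem.mpr ((mP1 _).mpr ⟨j, hj, hp⟩)
        omega
      · have := nz (by rw [← hp]; exact R.removable_ne_zeros hu hke)
        have : 1 ≤ P2.count p := Multiset.one_le_count_iff_mem.mpr ((mP2 _).mpr ⟨k, hk, hp⟩)
        omega
  obtain ⟨c₀, c, hc0, hc1, hc⟩ := exists_partial_fractions_multiset (Z1 + Z2) (P1 + P2)
    (by
      rw [Multiset.mem_add, mZ1, mZ2]
      rintro (⟨t, _, ht⟩ | ⟨t, _, ht⟩)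
      · exact mul_ne_zero h2 (hx0 t) ht
      · exact mul_ne_zero h3 (hx0 t) ht)
    (by
      rw [Multiset.mem_add, mP1, mP2]
      rintro (⟨t, _, ht⟩ | ⟨t, _, ht⟩)
      · exact hx0 t ht
      · exact mul_ne_zero (inv_ne_zero h1) (hx0 t) ht)
    (by simp [hP1, hP2, hZ1, hZ2]) hcount
  rw [hS] at hc1 hc
  refine ⟨c₀, c, hc0, hc1, fun z hz => ?_⟩
  have key := hc (RatFunc ℂ) z⁻¹
  have hlin : ∀ p : ℂ, 1 - RatFunc.C p * z⁻¹ = lin p z := fun p => by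
    rw [lin, div_eq_mul_inv]
  simp only [RatFunc.algebraMap_eq_C, hlin] at key
  rw [← key fun p _ => hz p, R.fatPsi_eq hz (N := N) fun t ht => hN t (by omega)]
  have hvac : vacPhi q1 q2 u n r a N z =
      ∏ m ∈ range n, phi q2 (x (N + m)) z :=
    prod_congr rfl fun m _ => by
      rw [hx, partSupport, partSupport, hN (N + m) (by omega)]
  rw [hvac, Multiset.map_add, Multiset.map_add, Multiset.prod_add, Multiset.prod_add]
  simp only [hP1, hP2, hZ1, hZ2, Multiset.map_map, Function.comp_def]
  change _ = ((∏ t ∈ range (N + n), lin (q2 * x t) z) * ∏ t ∈ range N, lin (q3 * x t) z) /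
    ((∏ t ∈ range (N + n), lin (x t) z) * ∏ t ∈ range N, lin (q1⁻¹ * x t) z)
  simp only [hfun, phi, prod_div_distrib, prod_mul_distrib, prod_range_add]
  rw [div_mul_div_comm]
  congr 1 <;> ring

end Resonant

/-! ### Residues and the commutator of the two half currents -/

theorem lin_X_eval_self {v : ℂ} (c : ℂ) (hv : v ≠ 0) : EvalsTo (lin (c * v) RatFunc.X) v (1 - c) := by
  have := EvalsTo.lin_X (c * v) hv
  rwa [mul_div_assoc, div_self hv, mul_one] at this

/-- The coefficients of a partial fraction decomposition are residues. -/
theorem eq_residue {R : RatFunc ℂ} {S : Finset ℂ} {c₀ w v : ℂ} {c : ℂ → ℂ}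
    (hR : R = RatFunc.C c₀ + ∑ p ∈ S, RatFunc.C (c p) / lin p RatFunc.X) (hvS : v ∈ S) (hv : v ≠ 0)
    (h : EvalsTo (lin v RatFunc.X * R) v w) : c v = w := by
  have h1 : lin v RatFunc.X * R = lin v RatFunc.X * (RatFunc.C c₀ +
      ∑ p ∈ S.erase v, RatFunc.C (c p) / lin p RatFunc.X) + RatFunc.C (c v) := by
    rw [hR, ← add_sum_erase S _ hvS]
    have := isGeneric_X v
    field_simp
    ring
  have h2 : EvalsTo (lin v RatFunc.X) v 0 := by
    have := lin_X_eval_self 1 hv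
    rwa [one_mul, sub_self] at this
  have h3 : EvalsTo (∑ p ∈ S.erase v, RatFunc.C (c p) / lin p RatFunc.X) v
      (∑ p ∈ S.erase v, c p / (1 - p / v)) :=
    EvalsTo.sum fun p hp => (EvalsTo.const _ _).div (EvalsTo.lin_X _ hv)
      (Good.one_sub_ne_zero hv (ne_of_mem_erase hp).symm)
  have h4 := (h2.mul ((EvalsTo.const c₀ v).add h3)).add (EvalsTo.const (c v) v)
  rw [← h1, zero_mul, zero_add] at h4
  exact h4.unique h

section Residues

variable {q1 q2 q3 u : ℂ} {n r : ℕ} {a : Fin n → ℕ} {L : ℕ → ℤ} {j k N : ℕ}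

namespace Resonant

theorem evalsTo_fatPsi_div (R : Resonant q1 q2 q3 n r) (hu : u ≠ 0) (h : Edge n r a L j) :
    EvalsTo (fatPsi q1 q3 q2 u n r a L RatFunc.X /
      hfun q1 q2 q3 (partSupport q1 q2 u L j) RatFunc.X) (partSupport q1 q2 u L j)
      (resid q1 q2 q3 u n r a L j) := by
  obtain ⟨N, hN⟩ := h.1.2.2
  have h1 : ∀ t ≥ N + j + 1, L t = vacuum n r a t := fun t ht => hN t (by omega)
  rw [R.resid_eq hu h h1 (by omega)]
  exact R.evalsTo_resid hu h h1 (by omega)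

theorem one_sub_q1_inv_ne_zero (R : Resonant q1 q2 q3 n r) : 1 - q1⁻¹ ≠ 0 :=
  sub_ne_zero.mpr fun h => R.q1_ne_one (inv_eq_one.mp h.symm)

/-- The residue of the eigenvalue at an addable box. -/
theorem residue_addable (R : Resonant q1 q2 q3 n r) (hu : u ≠ 0) (h : Edge n r a L j) :
    EvalsTo (lin (partSupport q1 q2 u L j) RatFunc.X * fatPsi q1 q3 q2 u n r a L RatFunc.X)
      (partSupport q1 q2 u L j)
      (resid q1 q2 q3 u n r a L j * ((1 - q2) * (1 - q3) / (1 - q1⁻¹))) := by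
  have hv := R.support_ne_zero hu L j
  have h1 := R.evalsTo_fatPsi_div hu h
  have h2 := ((lin_X_eval_self q2 hv).mul (lin_X_eval_self q3 hv)).div (lin_X_eval_self q1⁻¹ hv)
    R.one_sub_q1_inv_ne_zero
  convert h1.mul h2 using 1
  have g0 : hfun q1 q2 q3 (partSupport q1 q2 u L j) RatFunc.X ≠ 0 := hfun_ne_zero isGeneric_X
  rw [div_mul_eq_mul_div, eq_div_iff g0, mul_comm (lin _ _), mul_assoc]
  congr 1
  unfold hfun
  have g1 := isGeneric_X (partSupport q1 q2 u L j)
  generalize lin (partSupport q1 q2 u L j) RatFunc.X = A at *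
  field_simp

/-- The residue of the eigenvalue at a removable box; away from the part `k` itself, the factors are
those of `L - 1_k`. -/
theorem residue_removable (R : Resonant q1 q2 q3 n r) (hu : u ≠ 0) (h : Edge n r a (L - box k) k) :
    EvalsTo (lin (q1⁻¹ * partSupport q1 q2 u L k) RatFunc.X * fatPsi q1 q3 q2 u n r a L RatFunc.X)
      (q1⁻¹ * partSupport q1 q2 u L k)
      (resid q1 q2 q3 u n r a (L - box k) k * ((1 - q2 * q1) * (1 - q3 * q1) / (1 - q1))) := by
  obtain ⟨M, rfl⟩ : ∃ M, L = M + box k := ⟨L - box k, by abel⟩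
  rw [add_sub_cancel_right] at h ⊢
  rw [support_add_box_self R.q1_ne_zero, inv_mul_cancel_left₀ R.q1_ne_zero]
  have hv := R.support_ne_zero hu M k
  have h1 := R.evalsTo_fatPsi_div hu h
  have h2 := ((lin_X_eval_self (q2 * q1) hv).mul (lin_X_eval_self (q3 * q1) hv)).div
    (lin_X_eval_self q1 hv) R.one_sub_q1_ne_zero
  convert h1.mul h2 using 1
  have h3 := R.fatPsi_add_box (u := u) isGeneric_X h.1 k
  have g0 : hfun q1 q2 q3 (partSupport q1 q2 u M k) RatFunc.X ≠ 0 := hfun_ne_zero isGeneric_X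
  rw [div_mul_eq_mul_div, eq_div_iff g0, mul_assoc, h3, mul_left_comm]
  congr 1
  unfold hfun
  rw [inv_mul_cancel_left₀ R.q1_ne_zero, mul_assoc q2, mul_assoc q3]
  have g1 := isGeneric_X (partSupport q1 q2 u M k)
  generalize lin (partSupport q1 q2 u M k) RatFunc.X = A at *
  field_simp

/-- The sum over all boxes on the side of the commutator of `e(z)` and `f(w)`, and the expansions of
the eigenvalue of `ψ(z)`. -/
theorem exists_expansion (R : Resonant q1 q2 q3 n r) (hu : u ≠ 0) (hL : IsAdm n r a L) :
    ∃ (c₀ : ℂ) (s : ℤ → ℂ), c₀ ≠ 0 ∧ c₀ + s 0 = 1 ∧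
      (∀ m, coeffInf (fatPsi q1 q3 q2 u n r a L) m =
        (if m = 0 then c₀ else 0) + if 0 ≤ m then s m else 0) ∧
      (∀ m, coeffZero (fatPsi q1 q3 q2 u n r a L) m =
        (if m = 0 then c₀ else 0) - if m < 0 then s m else 0) ∧
      ∀ m, ∑ᶠ j, ampE q1 q2 q3 u n r a (L - box j) j * ampF q1 q2 q3 u n r a (L - box j) j *
          partSupport q1 q2 u (L - box j) j ^ m -
        ∑ᶠ j, ampE q1 q2 q3 u n r a L j * ampF q1 q2 q3 u n r a L j * partSupport q1 q2 u L j ^ m =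
          ((1 - q1) * (1 - q2) * (1 - q3))⁻¹ * s m := by
  classical
  have hn := R.two_le_n
  obtain ⟨N₀, hN₀⟩ := hL.2.2
  obtain ⟨N, hN⟩ : ∃ N, ∀ t, N ≤ t + 1 → L t = vacuum n r a t :=
    ⟨N₀ + 1, fun t ht => hN₀ t (by omega)⟩
  have hN' : ∀ t ≥ N, L t = vacuum n r a t := fun t ht => hN t (by omega)
  obtain ⟨c₀, c, hc0, hc1, hc⟩ := R.exists_poles hu hL hN
  have h0S : (0 : ℂ) ∉ poles q1 q2 u n r a L N := by
    simp only [poles, mem_union, mem_image, not_or, not_exists, not_and]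
    exact ⟨fun j _ => R.support_ne_zero hu L j, fun j _ =>
      mul_ne_zero (inv_ne_zero R.q1_ne_zero) (R.support_ne_zero hu L j)⟩
  refine ⟨c₀, fun m => ∑ p ∈ poles q1 q2 u n r a L N, c p * p ^ m, hc0, by simpa using hc1,
    coeffInf_partial_fractions (hc _ isGeneric_X_inv),
    coeffZero_partial_fractions h0S (hc _ isGeneric_X), fun m => ?_⟩
  set A := (range (N + n)).filter (Edge n r a L) with hA
  set B := (range N).filter fun k => Edge n r a (L - box k) k with hB
  have memA : ∀ j, Edge n r a L j → j ∈ A := fun j hj =>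
    mem_filter.mpr ⟨mem_range.mpr (IsAdm.addable_lt (by omega) hN' hj.2), hj⟩
  have memB : ∀ j, Edge n r a (L - box j) j → j ∈ B := fun j hj =>
    mem_filter.mpr ⟨mem_range.mpr (IsAdm.removable_lt (L := L - box j) (by omega)
      (fun i hi => by rw [sub_add_cancel]; exact hN' i hi) hj.1), hj⟩
  have hdisj : Disjoint (A.image (partSupport q1 q2 u L))
      (B.image fun k => q1⁻¹ * partSupport q1 q2 u L k) := by
    rw [disjoint_left]
    intro p hp hp'
    obtain ⟨j, hj, rfl⟩ := mem_image.mp hp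
    obtain ⟨k, hk, hjk⟩ := mem_image.mp hp'
    exact R.addable_ne_removable hu (mem_filter.mp hk).2 hjk.symm
  have hpoles : poles q1 q2 u n r a L N = A.image (partSupport q1 q2 u L) ∪
      B.image fun k => q1⁻¹ * partSupport q1 q2 u L k := by
    rw [poles]
  have hinj := R.support_injective hu hL
  have hinj' : Function.Injective fun k => q1⁻¹ * partSupport q1 q2 u L k :=
    (mul_right_injective₀ (inv_ne_zero R.q1_ne_zero)).comp hinj
  rw [finsum_eq_sum_of_support_subset (s := B) _ fun j hj =>
      memB j (edge_of_ampE_ne_zero (left_ne_zero_of_mul (left_ne_zero_of_mul hj))),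
    finsum_eq_sum_of_support_subset (s := A) _ fun j hj =>
      memA j (edge_of_ampE_ne_zero (left_ne_zero_of_mul (left_ne_zero_of_mul hj))),
    hpoles]
  dsimp only
  rw [sum_union hdisj, sum_image fun _ _ _ _ h => hinj h, sum_image fun _ _ _ _ h => hinj' h,
    mul_add, mul_sum, mul_sum, sub_eq_add_neg, add_comm, ← sum_neg_distrib]
  have g1 := R.one_sub_q1_ne_zero
  have g2 : 1 - q2 ≠ 0 := sub_ne_zero.mpr (Ne.symm R.q2_ne_one)
  have g3 : 1 - q3 ≠ 0 := sub_ne_zero.mpr (Ne.symm R.q3_ne_one)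
  have k1 := R.q1_ne_zero
  have k2 := R.q2_ne_zero
  have k3 := R.q3_ne_zero
  congr 1
  · refine sum_congr rfl fun j hj => ?_
    have he : Edge n r a L j := (mem_filter.mp hj).2
    rw [eq_residue (hc _ isGeneric_X) (mem_union_left _ (mem_image_of_mem _ hj))
      (R.support_ne_zero hu L j) (R.residue_addable hu he), R.ampE_mul_ampF hu he]
    have g4 := R.one_sub_q1_inv_ne_zero
    have g5 : 1 - q1⁻¹ = -(1 - q1) / q1 := by field_simp; ring
    rw [g5]
    field_simp
  · refine sum_congr rfl fun j hj => ?_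
    have he : Edge n r a (L - box j) j := (mem_filter.mp hj).2
    have hmem : q1⁻¹ * partSupport q1 q2 u L j ∈ poles q1 q2 u n r a L N :=
      mem_union_right _ (mem_image_of_mem (fun k => q1⁻¹ * partSupport q1 q2 u L k) hj)
    rw [eq_residue (hc _ isGeneric_X) hmem
      (mul_ne_zero (inv_ne_zero k1) (R.support_ne_zero hu L j)) (R.residue_removable hu he),
      R.ampE_mul_ampF hu he, ← R.support_sub_box]
    have e1 : (1 - q2 * q1) * (1 - q3 * q1) = q1 * ((1 - q2) * (1 - q3)) := by
      linear_combination (q1 - 1) * R.mul_eq_one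
    rw [e1]
    field_simp

end Resonant

open scoped Classical in
/-- The expansion coefficients of the eigenvalue of `ψ⁺(z)` on the semi-infinite module, with the
value `1` for the eigenvalue on sequences which are not admissible. -/
def ladderPsiP (q1 q2 q3 u : ℂ) (n r : ℕ) (a : Fin n → ℕ) (L : ℕ → ℤ) (i : ℤ) : ℂ :=
  if IsAdm n r a L then coeffInf (fatPsi q1 q3 q2 u n r a L) i else if i = 0 then 1 else 0

open scoped Classical in
/-- The expansion coefficients of the eigenvalue of `ψ⁻(z)` on the semi-infinite module, with the
value `1` for the eigenvalue on sequences which are not admissible. -/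
def ladderPsiM (q1 q2 q3 u : ℂ) (n r : ℕ) (a : Fin n → ℕ) (L : ℕ → ℤ) (i : ℤ) : ℂ :=
  if IsAdm n r a L then coeffZero (fatPsi q1 q3 q2 u n r a L) i else if i = 0 then 1 else 0

/-- Adding a box changes the eigenvalue by the quotient of the structure functions `g(z, v)` and
`g(v, z)`. -/
theorem Resonant.fatPsi_add_box_cubic (R : Resonant q1 q2 q3 n r) {y z : RatFunc ℂ}
    (hy : y = z⁻¹) (hz : IsGeneric z) (hL : IsAdm n r a L) (j : ℕ) :
    (1 - RatFunc.C ((q1 + q2 + q3) * partSupport q1 q2 u L j) * y +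
        RatFunc.C ((q1 * q2 + q1 * q3 + q2 * q3) * partSupport q1 q2 u L j ^ 2) * y ^ 2 -
        RatFunc.C (partSupport q1 q2 u L j ^ 3) * y ^ 3) *
          fatPsi q1 q3 q2 u n r a (L + box j) z =
      (1 - RatFunc.C ((q1 * q2 + q1 * q3 + q2 * q3) * partSupport q1 q2 u L j) * y +
        RatFunc.C ((q1 + q2 + q3) * partSupport q1 q2 u L j ^ 2) * y ^ 2 -
        RatFunc.C (partSupport q1 q2 u L j ^ 3) * y ^ 3) *
          fatPsi q1 q3 q2 u n r a L z := by
  set x := partSupport q1 q2 u L j with hx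
  have hp : RatFunc.C q1 * RatFunc.C q2 * RatFunc.C q3 = (1 : RatFunc ℂ) := by
    rw [← map_mul, ← map_mul, R.mul_eq_one, map_one]
  have j1 : q1⁻¹ = q2 * q3 := R.q2_mul_q3.symm
  have j2 : q2⁻¹ = q1 * q3 := by
    have := R.q2_ne_zero
    field_simp
    linear_combination -R.mul_eq_one
  have j3 : q3⁻¹ = q1 * q2 := by
    have := R.q3_ne_zero
    field_simp
    linear_combination -R.mul_eq_one
  have l1 : 1 - RatFunc.C ((q1 + q2 + q3) * x) * y +
        RatFunc.C ((q1 * q2 + q1 * q3 + q2 * q3) * x ^ 2) * y ^ 2 - RatFunc.C (x ^ 3) * y ^ 3 =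
      lin (q1 * x) z * lin (q2 * x) z * lin (q3 * x) z := by
    simp only [lin, div_eq_mul_inv, ← hy, map_mul, map_add, map_pow]
    linear_combination (RatFunc.C x ^ 3 * y ^ 3) * hp
  have l2 : 1 - RatFunc.C ((q1 * q2 + q1 * q3 + q2 * q3) * x) * y +
        RatFunc.C ((q1 + q2 + q3) * x ^ 2) * y ^ 2 - RatFunc.C (x ^ 3) * y ^ 3 =
      lin (q1⁻¹ * x) z * lin (q2⁻¹ * x) z * lin (q3⁻¹ * x) z := by
    rw [j1, j2, j3]
    simp only [lin, div_eq_mul_inv, ← hy, map_mul, map_add, map_pow]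
    linear_combination ((1 + RatFunc.C q1 * RatFunc.C q2 * RatFunc.C q3) * RatFunc.C x ^ 3 * y ^ 3 -
      (RatFunc.C q1 + RatFunc.C q2 + RatFunc.C q3) * RatFunc.C x ^ 2 * y ^ 2) * hp
  rw [l1, l2]
  have h1 := R.fatPsi_add_box (u := u) hz hL j
  have h2 := hfun_shift (x := x) R.mul_eq_one hz
  apply mul_right_cancel₀ (hfun_ne_zero (q1 := q1) (q2 := q2) (q3 := q3) (x := x) hz)
  rw [← hx] at h1
  linear_combination (lin (q1 * x) z * lin (q2 * x) z * lin (q3 * x) z) * h1 +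
    fatPsi q1 q3 q2 u n r a L z * h2

/-- The matrix coefficients of the semi-infinite module define a ladder representation. -/
theorem Resonant.isLadder (R : Resonant q1 q2 q3 n r) (hu : u ≠ 0) (a : Fin n → ℕ) :
    IsLadder q1 q2 q3 (IsAdm n r a) (ampE q1 q2 q3 u n r a) (ampF q1 q2 q3 u n r a)
      (partSupport q1 q2 u) (ladderPsiP q1 q2 q3 u n r a) (ladderPsiM q1 q2 q3 u n r a) where
  mul_eq_one := R.mul_eq_one
  halfE := R.halfCurrent_ampE hu
  halfF := R.halfCurrent_ampF hu
  edgeE L j h := edge_of_ampE_ne_zero h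
  edgeF L j h := edge_of_ampF_ne_zero h
  off_diag L j k hjk := R.amp_off_diag hu L hjk
  diag L m := by
    by_cases hL : IsAdm n r a L
    · obtain ⟨c₀, s, -, -, h1, h2, h3⟩ := R.exists_expansion hu hL
      rw [ladderPsiP, ladderPsiM, if_pos hL, if_pos hL, h1, h2, h3]
      congr 1
      rcases lt_or_ge m 0 with hm | hm
      · rw [if_neg (not_le.mpr hm), if_pos hm]; ring
      · rw [if_neg (not_lt.mpr hm), if_pos hm]; ring
    · have e1 : ∀ j, ampE q1 q2 q3 u n r a (L - box j) j = 0 := fun j =>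
        ampE_of_not_edge fun h => hL (by have := h.2; rwa [sub_add_cancel] at this)
      have e2 : ∀ j, ampE q1 q2 q3 u n r a L j = 0 := fun j => ampE_of_not_edge fun h => hL h.1
      simp only [e1, e2, ladderPsiP, ladderPsiM, if_neg hL]
      simp
  psiP_rec L j hL hL' i := by
    simp only [ladderPsiP, if_pos hL, if_pos hL']
    exact coeffInf_recursion (R.fatPsi_add_box_cubic (inv_inv _).symm isGeneric_X_inv hL j) i
  psiM_rec L j hL hL' i := by
    simp only [ladderPsiM, if_pos hL, if_pos hL']
    exact coeffZero_recursion (R.fatPsi_add_box_cubic rfl isGeneric_X hL j) i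
  psiP_neg L i hi := by
    by_cases hL : IsAdm n r a L
    · obtain ⟨c₀, s, -, -, h1, -⟩ := R.exists_expansion hu hL
      rw [ladderPsiP, if_pos hL, h1, if_neg hi.ne, if_neg (not_le.mpr hi), add_zero]
    · rw [ladderPsiP, if_neg hL, if_neg hi.ne]
  psiM_pos L i hi := by
    by_cases hL : IsAdm n r a L
    · obtain ⟨c₀, s, -, -, -, h2, -⟩ := R.exists_expansion hu hL
      rw [ladderPsiM, if_pos hL, h2, if_neg hi.ne', if_neg (not_lt.mpr hi.le), sub_zero]
    · rw [ladderPsiM, if_neg hL, if_neg hi.ne']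
  psiP_zero L := by
    by_cases hL : IsAdm n r a L
    · obtain ⟨c₀, s, -, hs, h1, -⟩ := R.exists_expansion hu hL
      rw [ladderPsiP, if_pos hL, h1, if_pos rfl, if_pos le_rfl, hs]
      exact one_ne_zero
    · rw [ladderPsiP, if_neg hL, if_pos rfl]
      exact one_ne_zero
  psiM_zero L := by
    by_cases hL : IsAdm n r a L
    · obtain ⟨c₀, s, h0, -, -, h2, -⟩ := R.exists_expansion hu hL
      rw [ladderPsiM, if_pos hL, h2, if_pos rfl, if_neg (lt_irrefl 0), sub_zero]
      exact h0
    · rw [ladderPsiM, if_neg hL, if_pos rfl]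
      exact one_ne_zero

end Residues

/-! ### Functions on admissible sequences -/

theorem amp_union {q1 q2 q3 u : ℂ} {L : ℕ → ℤ} {j : ℕ} {T T' W W' : Finset ℕ} (hT : Disjoint T T')
    (hW : Disjoint W W') : amp q1 q2 q3 u (T ∪ T') (W ∪ W') L j =
      amp q1 q2 q3 u T W L j * amp q1 q2 q3 u T' W' L j := by
  unfold amp
  rw [prod_union hT, prod_union hW]
  ring

section Degree

variable {n r : ℕ} {a : Fin n → ℕ}

/-- The size of `L` relative to the vacuum. -/
def seqDeg (n r : ℕ) (a : Fin n → ℕ) (L : ℕ → ℤ) : ℤ := ∑ᶠ j, (L j - vacuum n r a j)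

theorem IsAdm.finite_ne {L : ℕ → ℤ} (h : IsAdm n r a L) :
    (Function.support fun j => L j - vacuum n r a j).Finite := by
  obtain ⟨N, hN⟩ := h.2.2
  refine (Set.finite_lt_nat N).subset fun j hj => ?_
  by_contra hcon
  exact hj (sub_eq_zero.mpr (hN j (not_lt.mp hcon)))

theorem IsAdm.seqDeg_add_box {L : ℕ → ℤ} (h : IsAdm n r a L) (j : ℕ) :
    seqDeg n r a (L + box j) = seqDeg n r a L + 1 := by
  have h1 : (Function.support (box j)).Finite :=
    (Set.finite_singleton j).subset fun i hi => by
      by_contra hcon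
      exact hi (by rw [box_apply, if_neg (show i ≠ j from hcon)])
  have h2 : ∑ᶠ i, box j i = 1 := by
    rw [finsum_eq_single _ j fun i hi => by rw [box_apply, if_neg hi], box_apply, if_pos rfl]
  rw [seqDeg, seqDeg, ← h2, ← finsum_add_distrib h.finite_ne h1]
  exact finsum_congr fun i => by rw [Pi.add_apply]; ring

/-- The vacuum is the least admissible sequence: the gap condition can be followed into the region
where `L` is the vacuum. -/
theorem IsAdm.vacuum_le (hn : 0 < n) {L : ℕ → ℤ} (h : IsAdm n r a L) (j : ℕ) :
    vacuum n r a j ≤ L j := by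
  obtain ⟨N, hN⟩ := h.2.2
  have h1 : ∀ κ : ℕ, vacuum n r a (j + n * κ) = vacuum n r a j - r * κ := by
    intro κ
    induction κ with
    | zero => simp
    | succ κ ih => rw [mul_add, mul_one, ← add_assoc, vacuum_add_period hn, ih]; push_cast; ring
  have h2 := h.gap (s := j) (t := j + n * N) (κ := N) (by omega) (by push_cast; omega)
  rw [hN _ (le_trans (Nat.le_mul_of_pos_left N hn) (Nat.le_add_left _ _)), h1] at h2
  omega

theorem IsAdm.seqDeg_nonneg (hn : 0 < n) {L : ℕ → ℤ} (h : IsAdm n r a L) : 0 ≤ seqDeg n r a L :=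
  finsum_nonneg fun j => sub_nonneg.mpr (h.vacuum_le hn j)

open scoped Classical in
/-- The product of the weights `κ` along a path of length at most `d` that ends in `L`. The path is
chosen backwards, by removing boxes as long as there are removable ones. -/
def pathWeight (n r : ℕ) (a : Fin n → ℕ) (κ : (ℕ → ℤ) → ℕ → ℂ) : ℕ → (ℕ → ℤ) → ℂ
  | 0, _ => 1
  | d + 1, L => if h : ∃ j, Edge n r a (L - box j) j then
      pathWeight n r a κ d (L - box h.choose) * κ (L - box h.choose) h.choose else 1

theorem exists_pathWeight_succ {κ : (ℕ → ℤ) → ℕ → ℂ} {L : ℕ → ℤ} {j : ℕ}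
    (hj : Edge n r a (L - box j) j) (d : ℕ) : ∃ k, Edge n r a (L - box k) k ∧
      pathWeight n r a κ (d + 1) L = pathWeight n r a κ d (L - box k) * κ (L - box k) k := by
  have h : ∃ i, Edge n r a (L - box i) i := ⟨j, hj⟩
  exact ⟨h.choose, h.choose_spec, by rw [pathWeight, dif_pos h]⟩

/-- Weights on the edges which commute around squares come from a function on the vertices, the
weights of arbitrary paths from below. Independence of the path is proved by induction on the degree:
two different edges into the same vertex complete to a square, and the two lower edges of the square
are covered by the induction hypothesis. -/
theorem exists_potential (hn : 0 < n) (κ : (ℕ → ℤ) → ℕ → ℂ)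
    (hκ : ∀ L j, Edge n r a L j → κ L j ≠ 0)
    (hsq : ∀ L j k, j ≠ k → Edge n r a L j → Edge n r a L k → Edge n r a (L + box j) k →
      Edge n r a (L + box k) j → κ L j * κ (L + box j) k = κ L k * κ (L + box k) j) :
    ∃ c : (ℕ → ℤ) → ℂ, (∀ L, c L ≠ 0) ∧ ∀ L j, Edge n r a L j → c (L + box j) = c L * κ L j := by
  have hne : ∀ d L, pathWeight n r a κ d L ≠ 0 := by
    intro d
    induction d with
    | zero => intro L; exact one_ne_zero
    | succ d ih =>
      intro L
      rw [pathWeight]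
      split_ifs with h
      · exact mul_ne_zero (ih _) (hκ _ _ h.choose_spec)
      · exact one_ne_zero
  have main : ∀ (d : ℕ) L j, Edge n r a L j → seqDeg n r a L = d →
      pathWeight n r a κ (d + 1) (L + box j) = pathWeight n r a κ d L * κ L j := by
    intro d
    induction d with
    | zero =>
      intro L j hj hd
      obtain ⟨k, hk, hw⟩ := exists_pathWeight_succ (κ := κ) (L := L + box j) (j := j)
        (by rwa [add_sub_cancel_right]) 0
      rw [hw]
      by_cases hjk : k = j
      · subst hjk; rw [add_sub_cancel_right]
      · exfalso
        obtain ⟨M, rfl⟩ : ∃ M, L = M + box k := ⟨L - box k, by abel⟩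
        rw [show M + box k + box j - box k = M + box j by abel] at hk
        obtain ⟨s1, s2, -⟩ := Edge.square hn hjk (Or.inr ⟨hj.1, hk.1⟩)
        have h1 := s1.1.seqDeg_add_box k
        have h2 := s1.1.seqDeg_nonneg hn
        push_cast at hd
        omega
    | succ d ih =>
      intro L j hj hd
      obtain ⟨k, hk, hw⟩ := exists_pathWeight_succ (κ := κ) (L := L + box j) (j := j)
        (by rwa [add_sub_cancel_right]) (d + 1)
      rw [hw]
      by_cases hjk : k = j
      · subst hjk; rw [add_sub_cancel_right]
      · obtain ⟨M, rfl⟩ : ∃ M, L = M + box k := ⟨L - box k, by abel⟩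
        rw [show M + box k + box j - box k = M + box j by abel] at hk ⊢
        obtain ⟨s1, s2, s3, s4⟩ := Edge.square hn hjk (Or.inr ⟨hj.1, hk.1⟩)
        have h1 := s1.1.seqDeg_add_box k
        have hM : seqDeg n r a M = d := by push_cast at hd; omega
        rw [ih M k s1 hM, ih M j s2 hM, mul_assoc, mul_assoc, hsq M k j hjk s1 s2 s3 s4]
  refine ⟨fun L => pathWeight n r a κ (seqDeg n r a L).toNat L, fun L => hne _ L, fun L j hj => ?_⟩
  have h0 := hj.1.seqDeg_nonneg hn
  have h1 := hj.1.seqDeg_add_box j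
  dsimp only
  rw [h1, show (seqDeg n r a L + 1).toNat = (seqDeg n r a L).toNat + 1 by omega]
  exact main _ L j hj (by omega)

end Degree

/-! ### The semi-infinite module -/

section SemiInfinite

variable {q1 q2 q3 u : ℂ} {n r : ℕ} {a : Fin n → ℕ} {L : ℕ → ℤ} {j : ℕ}

theorem admAdds_iff {L L' : Admissible n r a} {j : ℕ} :
    admAdds L j L' ↔ L'.1 = L.1 + box j :=
  ⟨fun h => funext fun i => by rw [h i, add_box_apply], fun h i => by rw [h, add_box_apply]⟩

theorem edge_of_eq {L L' : Admissible n r a} (h : L'.1 = L.1 + box j) : Edge n r a L.1 j :=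
  ⟨L.2, h ▸ L'.2⟩

namespace Resonant

theorem evalsTo_rowE (R : Resonant q1 q2 q3 n r) (hu : u ≠ 0) (h : Edge n r a L j) :
    EvalsTo (rowE q1 q3 q2 u L j RatFunc.X) (partSupport q1 q2 u L j) (ampE q1 q2 q3 u n r a L j) := by
  rw [rowE_eq R.mul_eq_one, ampE_of_edge h, amp, prod_empty, mul_one]
  exact (EvalsTo.const _ _).mul (R.evalsTo_prod_hfun hu h (by simp))

theorem resid_split (R : Resonant q1 q2 q3 n r) (hu : u ≠ 0) (h : Edge n r a L j)
    {N : ℕ} (hN : ∀ t ≥ N, L t = vacuum n r a t) (hj : j < N) {T T' W W' : Finset ℕ}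
    (hT : Disjoint T T') (hW : Disjoint W W') (hTT : T ∪ T' = (range N).erase j)
    (hWW : W ∪ W' = Ico N (N + n)) :
    resid q1 q2 q3 u n r a L j = amp q1 q2 q3 u T W L j * amp q1 q2 q3 u T' W' L j := by
  rw [R.resid_eq hu h hN hj, ← hTT, ← hWW, amp_union hT hW]

theorem evalsTo_fatF (R : Resonant q1 q2 q3 n r) (hu : u ≠ 0) (h : Edge n r a L j) :
    EvalsTo (fatF q1 q3 q2 u n r a L j RatFunc.X) (partSupport q1 q2 u L j)
      (ampF q1 q2 q3 u n r a L j) := by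
  obtain ⟨N₀, hN₀⟩ := h.1.2.2
  obtain ⟨N, hN, hj⟩ : ∃ N, (∀ t ≥ N, L t = vacuum n r a t) ∧ j < N :=
    ⟨N₀ + j + 1, fun t ht => hN₀ t (by omega), by omega⟩
  have h1 : ampF q1 q2 q3 u n r a L j =
      q1 / (1 - q1) * amp q1 q2 q3 u (Ico (j + 1) N) (Ico N (N + n)) L j := by
    apply mul_left_cancel₀ (R.ampE_ne_zero hu h)
    rw [R.ampE_mul_ampF hu h, ampE_of_edge h, R.resid_split hu h hN hj (T := range j)
      (T' := Ico (j + 1) N) (W := ∅) (W' := Ico N (N + n)) _ (disjoint_empty_left _) _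
      (empty_union _)]
    · have := R.one_sub_q1_ne_zero
      field_simp
    · rw [disjoint_left]; intro t; rw [mem_range, mem_Ico]; omega
    · ext t; rw [mem_union, mem_erase, mem_range, mem_range, mem_Ico]; omega
  rw [h1, R.fatF_eq isGeneric_X hN hj, vacPhi_eq_prod_Ico]
  exact (EvalsTo.const _ _).mul
    (R.evalsTo_amp hu h (by simp) hN hj fun w hw => (mem_Ico.mp hw).1)

/-- The action of the algebra on the semi-infinite module. -/
def semiInfiniteRep (R : Resonant q1 q2 q3 n r) (hu : u ≠ 0) (a : Fin n → ℕ) :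
    Alg q1 q2 q3 →ₐ[ℂ] Module.End ℂ (Admissible n r a →₀ ℂ) :=
  (R.isLadder hu a).admRep

theorem isSemiInfiniteModule (R : Resonant q1 q2 q3 n r) (hu : u ≠ 0) (a : Fin n → ℕ) :
    IsSemiInfiniteModule u n r a (R.semiInfiniteRep hu a) where
  e_add m L j L' h := by
    have h' := admAdds_iff.mp h
    rw [deltaCoeff, (R.evalsTo_rowE hu (edge_of_eq h')).eval_eq]
    exact (R.isLadder hu a).admRep_e m L L' j h'
  e_other m L L' h :=
    (R.isLadder hu a).admRep_e_of_ne m L L' fun j hj => h ⟨j, admAdds_iff.mpr hj⟩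
  f_add m L j L' h := by
    have h' := admAdds_iff.mp h
    rw [deltaCoeff, (R.evalsTo_fatF hu (edge_of_eq h')).eval_eq]
    exact (R.isLadder hu a).admRep_f m L L' j h'
  f_other m L L' h :=
    (R.isLadder hu a).admRep_f_of_ne m L L' fun j hj => h ⟨j, admAdds_iff.mpr hj⟩
  psiPlus m L := by
    rw [expandInfinity_eq]
    exact ((R.isLadder hu a).admRep_psiPlus m L).trans
      (congrArg (· • ket L) (if_pos (show IsAdm n r a L.1 from L.2)))
  psiMinus m L := by
    rw [expandZero_eq]
    exact ((R.isLadder hu a).admRep_psiMinus m L).trans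
      (congrArg (· • ket L) (if_pos (show IsAdm n r a L.1 from L.2)))

end Resonant

theorem admDeg_of_adds (L : Admissible n r a) (j : ℕ) (L' : Admissible n r a) (h : admAdds L j L') :
    admDeg L' = admDeg L + 1 := by
  have := IsAdm.seqDeg_add_box L.2 j
  rw [← admAdds_iff.mp h] at this
  exact this

end SemiInfinite

/-! ### Tuples and admissible sequences -/

section Places

variable {n r : ℕ} {a : Fin n → ℕ}

/-- The place `n s + i` of the part `s` of the `i`-th member of a tuple. -/
def place (hn : 0 < n) : Fin n × ℕ ≃ ℕ where
  toFun p := n * p.2 + p.1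
  invFun j := (⟨j % n, Nat.mod_lt _ hn⟩, j / n)
  left_inv p := by
    refine Prod.ext (Fin.ext ?_) ?_
    · change (n * p.2 + p.1) % n = p.1
      rw [Nat.mul_add_mod, Nat.mod_eq_of_lt p.1.2]
    · change (n * p.2 + p.1) / n = p.2
      rw [Nat.mul_add_div hn, Nat.div_eq_of_lt p.1.2, add_zero]
  right_inv j := Nat.div_add_mod j n

theorem place_apply (hn : 0 < n) (p : Fin n × ℕ) : place hn p = n * p.2 + p.1 := rfl

theorem place_add_one (hn : 0 < n) (i : Fin n) (s : ℕ) :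
    place hn (i, s) + 1 = place hn (finRotate n i, s + bZero n i) := by
  obtain ⟨m, rfl⟩ : ∃ m, n = m + 1 := ⟨n - 1, by omega⟩
  rw [place_apply, place_apply]
  dsimp only
  by_cases hi : i = Fin.last m
  · subst hi
    rw [finRotate_last, bZero, if_pos (by simp), Fin.val_last, Fin.val_zero]
    ring
  · have h1 : (i : ℕ) ≠ m := fun h => hi (Fin.ext h)
    rw [coe_finRotate_of_ne_last hi, bZero, if_neg (by omega)]
    ring

theorem place_add_n (hn : 0 < n) (i : Fin n) (s : ℕ) : place hn (i, s) + n = place hn (i, s + 1) := by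
  rw [place_apply, place_apply]
  ring

theorem vacuum_place (hn : 0 < n) (i : Fin n) (s : ℕ) :
    vacuum n r a (place hn (i, s)) = -(s * r) - ∑ m ∈ Iio i, (a m : ℤ) := by
  have h1 : place hn (i, s) / n = s := congrArg Prod.snd ((place hn).symm_apply_apply (i, s))
  have h2 : place hn (i, s) % n = i := by rw [place_apply, Nat.mul_add_mod, Nat.mod_eq_of_lt i.2]
  rw [vacuum, h1, h2, ← sum_filter]
  congr 2
  ext m
  simp

theorem vacuum_succ (hn : 0 < n) (ha : ∑ i, a i = r) (i : Fin n) (s : ℕ) :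
    vacuum n r a (place hn (i, s) + 1) = vacuum n r a (place hn (i, s)) - a i := by
  rw [place_add_one, vacuum_place, vacuum_place]
  obtain ⟨m, rfl⟩ : ∃ m, n = m + 1 := ⟨n - 1, by omega⟩
  by_cases hi : i = Fin.last m
  · subst hi
    have h1 : Iio (0 : Fin (m + 1)) = ∅ := by ext x; simp
    have h2 : insert (Fin.last m) (Iio (Fin.last m)) = univ := by
      ext x
      rw [mem_insert, mem_Iio, ← le_iff_eq_or_lt]
      exact ⟨fun _ => mem_univ x, fun _ => Fin.le_last x⟩
    rw [finRotate_last, bZero, if_pos (by simp), h1, sum_empty, ← ha, ← h2, sum_insert (by simp)]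
    push_cast
    ring
  · have h1 : (i : ℕ) ≠ m := fun h => hi (Fin.ext h)
    have h2 : insert i (Iio i) = Iio (finRotate (m + 1) i) := by
      ext x
      rw [mem_insert, mem_Iio, mem_Iio, Fin.lt_def, Fin.lt_def, Fin.ext_iff,
        coe_finRotate_of_ne_last hi]
      omega
    rw [← h2, sum_insert (by simp), bZero, if_neg (by omega)]
    push_cast
    ring

/-- The sequence attached to a tuple, the parts being counted from the vacuum. -/
def toSeq (hn : 0 < n) (r : ℕ) (a : Fin n → ℕ) (l : Fin n → ℕ → ℤ) (j : ℕ) : ℤ :=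
  l ((place hn).symm j).1 ((place hn).symm j).2 + vacuum n r a j

theorem toSeq_place (hn : 0 < n) (l : Fin n → ℕ → ℤ) (i : Fin n) (s : ℕ) :
    toSeq hn r a l (place hn (i, s)) = l i s + vacuum n r a (place hn (i, s)) := by
  rw [toSeq, Equiv.symm_apply_apply]

/-- The tuple attached to a sequence. -/
def untuple (n r : ℕ) (a : Fin n → ℕ) (L : ℕ → ℤ) (i : Fin n) (s : ℕ) : ℤ :=
  L (n * s + i) - vacuum n r a (n * s + i)

theorem untuple_toSeq (hn : 0 < n) (l : Fin n → ℕ → ℤ) : untuple n r a (toSeq hn r a l) = l := by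
  funext i s
  have := toSeq_place (r := r) (a := a) hn l i s
  rw [place_apply] at this
  rw [untuple, this, add_sub_cancel_right]

theorem toSeq_untuple (hn : 0 < n) (L : ℕ → ℤ) : toSeq hn r a (untuple n r a L) = L := by
  funext j
  obtain ⟨⟨i, s⟩, rfl⟩ := (place hn).surjective j
  rw [toSeq_place, untuple, place_apply, sub_add_cancel]

/-- The conditions on a tuple say that the attached sequence is admissible. -/
theorem isAdm_toSeq_iff (hn : 0 < n) (ha : ∑ i, a i = r) (l : Fin n → ℕ → ℤ) :
    IsAdm n r a (toSeq hn r a l) ↔ (∀ i, Antitone (l i) ∧ {s | l i s ≠ 0}.Finite) ∧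
      ∀ i s, l i s ≥ l (finRotate n i) (s + bZero n i) - a i := by
  have hstep : ∀ i s, toSeq hn r a l (place hn (i, s) + 1) =
      l (finRotate n i) (s + bZero n i) + vacuum n r a (place hn (i, s)) - a i := fun i s => by
    rw [place_add_one, toSeq_place, ← place_add_one, vacuum_succ hn ha]; ring
  have hgap : ∀ i s, toSeq hn r a l (place hn (i, s) + n) =
      l i (s + 1) + vacuum n r a (place hn (i, s)) - r := fun i s => by
    rw [place_add_n, toSeq_place, ← place_add_n, vacuum_add_period hn]; ring
  constructor
  · intro h
    refine ⟨fun i => ⟨antitone_nat_of_succ_le fun s => ?_, ?_⟩, fun i s => ?_⟩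
    · have := h.gap_one (place hn (i, s))
      rw [hgap, toSeq_place] at this
      omega
    · obtain ⟨N, hN⟩ := h.2.2
      refine (Set.finite_lt_nat N).subset fun s hs => ?_
      by_contra hcon
      have h1 : N ≤ place hn (i, s) := by
        rw [place_apply]
        have h2 : s ≤ n * s := Nat.le_mul_of_pos_left s hn
        have h3 : N ≤ s := not_lt.mp hcon
        dsimp only
        omega
      have h2 := hN _ h1
      rw [toSeq_place] at h2
      exact hs (by omega)
    · have := h.step (place hn (i, s))
      rw [hstep, toSeq_place] at this
      omega
  · rintro ⟨h1, h2⟩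
    refine ⟨antitone_nat_of_succ_le fun j => ?_, fun j => ?_, ?_⟩
    · obtain ⟨⟨i, s⟩, rfl⟩ := (place hn).surjective j
      rw [hstep, toSeq_place]
      have := h2 i s
      omega
    · obtain ⟨⟨i, s⟩, rfl⟩ := (place hn).surjective j
      rw [hgap, toSeq_place]
      have := (h1 i).1 (Nat.le_succ s)
      rw [Nat.succ_eq_add_one] at this
      omega
    · have hfin : (⋃ i, {s | l i s ≠ 0}).Finite := Set.finite_iUnion fun i => (h1 i).2
      obtain ⟨N, hN⟩ := hfin.bddAbove
      refine ⟨n * (N + 1), fun j hj => ?_⟩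
      obtain ⟨⟨i, s⟩, rfl⟩ := (place hn).surjective j
      have h3 : N < s := by
        by_contra! hs
        rw [place_apply] at hj
        have h4 := i.2
        have h5 : n * s ≤ n * N := Nat.mul_le_mul_left n hs
        rw [mul_add, mul_one] at hj
        dsimp only at hj
        omega
      have h4 : l i s = 0 := by
        by_contra hne
        exact absurd (hN (Set.mem_iUnion.mpr ⟨i, hne⟩)) (not_le.mpr h3)
      rw [toSeq_place, h4, zero_add]

/-- The bijection between tuples and admissible sequences. -/
def tuplesEquiv (hn : 0 < n) (ha : ∑ i, a i = r) : Tuples a (bZero n) ≃ Admissible n r a where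
  toFun l := ⟨toSeq hn r a l.1, (isAdm_toSeq_iff hn ha l.1).mpr l.2⟩
  invFun L := ⟨untuple n r a L.1, (isAdm_toSeq_iff hn ha _).mp (by rw [toSeq_untuple]; exact L.2)⟩
  left_inv l := Subtype.ext (untuple_toSeq hn l.1)
  right_inv L := Subtype.ext (toSeq_untuple hn L.1)

theorem tuplesEquiv_apply (hn : 0 < n) (ha : ∑ i, a i = r) (l : Tuples a (bZero n)) :
    (tuplesEquiv hn ha l).1 = toSeq hn r a l.1 := rfl

theorem untuple_tuplesEquiv (hn : 0 < n) (ha : ∑ i, a i = r) (l : Tuples a (bZero n)) :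
    untuple n r a (tuplesEquiv hn ha l).1 = l.1 := untuple_toSeq hn l.1

theorem toSeq_add_box (hn : 0 < n) {l l' : Fin n → ℕ → ℤ} (p : Fin n × ℕ) :
    toSeq hn r a l' = toSeq hn r a l + box (place hn p) ↔
      ∀ i s, l' i s = l i s + if (i, s) = p then 1 else 0 := by
  constructor
  · intro h i s
    have h1 := congrFun h (place hn (i, s))
    rw [add_box_apply, toSeq_place, toSeq_place] at h1
    simp only [EmbeddingLike.apply_eq_iff_eq] at h1
    omega
  · intro h
    funext j
    obtain ⟨⟨i, s⟩, rfl⟩ := (place hn).surjective j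
    rw [add_box_apply, toSeq_place, toSeq_place, h]
    simp only [EmbeddingLike.apply_eq_iff_eq]
    ring

theorem tupleAdds_iff (hn : 0 < n) (ha : ∑ i, a i = r) {l l' : Tuples a (bZero n)}
    {p : Fin n × ℕ} : tupleAdds l p l' ↔
      (tuplesEquiv hn ha l').1 = (tuplesEquiv hn ha l).1 + box (place hn p) :=
  (toSeq_add_box hn p).symm

theorem admDeg_tuplesEquiv (hn : 0 < n) (ha : ∑ i, a i = r) (l : Tuples a (bZero n)) :
    admDeg (tuplesEquiv hn ha l) = tupleDeg l := by
  have hfin : (Function.support fun p : Fin n × ℕ => l.1 p.1 p.2).Finite := by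
    refine (Set.Finite.prod (Set.finite_univ (α := Fin n))
      (Set.finite_iUnion fun i => (l.2.1 i).2)).subset ?_
    exact fun p hp => ⟨Set.mem_univ _, Set.mem_iUnion.mpr ⟨p.1, hp⟩⟩
  have h1 : admDeg (tuplesEquiv hn ha l) = ∑ᶠ p : Fin n × ℕ, l.1 p.1 p.2 := by
    rw [admDeg, ← finsum_comp_equiv (place hn)]
    refine finsum_congr fun p => ?_
    rw [tuplesEquiv_apply, toSeq_place, add_sub_cancel_right]
  rw [h1, finsum_curry _ hfin, finsum_eq_sum_of_fintype, tupleDeg]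

end Places

/-! ### The tensor product of Fock modules -/

section Tensor

variable {q1 q2 q3 u : ℂ} {n r : ℕ} {a : Fin n → ℕ} {L : ℕ → ℤ}

/-- The places of the parts which precede `p` in the tensor product, the members of the tuple being
cut off at the part `N`. -/
def placesBefore (hn : 0 < n) (N : ℕ) (p : Fin n × ℕ) : Finset ℕ :=
  (Iio p.1 ×ˢ range N ∪ {p.1} ×ˢ range p.2).map (place hn).toEmbedding

/-- The places of the parts which follow `p` in the tensor product, the members of the tuple being
cut off at the part `N`. -/
def placesAfter (hn : 0 < n) (N : ℕ) (p : Fin n × ℕ) : Finset ℕ :=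
  ({p.1} ×ˢ Ico (p.2 + 1) N ∪ Ioi p.1 ×ˢ range N).map (place hn).toEmbedding

/-- The first places which are cut off, for the members of the tuple before `i`. -/
def tailBefore (hn : 0 < n) (N : ℕ) (i : Fin n) : Finset ℕ :=
  (Iio i ×ˢ {N}).map (place hn).toEmbedding

/-- The first places which are cut off, for the other members of the tuple. -/
def tailAfter (hn : 0 < n) (N : ℕ) (i : Fin n) : Finset ℕ :=
  (Ici i ×ˢ {N}).map (place hn).toEmbedding

theorem place_mem_map (hn : 0 < n) {S : Finset (Fin n × ℕ)} {p : Fin n × ℕ} :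
    place hn p ∈ S.map (place hn).toEmbedding ↔ p ∈ S :=
  mem_map' (place hn).toEmbedding

theorem place_lt_iff (hn : 0 < n) {p : Fin n × ℕ} {N : ℕ} : place hn p < n * N ↔ p.2 < N := by
  rw [← not_iff_not, not_lt, not_lt, place_apply]
  constructor
  · intro h
    by_contra! hp
    have h1 := p.1.2
    have h2 : n * (p.2 + 1) ≤ n * N := Nat.mul_le_mul_left n hp
    rw [mul_add, mul_one] at h2
    omega
  · intro h
    exact (Nat.mul_le_mul_left n h).trans (Nat.le_add_right _ _)

theorem placesBefore_union_placesAfter (hn : 0 < n) {N : ℕ} {p : Fin n × ℕ} (hp : p.2 < N) :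
    placesBefore hn N p ∪ placesAfter hn N p = (range (n * N)).erase (place hn p) := by
  ext t
  obtain ⟨⟨i, s⟩, rfl⟩ := (place hn).surjective t
  obtain ⟨i', s'⟩ := p
  rw [placesBefore, placesAfter, ← map_union, place_mem_map, mem_erase, mem_range, place_lt_iff,
    Ne, EmbeddingLike.apply_eq_iff_eq]
  simp only [mem_union, mem_product, mem_Iio, mem_Ioi, mem_singleton, mem_range, mem_Ico,
    Prod.mk.injEq, Fin.lt_def, Fin.ext_iff]
  dsimp only at hp
  omega

theorem disjoint_placesBefore_placesAfter (hn : 0 < n) (N : ℕ) (p : Fin n × ℕ) :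
    Disjoint (placesBefore hn N p) (placesAfter hn N p) := by
  rw [placesBefore, placesAfter, disjoint_map, disjoint_left]
  rintro ⟨i, s⟩
  simp only [mem_union, mem_product, mem_Iio, mem_Ioi, mem_singleton, mem_range, mem_Ico,
    Fin.lt_def, Fin.ext_iff]
  omega

theorem tailBefore_union_tailAfter (hn : 0 < n) (N : ℕ) (i : Fin n) :
    tailBefore hn N i ∪ tailAfter hn N i = Ico (n * N) (n * N + n) := by
  ext t
  obtain ⟨⟨i', s⟩, rfl⟩ := (place hn).surjective t
  rw [tailBefore, tailAfter, ← map_union, place_mem_map, mem_Ico, ← not_lt, place_lt_iff,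
    show n * N + n = n * (N + 1) by ring, place_lt_iff]
  simp only [mem_union, mem_product, mem_Iio, mem_Ici, mem_singleton, Fin.lt_def, Fin.le_def]
  omega

theorem disjoint_tailBefore_tailAfter (hn : 0 < n) (N : ℕ) (i : Fin n) :
    Disjoint (tailBefore hn N i) (tailAfter hn N i) := by
  rw [tailBefore, tailAfter, disjoint_map, disjoint_left]
  rintro ⟨i', s⟩
  simp only [mem_product, mem_Iio, mem_Ici, Fin.lt_def, Fin.le_def]
  omega

theorem le_of_mem_tail (hn : 0 < n) {N : ℕ} {i : Fin n} {w : ℕ}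
    (hw : w ∈ tailBefore hn N i ∪ tailAfter hn N i) : n * N ≤ w := by
  rw [tailBefore_union_tailAfter] at hw
  exact (mem_Ico.mp hw).1

theorem notMem_placesBefore (hn : 0 < n) (N : ℕ) (p : Fin n × ℕ) :
    place hn p ∉ placesBefore hn N p := by
  rw [placesBefore, place_mem_map]
  simp

theorem notMem_placesAfter (hn : 0 < n) (N : ℕ) (p : Fin n × ℕ) :
    place hn p ∉ placesAfter hn N p := by
  rw [placesAfter, place_mem_map]
  simp

/-- Of two different parts exactly one precedes the other. -/
theorem mem_placesBefore_or (hn : 0 < n) {N : ℕ} {p p' : Fin n × ℕ} (h : p ≠ p') (hp : p.2 < N)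
    (hp' : p'.2 < N) :
    (place hn p ∈ placesBefore hn N p' ∧ place hn p' ∉ placesBefore hn N p) ∨
      (place hn p' ∈ placesBefore hn N p ∧ place hn p ∉ placesBefore hn N p') := by
  obtain ⟨i, s⟩ := p
  obtain ⟨i', s'⟩ := p'
  rw [placesBefore, placesBefore, place_mem_map, place_mem_map]
  simp only [mem_union, mem_product, mem_Iio, mem_singleton, mem_range, Fin.lt_def, Fin.ext_iff,
    Prod.mk.injEq, Ne] at h hp hp' ⊢
  omega

/-- The evaluation parameters of the Fock modules are the supports of the vacuum. -/
theorem Resonant.evalParam_eq (R : Resonant q1 q2 q3 n r) (hn : 0 < n) (u : ℂ) (a : Fin n → ℕ)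
    (i : Fin n) (s : ℕ) : q3 ^ s * evalParam q1 q3 u a (bZero n) i =
      partSupport q1 q2 u (vacuum n r a) (place hn (i, s)) := by
  induction s with
  | zero =>
    have h1 := R.q1_ne_zero
    have h3 := R.q3_ne_zero
    have e1 : ∏ j ∈ Iio i, (q1 ^ (a j + 1) * q3 ^ (bZero n j + 1))⁻¹ =
        q1 ^ (-∑ m ∈ Iio i, (a m : ℤ)) * q2 ^ (i : ℕ) := by
      have e2 : ∀ j ∈ Iio i, (q1 ^ (a j + 1) * q3 ^ (bZero n j + 1))⁻¹ = (q1 ^ a j)⁻¹ * q2 := by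
        intro j hj
        rw [mem_Iio, Fin.lt_def] at hj
        have hi := i.2
        rw [bZero, if_neg (by omega), zero_add, pow_one, pow_succ]
        field_simp
        linear_combination -R.mul_eq_one
      rw [prod_congr rfl e2, prod_mul_distrib, prod_const, Fin.card_Iio, prod_inv_distrib,
        prod_pow_eq_pow_sum, zpow_neg, ← zpow_natCast]
      push_cast
      rfl
    rw [pow_zero, one_mul, evalParam, e1, partSupport, vacuum_place, place_apply]
    simp only [Nat.cast_zero, zero_mul, neg_zero, zero_sub, mul_zero, zero_add]
    ring
  | succ s ih =>
    rw [← place_add_n, R.support_vacuum_add, ← ih]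
    ring

/-- The support of a part of a tuple is the support of the corresponding place of the sequence. -/
theorem Resonant.partSupport_untuple (R : Resonant q1 q2 q3 n r) (hn : 0 < n) (u : ℂ)
    (a : Fin n → ℕ) (L : ℕ → ℤ) (i : Fin n) (s : ℕ) :
    partSupport q1 q3 (evalParam q1 q3 u a (bZero n) i) (untuple n r a L i) s =
      partSupport q1 q2 u L (place hn (i, s)) := by
  have h1 := R.evalParam_eq hn u a i s
  rw [partSupport, mul_assoc, h1, partSupport, partSupport, untuple, place_apply, zpow_sub₀ R.q1_ne_zero]
  have := zpow_ne_zero (vacuum n r a (n * s + i)) R.q1_ne_zero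
  field_simp

/-- The regularised products of a Fock module as finite products. -/
theorem Resonant.phi_mul_finprod (R : Resonant q1 q2 q3 n r) (hn : 0 < n) {z : RatFunc ℂ}
    (hz : IsGeneric z) {N : ℕ} (hN : ∀ t ≥ n * N, L t = vacuum n r a t) (i : Fin n) {s : ℕ}
    (hs : s ≤ N) :
    phi q2 (partSupport q1 q2 u (vacuum n r a) (place hn (i, s))) z *
      ∏ᶠ t : ℕ, partPsi q1 q2 q3 (evalParam q1 q3 u a (bZero n) i) (untuple n r a L i) (s + t) z /
        partPsi q1 q2 q3 (evalParam q1 q3 u a (bZero n) i) (fun _ => 0) (s + t) z =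
      (∏ t ∈ Ico s N, hfun q1 q2 q3 (partSupport q1 q2 u L (place hn (i, t))) z) *
        phi q2 (partSupport q1 q2 u (vacuum n r a) (place hn (i, N))) z := by
  have h0 : ∀ t, partPsi q1 q2 q3 (evalParam q1 q3 u a (bZero n) i) (fun _ => 0) t z =
      hfun q1 q2 q3 (partSupport q1 q2 u (vacuum n r a) (place hn (i, t))) z := fun t => by
    rw [partPsi_eq_hfun R.mul_eq_one, partSupport, zpow_zero, one_mul, R.evalParam_eq hn]
  have h1 : ∀ t, partPsi q1 q2 q3 (evalParam q1 q3 u a (bZero n) i) (untuple n r a L i) t z =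
      hfun q1 q2 q3 (partSupport q1 q2 u L (place hn (i, t))) z := fun t => by
    rw [partPsi_eq_hfun R.mul_eq_one, R.partSupport_untuple hn]
  simp only [h0, h1]
  refine mul_finprod_eq
    (Φ := fun t => phi q2 (partSupport q1 q2 u (vacuum n r a) (place hn (i, t))) z)
    (h := fun t => hfun q1 q2 q3 (partSupport q1 q2 u L (place hn (i, t))) z)
    (h0 := fun t => hfun q1 q2 q3 (partSupport q1 q2 u (vacuum n r a) (place hn (i, t))) z)
    (fun t => ?_) (fun t => hfun_ne_zero hz) (fun t ht => ?_) hs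
  · rw [← place_add_n, R.support_vacuum_add]
    exact phi_shift R.mul_eq_one hz
  · have h2 : n * N ≤ place hn (i, t) := by
      rw [← not_lt, place_lt_iff, not_lt]; exact ht
    simp only [partSupport, hN _ h2]

theorem Resonant.fockPsi_eq (R : Resonant q1 q2 q3 n r) (hn : 0 < n) {z : RatFunc ℂ}
    (hz : IsGeneric z) {N : ℕ} (hN : ∀ t ≥ n * N, L t = vacuum n r a t) (i : Fin n) :
    fockPsi q1 q2 q3 (evalParam q1 q3 u a (bZero n) i) (untuple n r a L i) z =
      (∏ t ∈ range N, hfun q1 q2 q3 (partSupport q1 q2 u L (place hn (i, t))) z) *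
        phi q2 (partSupport q1 q2 u (vacuum n r a) (place hn (i, N))) z := by
  have h1 := R.phi_mul_finprod (u := u) hn hz hN i (Nat.zero_le N)
  rw [← R.evalParam_eq hn u a i 0, pow_zero, one_mul] at h1
  simp only [zero_add] at h1
  rw [fockPsi, vacFun_eq_phi, h1, range_eq_Ico]

/-- On a tuple, `ψ(z)` has the same eigenvalue as on the attached sequence. -/
theorem Resonant.tensorPsi_eq (R : Resonant q1 q2 q3 n r) {z : RatFunc ℂ}
    (hz : IsGeneric z) (hL : IsAdm n r a L) :
    tensorPsi q1 q2 q3 (evalParam q1 q3 u a (bZero n)) (untuple n r a L) z =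
      fatPsi q1 q3 q2 u n r a L z := by
  have hn : 0 < n := by have := R.two_le_n; omega
  obtain ⟨N, hN⟩ := hL.2.2
  have hN' : ∀ t ≥ n * N, L t = vacuum n r a t := fun t ht =>
    hN t (le_trans (Nat.le_mul_of_pos_left N hn) ht)
  have e1 : range (n * N) = (univ ×ˢ range N).map (place hn).toEmbedding := by
    ext t
    obtain ⟨p, rfl⟩ := (place hn).surjective t
    rw [place_mem_map, mem_range, place_lt_iff]
    simp
  have e2 : Ico (n * N) (n * N + n) = (univ ×ˢ {N}).map (place hn).toEmbedding := by
    rw [← tailBefore_union_tailAfter hn N ⟨0, hn⟩, tailBefore, tailAfter, ← map_union]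
    congr 1
    ext ⟨i, s⟩
    simp [Fin.le_def]
  rw [R.fatPsi_eq hz hN', vacPhi_eq_prod_Ico, e1, e2, prod_map, prod_map, prod_product, prod_product,
    ← prod_mul_distrib, tensorPsi]
  refine prod_congr rfl fun i _ => ?_
  rw [R.fockPsi_eq hn hz hN', prod_singleton]
  rfl

theorem Resonant.tensorE_eq (R : Resonant q1 q2 q3 n r) (hn : 0 < n) {z : RatFunc ℂ}
    (hz : IsGeneric z) {N : ℕ} (hN : ∀ t ≥ n * N, L t = vacuum n r a t) (p : Fin n × ℕ) :
    tensorE q1 q2 q3 (evalParam q1 q3 u a (bZero n)) (untuple n r a L) p z =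
      RatFunc.C (1 / (1 - q1)) *
        ((∏ t ∈ placesBefore hn N p, hfun q1 q2 q3 (partSupport q1 q2 u L t) z) *
          ∏ w ∈ tailBefore hn N p.1, phi q2 (partSupport q1 q2 u (vacuum n r a) w) z) := by
  have hd : Disjoint (Iio p.1 ×ˢ range N) ({p.1} ×ˢ range p.2) :=
    disjoint_product.mpr (Or.inl (by simp))
  rw [tensorE, rowE, prod_congr rfl fun i _ => R.fockPsi_eq hn hz hN i, placesBefore, tailBefore,
    prod_map, prod_map, prod_union hd, prod_product, prod_product, prod_product, prod_mul_distrib,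
    prod_singleton]
  simp only [prod_singleton, partPsi_eq_hfun R.mul_eq_one, R.partSupport_untuple hn,
    Equiv.coe_toEmbedding]
  ring

theorem Resonant.tensorF_eq (R : Resonant q1 q2 q3 n r) (hn : 0 < n) {z : RatFunc ℂ}
    (hz : IsGeneric z) {N : ℕ} (hN : ∀ t ≥ n * N, L t = vacuum n r a t) {p : Fin n × ℕ}
    (hp : p.2 < N) :
    tensorF q1 q2 q3 (evalParam q1 q3 u a (bZero n)) (untuple n r a L) p z =
      RatFunc.C (q1 / (1 - q1)) *
        ((∏ t ∈ placesAfter hn N p, hfun q1 q2 q3 (partSupport q1 q2 u L t) z) *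
          ∏ w ∈ tailAfter hn N p.1, phi q2 (partSupport q1 q2 u (vacuum n r a) w) z) := by
  have hd : Disjoint ({p.1} ×ˢ Ico (p.2 + 1) N) (Ioi p.1 ×ˢ range N) :=
    disjoint_product.mpr (Or.inl (by simp))
  have h1 := R.phi_mul_finprod (u := u) hn hz hN p.1 (show p.2 + 1 ≤ N from hp)
  rw [← R.evalParam_eq hn u a p.1 (p.2 + 1)] at h1
  rw [tensorF, fockF, vacFun_eq_phi, prod_congr rfl fun i _ => R.fockPsi_eq hn hz hN i,
    mul_comm (evalParam q1 q3 u a (bZero n) p.1), mul_assoc (RatFunc.C (q1 / (1 - q1))), h1, placesAfter, tailAfter, prod_map, prod_map,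
    prod_union hd, prod_product, prod_product, prod_product, prod_mul_distrib, prod_singleton,
    ← Ioi_insert p.1, prod_insert (by simp)]
  simp only [prod_singleton, Equiv.coe_toEmbedding]
  ring

end Tensor

/-! ### The rescaling of the basis -/

section Gauge

variable {q1 q2 q3 u : ℂ} {n r : ℕ} {a : Fin n → ℕ} {L : ℕ → ℤ} {p : Fin n × ℕ}

/-- The amplitude of `e(z)` in the tensor product of Fock modules, for the tuple attached to `L`.
The argument `j` is the place of `p`. -/
def tensorAmpE (q1 q2 q3 u : ℂ) (n r : ℕ) (a : Fin n → ℕ) (L : ℕ → ℤ) (p : Fin n × ℕ) (j : ℕ) : ℂ :=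
  RatFunc.eval (RingHom.id ℂ) (partSupport q1 q2 u L j)
    (tensorE q1 q2 q3 (evalParam q1 q3 u a (bZero n)) (untuple n r a L) p RatFunc.X)

namespace Resonant

theorem tensorAmpE_eq (R : Resonant q1 q2 q3 n r) (hu : u ≠ 0) (hn : 0 < n)
    (h : Edge n r a L (place hn p)) {N : ℕ} (hN : ∀ t ≥ n * N, L t = vacuum n r a t) (hp : p.2 < N) :
    tensorAmpE q1 q2 q3 u n r a L p (place hn p) = 1 / (1 - q1) *
      amp q1 q2 q3 u (placesBefore hn N p) (tailBefore hn N p.1) L (place hn p) := by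
  refine EvalsTo.eval_eq ?_
  rw [R.tensorE_eq hn isGeneric_X hN]
  exact (EvalsTo.const _ _).mul (R.evalsTo_amp hu h (notMem_placesBefore hn N p) hN
    ((place_lt_iff hn).mpr hp) fun w hw => le_of_mem_tail hn (mem_union_left _ hw))

theorem notMem_tail (hn : 0 < n) {N : ℕ} (hp : p.2 < N) (i : Fin n) :
    place hn p ∉ tailBefore hn N i ∪ tailAfter hn N i := fun h =>
  absurd (le_of_mem_tail hn h) (not_le.mpr ((place_lt_iff hn).mpr hp))

theorem exists_cutoff (hn : 0 < n) (hL : IsAdm n r a L) (m : ℕ) :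
    ∃ N, m < N ∧ ∀ t ≥ n * N, L t = vacuum n r a t := by
  obtain ⟨N, hN⟩ := hL.2.2
  refine ⟨N + m + 1, by omega, fun t ht => hN t ?_⟩
  have := Nat.le_mul_of_pos_left (N + m + 1) hn
  omega

theorem tensorAmpE_ne_zero (R : Resonant q1 q2 q3 n r) (hu : u ≠ 0) (hn : 0 < n)
    (h : Edge n r a L (place hn p)) : tensorAmpE q1 q2 q3 u n r a L p (place hn p) ≠ 0 := by
  obtain ⟨N, hp, hN⟩ := exists_cutoff hn h.1 p.2
  rw [R.tensorAmpE_eq hu hn h hN hp]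
  exact mul_ne_zero (one_div_ne_zero R.one_sub_q1_ne_zero) (R.amp_ne_zero hu h
    (notMem_placesBefore hn N p) fun h' => notMem_tail hn hp p.1 (mem_union_left _ h'))

/-- Around a square, the amplitudes of `e(z)` in the tensor product are related by the structure
function. -/
theorem tensorAmpE_square (R : Resonant q1 q2 q3 n r) (hu : u ≠ 0) (hn : 0 < n) {p' : Fin n × ℕ}
    (hpp : p ≠ p') (hj : Edge n r a L (place hn p)) (hk : Edge n r a L (place hn p'))
    (hjk : Edge n r a (L + box (place hn p)) (place hn p'))
    (hkj : Edge n r a (L + box (place hn p')) (place hn p)) :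
    cubic (q1 + q2 + q3) (q1 * q2 + q1 * q3 + q2 * q3)
        (partSupport q1 q2 u L (place hn p')) (partSupport q1 q2 u L (place hn p)) *
        (tensorAmpE q1 q2 q3 u n r a L p (place hn p) *
          tensorAmpE q1 q2 q3 u n r a (L + box (place hn p)) p' (place hn p')) +
      cubic (q1 + q2 + q3) (q1 * q2 + q1 * q3 + q2 * q3)
        (partSupport q1 q2 u L (place hn p)) (partSupport q1 q2 u L (place hn p')) *
        (tensorAmpE q1 q2 q3 u n r a L p' (place hn p') *
          tensorAmpE q1 q2 q3 u n r a (L + box (place hn p')) p (place hn p)) = 0 := by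
  obtain ⟨N, hm, hN⟩ := exists_cutoff hn hj.1 (max p.2 p'.2)
  have hp : p.2 < N := (le_max_left _ _).trans_lt hm
  have hp' : p'.2 < N := (le_max_right _ _).trans_lt hm
  have hN' : ∀ x : Fin n × ℕ, x.2 < N → ∀ t ≥ n * N, (L + box (place hn x)) t = vacuum n r a t := by
    intro x hx t ht
    have := (place_lt_iff hn).mpr hx
    rw [add_box_apply, if_neg (by omega), add_zero, hN t ht]
  have hne : place hn p ≠ place hn p' := fun h => hpp ((place hn).injective h)
  have w1 : place hn p' ∉ tailBefore hn N p.1 := fun h =>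
    notMem_tail hn hp' p.1 (mem_union_left _ h)
  have w2 : place hn p ∉ tailBefore hn N p'.1 := fun h =>
    notMem_tail hn hp p'.1 (mem_union_left _ h)
  rw [R.tensorAmpE_eq hu hn hj hN hp, R.tensorAmpE_eq hu hn hk hN hp',
    R.tensorAmpE_eq hu hn hjk (hN' p hp) hp', R.tensorAmpE_eq hu hn hkj (hN' p' hp') hp]
  rcases mem_placesBefore_or hn hpp hp hp' with ⟨h1, h2⟩ | ⟨h1, h2⟩
  · linear_combination (1 / (1 - q1)) ^ 2 * R.amp_square hu hne.symm hk hjk h1 h2 w2 w1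
  · linear_combination (1 / (1 - q1)) ^ 2 * R.amp_square hu hne hj hkj h1 h2 w1 w2

/-- The amplitude of `f(z)` in the tensor product: its product with the amplitude of `e(z)` is the same
as in the semi-infinite module. -/
theorem evalsTo_tensorF (R : Resonant q1 q2 q3 n r) (hu : u ≠ 0) (hn : 0 < n)
    (h : Edge n r a L (place hn p)) :
    EvalsTo (tensorF q1 q2 q3 (evalParam q1 q3 u a (bZero n)) (untuple n r a L) p RatFunc.X)
      (partSupport q1 q2 u L (place hn p))
      (q1 / (1 - q1) ^ 2 * resid q1 q2 q3 u n r a L (place hn p) /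
        tensorAmpE q1 q2 q3 u n r a L p (place hn p)) := by
  obtain ⟨N, hp, hN⟩ := exists_cutoff hn h.1 p.2
  have h0 := R.amp_ne_zero hu h (notMem_placesBefore hn N p)
    (W := tailBefore hn N p.1) fun h' => notMem_tail hn hp p.1 (mem_union_left _ h')
  have h1 : q1 / (1 - q1) ^ 2 * resid q1 q2 q3 u n r a L (place hn p) /
      tensorAmpE q1 q2 q3 u n r a L p (place hn p) = q1 / (1 - q1) *
        amp q1 q2 q3 u (placesAfter hn N p) (tailAfter hn N p.1) L (place hn p) := by
    rw [R.tensorAmpE_eq hu hn h hN hp, R.resid_split hu h hN ((place_lt_iff hn).mpr hp)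
      (disjoint_placesBefore_placesAfter hn N p) (disjoint_tailBefore_tailAfter hn N p.1)
      (placesBefore_union_placesAfter hn hp) (tailBefore_union_tailAfter hn N p.1)]
    have := R.one_sub_q1_ne_zero
    field_simp
  rw [h1, R.tensorF_eq hn isGeneric_X hN hp]
  exact (EvalsTo.const _ _).mul (R.evalsTo_amp hu h (notMem_placesAfter hn N p) hN
    ((place_lt_iff hn).mpr hp) fun w hw => le_of_mem_tail hn (mem_union_right _ hw))

/-- The two modules differ by a rescaling of the basis vectors. -/
theorem exists_gauge (R : Resonant q1 q2 q3 n r) (hu : u ≠ 0) (hn : 0 < n) (a : Fin n → ℕ) :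
    ∃ c : (ℕ → ℤ) → ℂ, (∀ L, c L ≠ 0) ∧ ∀ L p, Edge n r a L (place hn p) →
      c (L + box (place hn p)) * tensorAmpE q1 q2 q3 u n r a L p (place hn p) =
        c L * ampE q1 q2 q3 u n r a L (place hn p) := by
  obtain ⟨c, hc, h⟩ := exists_potential (a := a) (r := r) hn
    (fun L j => ampE q1 q2 q3 u n r a L j / tensorAmpE q1 q2 q3 u n r a L ((place hn).symm j) j)
    (fun L j hj => by
      obtain ⟨p, rfl⟩ := (place hn).surjective j
      rw [Equiv.symm_apply_apply]
      exact div_ne_zero (R.ampE_ne_zero hu hj) (R.tensorAmpE_ne_zero hu hn hj))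
    (fun L j k hjk hj hk hjk' hkj => by
      obtain ⟨p, rfl⟩ := (place hn).surjective j
      obtain ⟨p', rfl⟩ := (place hn).surjective k
      have hpp : p ≠ p' := fun h => hjk (congrArg _ h)
      simp only [Equiv.symm_apply_apply]
      have h1 := R.ampE_square hu hjk hj hk hjk' hkj
      have h2 := R.tensorAmpE_square hu hn hpp hj hk hjk' hkj
      have h3 := R.cubic_ne_zero hu hj hkj hjk
      rw [div_mul_div_comm, div_mul_div_comm, div_eq_div_iff
        (mul_ne_zero (R.tensorAmpE_ne_zero hu hn hj) (R.tensorAmpE_ne_zero hu hn hjk'))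
        (mul_ne_zero (R.tensorAmpE_ne_zero hu hn hk) (R.tensorAmpE_ne_zero hu hn hkj))]
      apply mul_left_cancel₀ h3
      linear_combination (ampE q1 q2 q3 u n r a L (place hn p) *
          ampE q1 q2 q3 u n r a (L + box (place hn p)) (place hn p')) * h2 -
        (tensorAmpE q1 q2 q3 u n r a L p (place hn p) *
          tensorAmpE q1 q2 q3 u n r a (L + box (place hn p)) p' (place hn p')) * h1)
  refine ⟨c, hc, fun L p hp => ?_⟩
  rw [h L _ hp, Equiv.symm_apply_apply, mul_assoc,
    div_mul_cancel₀ _ (R.tensorAmpE_ne_zero hu hn hp)]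

end Resonant

/-! ### Transport of the action -/

/-- The diagonal automorphism with eigenvalues `c`. -/
def diagEquiv {P : Type} (c : P → ℂ) (hc : ∀ l, c l ≠ 0) : (P →₀ ℂ) ≃ₗ[ℂ] (P →₀ ℂ) :=
  LinearEquiv.ofLinearMap (diagOp c) (diagOp c⁻¹)
    (by
      change diagOp c * diagOp c⁻¹ = 1
      rw [diagOp_mul, ← diagOp_one]
      exact congrArg diagOp (funext fun l => mul_inv_cancel₀ (hc l)))
    (by
      change diagOp c⁻¹ * diagOp c = 1
      rw [diagOp_mul, ← diagOp_one]
      exact congrArg diagOp (funext fun l => inv_mul_cancel₀ (hc l)))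

/-- The linear isomorphism which maps `|l⟩` to a multiple of `|β l⟩`. -/
def scaledRelabel {P Q : Type} (β : P ≃ Q) (c : Q → ℂ) (hc : ∀ l, c l ≠ 0) :
    (P →₀ ℂ) ≃ₗ[ℂ] (Q →₀ ℂ) :=
  (Finsupp.domLCongr β).trans (diagEquiv c hc)

theorem scaledRelabel_ket {P Q : Type} (β : P ≃ Q) (c : Q → ℂ) (hc : ∀ l, c l ≠ 0) (l : P) :
    scaledRelabel β c hc (ket l) = c (β l) • ket (β l) := by
  rw [scaledRelabel, LinearEquiv.trans_apply, ket, Finsupp.domLCongr_single]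
  exact diagOp_ket c (β l)

theorem scaledRelabel_symm_ket {P Q : Type} (β : P ≃ Q) (c : Q → ℂ) (hc : ∀ l, c l ≠ 0) (l : P) :
    (scaledRelabel β c hc).symm (ket (β l)) = (c (β l))⁻¹ • ket l := by
  rw [LinearEquiv.symm_apply_eq, map_smul, scaledRelabel_ket, inv_smul_smul₀ (hc _)]

theorem scaledRelabel_symm_apply {P Q : Type} (β : P ≃ Q) (c : Q → ℂ) (hc : ∀ l, c l ≠ 0)
    (x : Q →₀ ℂ) (l : P) : (scaledRelabel β c hc).symm x l = (c (β l))⁻¹ * x (β l) := by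
  classical
  induction x using Finsupp.induction_linear with
  | zero => simp
  | add x y hx hy => rw [map_add, Finsupp.add_apply, hx, hy, Finsupp.add_apply, mul_add]
  | single i b =>
    obtain ⟨k, rfl⟩ := β.surjective i
    have h1 : Finsupp.single (β k) b = b • ket (β k) := by rw [ket, Finsupp.smul_single_one]
    rw [h1, map_smul, scaledRelabel_symm_ket]
    simp only [Finsupp.smul_apply, ket, Finsupp.single_apply, smul_eq_mul,
      EmbeddingLike.apply_eq_iff_eq]
    by_cases h : k = l
    · subst h; simp; ring
    · simp [h]

theorem map_modGrade {P Q : Type} (β : P ≃ Q) (c : Q → ℂ) (hc : ∀ l, c l ≠ 0) {degP : P → ℤ}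
    {degQ : Q → ℤ} (hdeg : ∀ l, degQ (β l) = degP l) (d : ℤ) :
    (modGrade degP d).map (scaledRelabel β c hc : (P →₀ ℂ) →ₗ[ℂ] (Q →₀ ℂ)) = modGrade degQ d := by
  refine le_antisymm ?_ ?_
  · rw [modGrade, Submodule.map_span_le]
    rintro x ⟨l, hl, rfl⟩
    change scaledRelabel β c hc (ket l) ∈ _
    rw [scaledRelabel_ket]
    exact Submodule.smul_mem _ _ (Submodule.subset_span ⟨β l, by rw [hdeg, hl], rfl⟩)
  · rw [modGrade, Submodule.span_le]
    rintro x ⟨k, hk, rfl⟩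
    obtain ⟨l, rfl⟩ := β.surjective k
    refine ⟨(c (β l))⁻¹ • ket l, Submodule.smul_mem _ _
      (Submodule.subset_span ⟨l, by rw [← hdeg, hk], rfl⟩), ?_⟩
    change scaledRelabel β c hc _ = _
    rw [map_smul, scaledRelabel_ket, inv_smul_smul₀ (hc _)]

/-- The action on the space of tuples that corresponds to the semi-infinite module. -/
def tupleRep (R : Resonant q1 q2 q3 n r) (hu : u ≠ 0) (hn : 0 < n) (ha : ∑ i, a i = r)
    (c : Admissible n r a → ℂ) (hc : ∀ L, c L ≠ 0) :
    Alg q1 q2 q3 →ₐ[ℂ] Module.End ℂ (Tuples a (bZero n) →₀ ℂ) :=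
  ((scaledRelabel (tuplesEquiv hn ha) c hc).symm.conjAlgEquiv ℂ).toAlgHom.comp
    (R.semiInfiniteRep hu a)

theorem tupleRep_apply (R : Resonant q1 q2 q3 n r) (hu : u ≠ 0) (hn : 0 < n) (ha : ∑ i, a i = r)
    (c : Admissible n r a → ℂ) (hc : ∀ L, c L ≠ 0) (x : Alg q1 q2 q3)
    (y : Tuples a (bZero n) →₀ ℂ) :
    tupleRep R hu hn ha c hc x y = (scaledRelabel (tuplesEquiv hn ha) c hc).symm
      (R.semiInfiniteRep hu a x (scaledRelabel (tuplesEquiv hn ha) c hc y)) := rfl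

theorem tupleRep_ket_apply (R : Resonant q1 q2 q3 n r) (hu : u ≠ 0) (hn : 0 < n)
    (ha : ∑ i, a i = r) (c : Admissible n r a → ℂ) (hc : ∀ L, c L ≠ 0) (x : Alg q1 q2 q3)
    (l l' : Tuples a (bZero n)) :
    tupleRep R hu hn ha c hc x (ket l) l' =
      (c (tuplesEquiv hn ha l'))⁻¹ * (c (tuplesEquiv hn ha l) *
        R.semiInfiniteRep hu a x (ket (tuplesEquiv hn ha l)) (tuplesEquiv hn ha l')) := by
  rw [tupleRep_apply, scaledRelabel_ket, map_smul, scaledRelabel_symm_apply, Finsupp.smul_apply,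
    smul_eq_mul]

theorem tensorSupport_eq (R : Resonant q1 q2 q3 n r) (hn : 0 < n) (ha : ∑ i, a i = r) (u : ℂ)
    (l : Tuples a (bZero n)) (p : Fin n × ℕ) :
    tensorSupport q1 q3 (evalParam q1 q3 u a (bZero n)) l.1 p =
      partSupport q1 q2 u (tuplesEquiv hn ha l).1 (place hn p) := by
  rw [tensorSupport, ← untuple_tuplesEquiv hn ha l, R.partSupport_untuple hn]

/-- With the factors of `exists_gauge`, the transported action has the matrix coefficients of the
tensor product of Fock modules. -/
theorem isTupleModule_tupleRep (R : Resonant q1 q2 q3 n r) (hu : u ≠ 0) (hn : 0 < n)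
    (ha : ∑ i, a i = r) {c : (ℕ → ℤ) → ℂ} (hc : ∀ L, c L ≠ 0)
    (hgauge : ∀ L p, Edge n r a L (place hn p) →
      c (L + box (place hn p)) * tensorAmpE q1 q2 q3 u n r a L p (place hn p) =
        c L * ampE q1 q2 q3 u n r a L (place hn p)) :
    IsTupleModule u a (bZero n)
      (tupleRep R hu hn ha (fun L : Admissible n r a => c L.1) fun L => hc L.1) where
  e_add m l p l' h := by
    have h' := (tupleAdds_iff hn ha).mp h
    have he := edge_of_eq h'
    have h1 := (R.isSemiInfiniteModule hu a).e_add m (tuplesEquiv hn ha l) (place hn p)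
      (tuplesEquiv hn ha l') (admAdds_iff.mpr h')
    have h2 := hgauge _ _ he
    rw [tupleRep_ket_apply, h1, deltaCoeff, (R.evalsTo_rowE hu he).eval_eq, deltaCoeff,
      tensorSupport_eq R hn ha]
    have h3 : RatFunc.eval (RingHom.id ℂ) (partSupport q1 q2 u (tuplesEquiv hn ha l).1 (place hn p))
        (tensorE q1 q2 q3 (evalParam q1 q3 u a (bZero n)) l.1 p RatFunc.X) =
          tensorAmpE q1 q2 q3 u n r a (tuplesEquiv hn ha l).1 p (place hn p) := by
      rw [tensorAmpE, untuple_tuplesEquiv]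
    rw [h3, inv_mul_eq_iff_eq_mul₀ (hc _), h', ← mul_assoc, ← mul_assoc, h2]
  e_other m l l' h := by
    rw [tupleRep_ket_apply, (R.isSemiInfiniteModule hu a).e_other, mul_zero, mul_zero]
    rintro ⟨j, hj⟩
    obtain ⟨p, rfl⟩ := (place hn).surjective j
    exact h ⟨p, (tupleAdds_iff hn ha).mpr (admAdds_iff.mp hj)⟩
  f_add m l p l' h := by
    have h' := (tupleAdds_iff hn ha).mp h
    have he := edge_of_eq h'
    have h1 := (R.isSemiInfiniteModule hu a).f_add m (tuplesEquiv hn ha l) (place hn p)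
      (tuplesEquiv hn ha l') (admAdds_iff.mpr h')
    have h2 := hgauge _ _ he
    have h3 := R.evalsTo_tensorF hu hn he
    rw [untuple_tuplesEquiv] at h3
    have h4 := R.tensorAmpE_ne_zero hu hn he
    rw [tupleRep_ket_apply, h1, deltaCoeff, (R.evalsTo_fatF hu he).eval_eq, deltaCoeff,
      tensorSupport_eq R hn ha, h3.eval_eq, inv_mul_eq_iff_eq_mul₀ (hc _), h',
      ← R.ampE_mul_ampF hu he, ← mul_assoc, ← mul_assoc]
    congr 1
    rw [← mul_div_assoc, eq_div_iff h4]
    linear_combination ampF q1 q2 q3 u n r a (tuplesEquiv hn ha l).1 (place hn p) * h2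
  f_other m l l' h := by
    rw [tupleRep_ket_apply, (R.isSemiInfiniteModule hu a).f_other, mul_zero, mul_zero]
    rintro ⟨j, hj⟩
    obtain ⟨p, rfl⟩ := (place hn).surjective j
    exact h ⟨p, (tupleAdds_iff hn ha).mpr (admAdds_iff.mp hj)⟩
  psiPlus m l := by
    rw [tupleRep_apply, scaledRelabel_ket, map_smul, (R.isSemiInfiniteModule hu a).psiPlus,
      smul_comm, map_smul, map_smul, scaledRelabel_symm_ket, smul_inv_smul₀ (hc _), expandInfinity,
      expandInfinity, ← R.tensorPsi_eq isGeneric_X_inv (tuplesEquiv hn ha l).2, untuple_tuplesEquiv]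
  psiMinus m l := by
    rw [tupleRep_apply, scaledRelabel_ket, map_smul, (R.isSemiInfiniteModule hu a).psiMinus,
      smul_comm, map_smul, map_smul, scaledRelabel_symm_ket, smul_inv_smul₀ (hc _), expandZero,
      expandZero, ← R.tensorPsi_eq isGeneric_X (tuplesEquiv hn ha l).2, untuple_tuplesEquiv]

end Gauge

end QuantumGl

end

theorem mainTheorem3 (q1 q2 q3 u : ℂ) (n r : ℕ) (a : Fin n → ℕ)
    (hq : q1 * q2 * q3 = 1) (hu : u ≠ 0) (hn : 2 ≤ n) (hr : 2 ≤ r) (ha : ∑ i, a i = r)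
    (hres : ∀ x y : ℤ, q1 ^ x * q3 ^ y = 1 ↔
      ∃ κ : ℤ, x = ((n : ℤ) + r) * κ ∧ y = ((n : ℤ) + 1) * κ) :
    ∃ (ρM : QuantumGl.Alg q1 q2 q3 →ₐ[ℂ]
          Module.End ℂ (QuantumGl.Tuples a (QuantumGl.bZero n) →₀ ℂ))
      (ρG : QuantumGl.Alg q1 q2 q3 →ₐ[ℂ] Module.End ℂ (QuantumGl.Admissible n r a →₀ ℂ)),
      QuantumGl.IsTupleModule u a (QuantumGl.bZero n) ρM ∧
      QuantumGl.IsSemiInfiniteModule u n r a ρG ∧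
      QuantumGl.IsGradedModule ρM QuantumGl.tupleDeg ∧
      QuantumGl.IsGradedModule ρG QuantumGl.admDeg ∧
      ∃ (β : QuantumGl.Tuples a (QuantumGl.bZero n) ≃ QuantumGl.Admissible n r a)
        (c : QuantumGl.Admissible n r a → ℂ)
        (iota : (QuantumGl.Tuples a (QuantumGl.bZero n) →₀ ℂ) ≃ₗ[ℂ]
          (QuantumGl.Admissible n r a →₀ ℂ)),
        (∀ l (i : Fin n) (s : ℕ),
          (β l).1 (n * s + i) = l.1 i s + QuantumGl.vacuum n r a (n * s + i)) ∧
        (∀ L, c L ≠ 0) ∧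
        (∀ l, iota (QuantumGl.ket l) = c (β l) • QuantumGl.ket (β l)) ∧
        (∀ x y, iota (ρM x y) = ρG x (iota y)) ∧
        (∀ d : ℤ, (QuantumGl.modGrade QuantumGl.tupleDeg d).map
            (iota : (QuantumGl.Tuples a (QuantumGl.bZero n) →₀ ℂ) →ₗ[ℂ]
              (QuantumGl.Admissible n r a →₀ ℂ)) =
          QuantumGl.modGrade QuantumGl.admDeg d) := by
  have hn0 : 0 < n := by omega
  have R : QuantumGl.Resonant q1 q2 q3 n r := ⟨hq, hn, hr, hres⟩
  obtain ⟨c, hc, hgauge⟩ := R.exists_gauge hu hn0 a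
  have hM := QuantumGl.isTupleModule_tupleRep R hu hn0 ha hc hgauge
  have hG := R.isSemiInfiniteModule hu a
  have hdeg := QuantumGl.admDeg_tuplesEquiv hn0 ha
  refine ⟨_, _, hM, hG, QuantumGl.HasMatrixCoefficients.isGradedModule hM _ fun l p l' h => ?_,
    QuantumGl.HasMatrixCoefficients.isGradedModule hG _ QuantumGl.admDeg_of_adds,
    QuantumGl.tuplesEquiv hn0 ha, fun L => c L.1,
    QuantumGl.scaledRelabel (QuantumGl.tuplesEquiv hn0 ha) (fun L => c L.1) fun L => hc L.1,
    fun l i s => QuantumGl.toSeq_place hn0 l.1 i s, fun L => hc L.1,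
    QuantumGl.scaledRelabel_ket _ _ _, fun x y => ?_, QuantumGl.map_modGrade _ _ _ hdeg⟩
  · rw [← hdeg, ← hdeg]
    exact QuantumGl.admDeg_of_adds _ (QuantumGl.place hn0 p) _
      (QuantumGl.admAdds_iff.mpr ((QuantumGl.tupleAdds_iff hn0 ha).mp h))
  · rw [QuantumGl.tupleRep_apply, LinearEquiv.apply_symm_apply]
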